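/- **Setting.** Let $f\in C^2(\mathbb R)$ with $f''\ge 0$ and $\{f''=0\}$ Lebesgue null, let $\varphi\in L^\infty(\mathbb R)$, and consider $u_t+f(u)_x=0$ on $\mathbb R\times(0,\infty)$, $u|_{t=0}=\varphi$. A *weak solution* is a bounded measurable $u$ with $\iint(u\psi_t+f(u)\psi_x)\,dx\,dt=0$ for all $\psi\in C_c^\infty(\mathbb R\times(0,\infty))$ and $\int_{x_1}^{x_2}u(x,t)\,dx\to\int_{x_1}^{x_2}\varphi\,dx$ as $t\to0+$ for all $x_1,x_2$. It is an *entropy solution* if $f'(u(x_2,t))-f'(u(x_1,t))\le (x_2-x_1)/t$ for all $x_1<x_2$, $t>0$. Let $u$ be the entropy solution, in its time-continuous representative: $t\mapsto\int_{x_1}^{x_2}u(x,t)\,dx$ is continuous on $(0,\infty)$ for all $x_1,x_2$. *Divides.* Let $E(v;x,t)=t\int_0^v f''(s)(\varphi(x-tf'(s))-s)\,ds$ and let $\mathcal U(x,t)$ be the set of maximum points of $E(\cdot\,;x,t)$. For $x_0\in\mathbb R$ let $\mathcal D(x_0)$ be the set of $c$ with $\mathcal U(x_0+tf'(c),t)=\{c\}$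 for all $t>0$; the line $x=x_0+tf'(c)$, $t>0$, is then called a divide. *Contact set.* Let $\Phi(x)=\int_0^x\varphi$, let $\bar\Phi$ be its convex hull over $\mathbb R$ (greatest convex minorant, $-\infty$ if there is none), $\mathcal K_0=\{\Phi=\bar\Phi\}$, $\overline u_l=\limsup_{x\to-\infty}\frac1x\int_0^x\varphi$, $\underline u_r=\liminf_{x\to\infty}\frac1x\int_0^x\varphi$. Let $\mathrm D_\pm\bar\Phi$ be the one-sided derivatives, and $\underline{\mathrm D}_+\Phi(x)=\liminf_{l\to0+}\frac1l\int_x^{x+l}\varphi$, $\overline{\mathrm D}_-\Phi(x)=\limsup_{l\to0-}\frac1l\int_x^{x+l}\varphi$. *Regions.* $\mathcal K$ is the union of all divides issuing from points of $\mathcal K_0$. For a bounded component $(e_n,h_n)$ of $\mathbb R\setminus\mathcal K_0$ put $c_n=\frac{\Phi(h_n)-\Phi(e_n)}{h_n-e_n}$, $e_n(t)=e_n+tf'(c_n)$, $h_n(t)=h_n+tf'(c_n)$, $\mathcal H_{(e_n,h_n)}=\{t>0,\ e_n(t)<x<h_n(t)\}$. If $x_0^+=\sup\mathcal K_0<\infty$,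 put $x_0^+(t)=x_0^++tf'(\underline u_r)$, $\mathcal H_\infty=\{t>0,\ x>x_0^+(t)\}$. If $x_0^-=\inf\mathcal K_0>-\infty$, put $x_0^-(t)=x_0^-+tf'(\overline u_l)$, $\mathcal H_{-\infty}=\{t>0,\ x<x_0^-(t)\}$. *Forward generalized characteristics.* The backward characteristic triangle of $(x,t)$ is the union of the segments $\{(x+(\tau-t)f'(v),\tau):0<\tau<t\}$ over $v\in[u(x+,t),u(x-,t)]$. A forward generalized characteristic is a continuous curve $x(t)$, $t\ge t_0\ge0$, along which (for $t>0$) the backward characteristic triangles are nested increasingly in $t$. "In a region" means that $(x(t),t)$ lies in it for all $t\ge t_0$, $t>0$. Write $y^\pm(t)=x(t)-tf'(u(x(t)\pm,t))$. *Generalized $N$-wave.* Choose in each $\mathcal H_{(e_n,h_n)}$, and in each of $\mathcal H_\infty$, $\mathcal H_{-\infty}$ that exists, a forward generalized characteristic $x_n$, $x_+$, $x_-$ starting at time $0$. Then $w(x,t)=(f')^{-1}\big(\frac{x-\xi}t\big)$, wherever this is defined, with: $\xi=x_0$ on a divide issuing from $x_0\in\mathcal K_0$; $\xi=e_n$ if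 $e_n(t)<x<x_n(t)$; $\xi=h_n$ if $x_n(t)<x<h_n(t)$; $\xi=x_0^+$ if $x_0^+(t)<x<x_+(t)$; $\xi=x_0^-$ if $x_-(t)<x<x_0^-(t)$. *Degeneracy exponents.* $\alpha_n,\alpha_r,\alpha_l\ge0$ denote exponents $\alpha$ with $f''(v)=(N_\pm+o(1))|v-c|^{\alpha}$ as $v\to c\pm$ for some $N_\pm>0$, where $c=c_n,\underline u_r,\overline u_l$ respectively. Each statement below that contains such an exponent assumes that it exists (part (i)(a) assumes $\alpha_n$ with $N_+=N_-$). *Notation.* As $t\to\infty$: $F\lesssim g$ means $F\le Cg$ for large $t$ with a constant $C$; $F\lessapprox g$ means $F\le(1+o(1))g$. $\|g\|_{L^q(I)}=(\int_I|g|^q)^{1/q}$ for every real $q>0$. Write $\Delta(t)=f'(u(\cdot,t))-f'(w(\cdot,t))$. **Theorem.** Suppose that $\overline u_l<\underline u_r$, or $\overline u_l=\underline u_r$ and $\mathcal K_0\ne\varnothing$. Let $p\in[1,\infty)$, $\varphi-\underline u_r\in L^p([0,\infty))$, $\varphi-\overline u_l\in L^p((-\infty,0])$, and let $w$ be a generalized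 $N$-wave. Then $u=w$ on $\mathcal K$, and as $t\to\infty$: (i) For each bounded component $(e_n,h_n)$: (a) for any forward generalized characteristic in $\mathcal H_{(e_n,h_n)}$ and any $q>0$, $$\|\Delta(t)\|_{L^q([e_n(t),h_n(t)])}\lessapprox\Big(\frac{h_n-e_n}2\Big)^{1/q}\big((y^-(t)-e_n)^q+(h_n-y^+(t))^q\big)^{1/q}t^{-1};$$ (b) if, for some $\sigma_n>0$ and $C>0$, $\int_{e_n}^x(\varphi-c_n)\ge C|x-e_n|^{1+\sigma_n}$ for $x>e_n$ near $e_n$ and $\int_{h_n}^x(\varphi-c_n)\ge C|x-h_n|^{1+\sigma_n}$ for $x<h_n$ near $h_n$, then for any $q>0$, $\|\Delta(t)\|_{L^q([e_n(t),h_n(t)])}\lesssim t^{-1-\frac1{\sigma_n(1+\alpha_n)}}$. (ii) If $x_0^+<\infty$, then for any forward generalized characteristic $x(t)$ in $\mathcal H_\infty$ and any $q>\frac p{p+1+\alpha_r}$, $$\|\Delta(t)\|_{L^q([x_0^+(t),x(t)])}\lesssim (y^-(t)-x_0^+)\,t^{-1+\frac{p/q}{p+1+\alpha_r}};$$ if moreover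 $\int_{x_0^+}^x(\varphi-\underline u_r)\ge C|x-x_0^+|^{1+\sigma_r}$ for $x>x_0^+$ near $x_0^+$, with some $\sigma_r,C>0$, this norm is $\lesssim t^{-1+\frac{p/q}{p+1+\alpha_r}-\frac{1/\sigma_r}{p+1+\alpha_r}}$. (iii) If $x_0^->-\infty$, then for any forward generalized characteristic $x(t)$ in $\mathcal H_{-\infty}$ and any $q>\frac p{p+1+\alpha_l}$, $$\|\Delta(t)\|_{L^q([x(t),x_0^-(t)])}\lesssim (x_0^--y^+(t))\,t^{-1+\frac{p/q}{p+1+\alpha_l}};$$ if moreover $\int_{x_0^-}^x(\varphi-\overline u_l)\ge C|x-x_0^-|^{1+\sigma_l}$ for $x<x_0^-$ near $x_0^-$, with some $\sigma_l,C>0$, this norm is $\lesssim t^{-1+\frac{p/q}{p+1+\alpha_l}-\frac{1/\sigma_l}{p+1+\alpha_l}}$. (iv) For any two divides $e(t)<h(t)$ and any $q>0$, $\|\Delta(t)\|_{L^q([e(t),h(t)])}\le o(1)\,t^{-1}$. (v) Let $x_1(t),x_2(t)$ be forward generalized characteristics in one of the cases: (l) $x_1$ in $\mathcal H_{-\infty}$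 and $x_2$ in some $\mathcal H_{(e_n,h_n)}$ or a divide; (r) $x_1$ in some $\mathcal H_{(e_n,h_n)}$ or a divide and $x_2$ in $\mathcal H_\infty$; (lr) $x_1$ in $\mathcal H_{-\infty}$ and $x_2$ in $\mathcal H_\infty$. Let $\alpha=\alpha_l$, $\alpha_r$, $\min\{\alpha_l,\alpha_r\}$ respectively. Then for any $q>\frac p{p+1+\alpha}$, $$\|\Delta(t)\|_{L^q([x_1(t),x_2(t)])}\le o(1)\,t^{-1+\frac{p/q}{p+1+\alpha}}.$$ If, in addition, $\overline{\mathrm D}_-\Phi(x_0^-)<\mathrm D_-\bar\Phi(x_0^-)$ in case (l), $\mathrm D_+\bar\Phi(x_0^+)<\underline{\mathrm D}_+\Phi(x_0^+)$ in case (r), both in case (lr), then, with no assumption on the degeneracy exponents, $\|\Delta(t)\|_{L^q([x_1(t),x_2(t)])}\le o(1)\,t^{-1}$ for any $q>0$. -/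

import Mathlib

open MeasureTheory Filter Set
open scoped Topology ENNReal ContDiff

noncomputable section

namespace ConvexLaw

/-- The flux: `f ∈ C²(ℝ)`, `f'' ≥ 0`, and the zero set of `f''` is Lebesgue null. -/
structure IsFlux (f : ℝ → ℝ) : Prop where
  contDiff : ContDiff ℝ 2 f
  nonneg : ∀ v, 0 ≤ deriv (deriv f) v
  null : volume {v | deriv (deriv f) v = 0} = 0

/-- Weak solutions of `u_t + f(u)_x = 0`, `u|_{t=0} = φ`; only the values `u x t` with `t > 0`
matter. -/
structure IsWeakSolution (f φ : ℝ → ℝ) (u : ℝ → ℝ → ℝ) : Prop where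
  aemeasurable : AEMeasurable (fun P : ℝ × ℝ => u P.1 P.2) (volume.restrict (univ ×ˢ Ioi 0))
  bounded : ∃ M : ℝ, ∀ x t, 0 < t → |u x t| ≤ M
  weak : ∀ ψ : ℝ × ℝ → ℝ, ContDiff ℝ ∞ ψ → HasCompactSupport ψ → tsupport ψ ⊆ univ ×ˢ Ioi 0 →
    ∫ P in univ ×ˢ Ioi (0 : ℝ),
      (u P.1 P.2 * fderiv ℝ ψ P (0, 1) + f (u P.1 P.2) * fderiv ℝ ψ P (1, 0)) = 0
  initial : ∀ x₁ x₂ : ℝ,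
    Tendsto (fun t => ∫ x in x₁..x₂, u x t) (𝓝[>] 0) (𝓝 (∫ x in x₁..x₂, φ x))

/-- Entropy solutions: weak solutions with the Oleinik-type one-sided inequality. -/
structure IsEntropySolution (f φ : ℝ → ℝ) (u : ℝ → ℝ → ℝ) : Prop extends
    IsWeakSolution f φ u where
  oleinik : ∀ x₁ x₂ t : ℝ, x₁ < x₂ → 0 < t →
    deriv f (u x₂ t) - deriv f (u x₁ t) ≤ (x₂ - x₁) / t

/-- The time-continuous representative: `t ↦ u(·,t)` is continuous on `(0,∞)` when tested against
indicators of bounded intervals. (A weak solution can otherwise be altered at will on a null set of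
times, so that its values at an individual time carry no information.) -/
def IsTimeContinuous (u : ℝ → ℝ → ℝ) : Prop :=
  ∀ x₁ x₂ : ℝ, ContinuousOn (fun t => ∫ x in x₁..x₂, u x t) (Ioi 0)

/-- The function `E(v; x, t)` whose maximizers in `v` give the solution. -/
def energy (f φ : ℝ → ℝ) (v x t : ℝ) : ℝ :=
  t * ∫ s in (0 : ℝ)..v, deriv (deriv f) s * (φ (x - t * deriv f s) - s)

/-- `𝒰(x,t)`, the set of maximum points of `E(·; x, t)`. -/
def maximizers (f φ : ℝ → ℝ) (x t : ℝ) : Set ℝ :=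
  {v | ∀ v', energy f φ v' x t ≤ energy f φ v x t}

/-- `𝒟(x₀)`, the set of divide generation values of `x₀`: `c ∈ 𝒟(x₀)` means that the line
`x = x₀ + t f'(c)`, `t > 0`, is a divide. -/
def divideValues (f φ : ℝ → ℝ) (x₀ : ℝ) : Set ℝ :=
  {c | ∀ t, 0 < t → maximizers f φ (x₀ + t * deriv f c) t = {c}}

/-- `Φ(x) = ∫₀ˣ φ`. -/
def primitive (φ : ℝ → ℝ) (x : ℝ) : ℝ := ∫ y in (0 : ℝ)..x, φ y

/-- The convex hull of `Φ` over `(-∞,∞)`: the greatest convex minorant of `Φ`, equal to `-∞` if there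
is no convex minorant. -/
def convHull (φ : ℝ → ℝ) (x : ℝ) : EReal :=
  ⨆ g : {g : ℝ → ℝ // ConvexOn ℝ univ g ∧ ∀ y, g y ≤ primitive φ y}, ((g.1 x : ℝ) : EReal)

/-- `𝒦₀`, the contact set of `Φ` and its convex hull. -/
def contactSet (φ : ℝ → ℝ) : Set ℝ := {x | (primitive φ x : EReal) = convHull φ x}

/-- One-sided derivatives of the convex hull of `Φ`. -/
def hullDerivRight (φ : ℝ → ℝ) (x : ℝ) : ℝ := derivWithin (fun y => (convHull φ y).toReal) (Ioi x) x

/-- See `hullDerivRight`. -/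
def hullDerivLeft (φ : ℝ → ℝ) (x : ℝ) : ℝ := derivWithin (fun y => (convHull φ y).toReal) (Iio x) x

/-- The lower right Dini derivative of `Φ`. -/
def diniLowerRight (φ : ℝ → ℝ) (x : ℝ) : ℝ :=
  liminf (fun l : ℝ => (1 / l) * ∫ y in x..(x + l), φ y) (𝓝[>] 0)

/-- The upper left Dini derivative of `Φ`. -/
def diniUpperLeft (φ : ℝ → ℝ) (x : ℝ) : ℝ :=
  limsup (fun l : ℝ => (1 / l) * ∫ y in x..(x + l), φ y) (𝓝[<] 0)

/-- `ū_l`, the limsup of `(1/x) ∫₀ˣ φ` as `x → -∞`. -/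
def meanUpperLeft (φ : ℝ → ℝ) : ℝ := limsup (fun x : ℝ => (1 / x) * ∫ y in (0 : ℝ)..x, φ y) atBot

/-- `u̲_r`, the liminf of `(1/x) ∫₀ˣ φ` as `x → ∞`. -/
def meanLowerRight (φ : ℝ → ℝ) : ℝ := liminf (fun x : ℝ => (1 / x) * ∫ y in (0 : ℝ)..x, φ y) atTop

/-- `𝒦`, the union of all divides. -/
def divideSet (f φ : ℝ → ℝ) : Set (ℝ × ℝ) :=
  {P | 0 < P.2 ∧ ∃ x₀ ∈ contactSet φ, ∃ c ∈ divideValues f φ x₀, P.1 = x₀ + P.2 * deriv f c}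

/-- `(e,h)` is a bounded connected component of the complement of the (closed) set `𝒦₀`. -/
structure IsGap (φ : ℝ → ℝ) (e h : ℝ) : Prop where
  lt : e < h
  left_mem : e ∈ contactSet φ
  right_mem : h ∈ contactSet φ
  disjoint : ∀ x, e < x → x < h → x ∉ contactSet φ

/-- `c_n`, the slope of the convex hull of `Φ` on the gap `(e,h)`. -/
def gapValue (φ : ℝ → ℝ) (e h : ℝ) : ℝ := (primitive φ h - primitive φ e) / (h - e)

/-- `ℋ_{(e,h)}`. -/
def gapRegion (f φ : ℝ → ℝ) (e h : ℝ) : Set (ℝ × ℝ) :=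
  {P | 0 < P.2 ∧ e + P.2 * deriv f (gapValue φ e h) < P.1 ∧
    P.1 < h + P.2 * deriv f (gapValue φ e h)}

/-- `ℋ_∞`, where `b = sup 𝒦₀`. -/
def rightRegion (f φ : ℝ → ℝ) (b : ℝ) : Set (ℝ × ℝ) :=
  {P | 0 < P.2 ∧ b + P.2 * deriv f (meanLowerRight φ) < P.1}

/-- `ℋ_{-∞}`, where `a = inf 𝒦₀`. -/
def leftRegion (f φ : ℝ → ℝ) (a : ℝ) : Set (ℝ × ℝ) :=
  {P | 0 < P.2 ∧ P.1 < a + P.2 * deriv f (meanUpperLeft φ)}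

/-- The trace `u(x-,t)`. -/
def traceLeft (u : ℝ → ℝ → ℝ) (x t : ℝ) : ℝ := Function.leftLim (fun y => u y t) x

/-- The trace `u(x+,t)`. -/
def traceRight (u : ℝ → ℝ → ℝ) (x t : ℝ) : ℝ := Function.rightLim (fun y => u y t) x

/-- The backward characteristic triangle from the point `(x,t)`: the union of the segments
`{(x + (τ - t) f'(v), τ) : 0 < τ < t}` over `v ∈ [u(x+,t), u(x-,t)]`. -/
def backwardTriangle (f : ℝ → ℝ) (u : ℝ → ℝ → ℝ) (x t : ℝ) : Set (ℝ × ℝ) :=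
  {P | 0 < P.2 ∧ P.2 < t ∧
    ∃ v ∈ Icc (traceRight u x t) (traceLeft u x t), P.1 = x + (P.2 - t) * deriv f v}

/-- `x(t)`, `t ≥ s ≥ 0`, is a forward generalized characteristic: a continuous curve along which the
backward characteristic triangles are nested. -/
structure IsForwardChar (f : ℝ → ℝ) (u : ℝ → ℝ → ℝ) (s : ℝ) (X : ℝ → ℝ) : Prop where
  start_nonneg : 0 ≤ s
  continuousOn : ContinuousOn X (Ici s)
  nested : ∀ t₁ t₂, s ≤ t₁ → 0 < t₁ → t₁ < t₂ →
    backwardTriangle f u (X t₁) t₁ ⊆ backwardTriangle f u (X t₂) t₂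

/-- `x(t)`, `t ≥ s`, is a forward generalized characteristic that lies in the region `R`. -/
def IsForwardCharIn (f : ℝ → ℝ) (u : ℝ → ℝ → ℝ) (R : Set (ℝ × ℝ)) (s : ℝ) (X : ℝ → ℝ) : Prop :=
  IsForwardChar f u s X ∧ ∀ t, s ≤ t → 0 < t → (X t, t) ∈ R

/-- A forward generalized characteristic away from `ℋ_{±∞}`: it lies in some `ℋ_{(e,h)}` with `e`, `h`
finite, or it is a divide. -/
def IsInnerChar (f φ : ℝ → ℝ) (u : ℝ → ℝ → ℝ) (X : ℝ → ℝ) : Prop :=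
  (∃ e h s, IsGap φ e h ∧ IsForwardCharIn f u (gapRegion f φ e h) s X) ∨
    ∃ x₀, ∃ c ∈ divideValues f φ x₀, ∀ t, 0 < t → X t = x₀ + t * deriv f c

/-- `y⁻(t,0)` for the point `x = x(t)`: the foot on the `x`-axis of the backward characteristic with
the left trace. -/
def footLeft (f : ℝ → ℝ) (u : ℝ → ℝ → ℝ) (x t : ℝ) : ℝ := x - t * deriv f (traceLeft u x t)

/-- `y⁺(t,0)`, with the right trace. -/
def footRight (f : ℝ → ℝ) (u : ℝ → ℝ → ℝ) (x t : ℝ) : ℝ := x - t * deriv f (traceRight u x t)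

/-- `w(x,t) = (f')⁻¹((x - ξ)/t)`, wherever the right-hand side is defined. -/
def WaveAt (f : ℝ → ℝ) (w : ℝ → ℝ → ℝ) (ξ x t : ℝ) : Prop :=
  (x - ξ) / t ∈ range (deriv f) → deriv f (w x t) = (x - ξ) / t

/-- `w` is a generalized `N`-wave: it is `(f')⁻¹((x - ξ)/t)` with `ξ ∈ 𝒦₀`, where the forward
generalized characteristics (one in each region, starting at time `0`) may be chosen arbitrarily. -/
structure IsNWave (f φ : ℝ → ℝ) (u w : ℝ → ℝ → ℝ) : Prop where
  on_divides : ∀ x₀ ∈ contactSet φ, ∀ c ∈ divideValues f φ x₀, ∀ t, 0 < t →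
    WaveAt f w x₀ (x₀ + t * deriv f c) t
  on_gaps : ∀ e h, IsGap φ e h → ∃ X : ℝ → ℝ, IsForwardCharIn f u (gapRegion f φ e h) 0 X ∧
    ∀ x t, 0 < t →
      (e + t * deriv f (gapValue φ e h) < x → x < X t → WaveAt f w e x t) ∧
      (X t < x → x < h + t * deriv f (gapValue φ e h) → WaveAt f w h x t)
  on_right : ∀ b, IsLUB (contactSet φ) b → ∃ X : ℝ → ℝ,
    IsForwardCharIn f u (rightRegion f φ b) 0 X ∧
    ∀ x t, 0 < t → b + t * deriv f (meanLowerRight φ) < x → x < X t → WaveAt f w b x t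
  on_left : ∀ a, IsGLB (contactSet φ) a → ∃ X : ℝ → ℝ,
    IsForwardCharIn f u (leftRegion f φ a) 0 X ∧
    ∀ x t, 0 < t → X t < x → x < a + t * deriv f (meanUpperLeft φ) → WaveAt f w a x t

/-- `f''(v) = (N_± + o(1)) |v - c|^α` as `v → c±`. -/
structure HasDegeneracy (f : ℝ → ℝ) (c α Nminus Nplus : ℝ) : Prop where
  order_nonneg : 0 ≤ α
  minus_pos : 0 < Nminus
  plus_pos : 0 < Nplus
  minus : Tendsto (fun v => deriv (deriv f) v / |v - c| ^ α) (𝓝[<] c) (𝓝 Nminus)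
  plus : Tendsto (fun v => deriv (deriv f) v / |v - c| ^ α) (𝓝[>] c) (𝓝 Nplus)

/-- `∫_ξ^x (φ - c) ≥ O(1) |x - ξ|^(1+σ)` as `x → ξ` along the filter `l`, where `O(1)` is a positive
constant. -/
def HasGrowth (φ : ℝ → ℝ) (c ξ σ : ℝ) (l : Filter ℝ) : Prop :=
  ∃ C : ℝ, 0 < C ∧ ∀ᶠ x in l, C * |x - ξ| ^ (1 + σ) ≤ ∫ y in ξ..x, (φ y - c)

/-- `‖f'(u(·,t)) - f'(w(·,t))‖` in `L^q([a,b])`, `q > 0`. -/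
def lqDist (f : ℝ → ℝ) (u w : ℝ → ℝ → ℝ) (q a b t : ℝ) : ℝ≥0∞ :=
  eLpNorm (fun x => deriv f (u x t) - deriv f (w x t)) (ENNReal.ofReal q)
    (volume.restrict (Icc a b))

/-- `F(t) ≤ o(1) g(t)` as `t → ∞`. -/
def LeSmallO (F : ℝ → ℝ≥0∞) (g : ℝ → ℝ) : Prop :=
  ∀ δ : ℝ, 0 < δ → ∀ᶠ t in atTop, F t ≤ ENNReal.ofReal (δ * g t)

/-- `F(t) ≤ O(1) g(t)` as `t → ∞`. -/
def LeBigO (F : ℝ → ℝ≥0∞) (g : ℝ → ℝ) : Prop :=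
  ∃ C : ℝ, 0 < C ∧ ∀ᶠ t in atTop, F t ≤ ENNReal.ofReal (C * g t)

/-- `F(t) ≤ (1 + o(1)) g(t)` as `t → ∞`. -/
def LeAsymp (F : ℝ → ℝ≥0∞) (g : ℝ → ℝ) : Prop :=
  ∀ δ : ℝ, 0 < δ → ∀ᶠ t in atTop, F t ≤ ENNReal.ofReal ((1 + δ) * g t)

end ConvexLaw

end

/-!
Asymptotics of entropy solutions of `u_t + f(u)_x = 0` in terms of generalized `N`-waves, by the
Hopf–Lax formula.

The form `u dx - f(u) dt` is closed, so an entropy solution has a potential `U` with `U_x = u`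
(`IsEntropySolution.exists_potential`). With `K` the primitive of the initial values, `U(x,t)` is up
to a constant the minimum over `v` of the cost `K(x - t f'(v)) + t (v f'(v) - f(v))`
(`IsPotential.hopfLax`), and the one-sided limits of `u(·,t)` at `x` are the largest and the smallest
minimizer (`IsEntropySolution.isLaxMin_traces`). The cost is minus the energy up to a constant, so a
line `x = x₀ + t f'(c)` is a divide if and only if `z ↦ K(x₀) + c (z - x₀)` supports `K` from below
(`mem_divideValues_iff`). The contact set is the set of points with a supporting line
(`mem_contactSet_iff`), and on a divide `u` and `w` both equal `c`.

Away from the divides everything is expressed by the foot `x - t f'(u(x,t))` of the backward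
characteristic. Where the wave is centred at `ξ` one has `f'(u) - f'(w) = (ξ - foot) / t`
(`IsWaveProblem.exists_sub_eq`), so an `L^q` norm over an interval is controlled by the length of the
interval and by the distance of the feet from `ξ`. The feet are ordered in `x`, so on either side of
a forward generalized characteristic this distance is largest at the characteristic itself. Along the
characteristic the left feet decrease and the right feet increase in time (`IsShockCurve`), hence
converge, and a limit of feet is a contact point, because dividing the minimizing property of the
cost by large `t` turns it into a supporting line (`isSupport_of_tendsto_foot`). Over a gap `(e,h)` of
the contact set the left feet must therefore tend to `e` and the right feet to `h`; right of the last
contact point the left feet tend to that point. In particular two characteristics in the same region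
merge, which makes the choice of characteristics in `w` immaterial.

The rates come from comparing a left minimizer `v` with the state that joins the limit `b` of the
feet to the same point. A lower bound for the growth of `K` above its supporting line at `b` then
bounds the distance of the foot from `b` (`IsShockCurve.footLeft_rate`), and a linear lower bound,
which is what the Dini condition gives, makes this distance vanish in finite time
(`IsShockCurve.eventually_footLeft_eq`). An upper bound for that growth, which Hölder's inequality
gives when `φ - c ∈ L^p`, bounds the width of the unbounded region left of the characteristic
(`IsShockCurve.width_rate`). Over a gap on which `f''` has the same leading term on both sides of the
slope, equality of the costs at the two ends puts the characteristic asymptotically into the middle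
(`IsShockCurve.eventually_width_le`). Between two divides each gap contributes `o(1) / t` and the
gaps have finite total length, so dominated convergence applies (`IsWaveProblem.leSmallO_inner`).

Statements on the left are deduced from those on the right by the reflection
`x ↦ -x`, `v ↦ -v`, under which `f` becomes `v ↦ f (-v)` and `K` becomes `z ↦ K (-z)`.
-/

noncomputable section

namespace ConvexLaw

/-! ### Flux functions and the Legendre transform -/

namespace IsFlux

variable {f : ℝ → ℝ}

theorem differentiable (hf : IsFlux f) : Differentiable ℝ f :=
  hf.contDiff.differentiable (by norm_num)

theorem contDiff_deriv (hf : IsFlux f) : ContDiff ℝ 1 (deriv f) := by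
  have h : ContDiff ℝ (1 + 1) f := by simpa [one_add_one_eq_two] using hf.contDiff
  exact (contDiff_succ_iff_deriv.1 h).2.2

theorem continuous_deriv (hf : IsFlux f) : Continuous (deriv f) := hf.contDiff_deriv.continuous

theorem differentiable_deriv (hf : IsFlux f) : Differentiable ℝ (deriv f) :=
  hf.contDiff_deriv.differentiable (by norm_num)

theorem continuous_deriv2 (hf : IsFlux f) : Continuous (deriv (deriv f)) :=
  hf.contDiff_deriv.continuous_deriv (by norm_num)

theorem continuous (hf : IsFlux f) : Continuous f := hf.differentiable.continuous

theorem strictMono (hf : IsFlux f) : StrictMono (deriv f) := by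
  have hm : Monotone (deriv f) := monotone_of_deriv_nonneg hf.differentiable_deriv hf.nonneg
  intro x y hxy
  refine lt_of_le_of_ne (hm hxy.le) fun heq => ?_
  -- on an interval where `f'` is constant, `f''` vanishes on a set of positive measure
  have hc : ∀ z ∈ Ioo x y, deriv (deriv f) z = 0 := by
    intro z hz
    have : deriv f =ᶠ[𝓝 z] fun _ => deriv f x := by
      filter_upwards [Ioo_mem_nhds hz.1 hz.2] with w hw
      exact le_antisymm ((hm hw.2.le).trans heq.ge) (hm hw.1.le)
    rw [this.deriv_eq, deriv_const]
  have h0 : volume (Ioo x y) ≤ 0 := hf.null ▸ measure_mono hc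
  simp at h0
  linarith

theorem tangent_lt (hf : IsFlux f) {v v' : ℝ} (h : v ≠ v') :
    f v + deriv f v * (v' - v) < f v' := by
  rcases lt_or_gt_of_ne h with h | h
  · obtain ⟨ξ, hξ, he⟩ := exists_deriv_eq_slope f h hf.continuous.continuousOn
      hf.differentiable.differentiableOn
    have h1 := hf.strictMono hξ.1
    rw [he, lt_div_iff₀ (by linarith)] at h1
    linarith
  · obtain ⟨ξ, hξ, he⟩ := exists_deriv_eq_slope f h hf.continuous.continuousOn
      hf.differentiable.differentiableOn
    have h1 := hf.strictMono hξ.2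
    rw [he, div_lt_iff₀ (by linarith)] at h1
    linarith

end IsFlux

/-- The Legendre transform of `f` at the slope `f'(v)`, parametrized by `v`. -/
def legendre (f : ℝ → ℝ) (v : ℝ) : ℝ := v * deriv f v - f v

section Legendre

variable {f : ℝ → ℝ}

/-- `v` is a subgradient of the Legendre transform at the slope `f'(v)`. -/
theorem legendre_sub_gt (hf : IsFlux f) {v v' : ℝ} (h : v ≠ v') :
    v * (deriv f v' - deriv f v) < legendre f v' - legendre f v := by
  have := hf.tangent_lt h.symm
  unfold legendre
  linarith

theorem legendre_sub_ge (hf : IsFlux f) (v v' : ℝ) :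
    v * (deriv f v' - deriv f v) ≤ legendre f v' - legendre f v := by
  rcases eq_or_ne v v' with rfl | h
  · simp
  · exact (legendre_sub_gt hf h).le

theorem legendre_sub_le (hf : IsFlux f) (v v' : ℝ) :
    legendre f v' - legendre f v ≤ v' * (deriv f v' - deriv f v) := by
  have := legendre_sub_ge hf v' v
  linarith

/-- Young's inequality. -/
theorem deriv_mul_sub_le_legendre (hf : IsFlux f) (v s : ℝ) :
    deriv f v * s - f s ≤ legendre f v := by
  rcases eq_or_ne v s with rfl | h
  · unfold legendre; linarith
  · have := hf.tangent_lt h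
    unfold legendre; linarith

theorem continuous_legendre (hf : IsFlux f) : Continuous (legendre f) :=
  (continuous_id.mul hf.continuous_deriv).sub hf.continuous

/-- The slopes `f'(v)` cover, uniformly for bounded `v`, a neighbourhood of each `f'(v)`. -/
theorem IsFlux.exists_near (hf : IsFlux f) (M : ℝ) {η : ℝ} (hη : 0 < η) :
    ∃ κ > 0, ∀ v, |v| ≤ M → ∀ d, |d| ≤ κ → ∃ v', |v' - v| ≤ η ∧ deriv f v' = deriv f v + d := by
  rcases lt_or_ge M 0 with hM | hM
  · exact ⟨1, one_pos, fun v hv => absurd (abs_nonneg v) (by linarith)⟩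
  set g : ℝ → ℝ := fun v => min (deriv f (v + η) - deriv f v) (deriv f v - deriv f (v - η)) with hg
  have hgc : Continuous g := by
    have := hf.continuous_deriv
    exact ((this.comp (continuous_id.add continuous_const)).sub this).min
      (this.sub (this.comp (continuous_id.sub continuous_const)))
  obtain ⟨v₀, hv₀, hmin⟩ := (isCompact_Icc (a := -M) (b := M)).exists_isMinOn
    (nonempty_Icc.2 (by linarith)) hgc.continuousOn
  have hpos : 0 < g v₀ := lt_min (sub_pos.2 (hf.strictMono (by linarith)))
    (sub_pos.2 (hf.strictMono (by linarith)))
  refine ⟨g v₀, hpos, fun v hv d hd => ?_⟩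
  have hle : g v₀ ≤ g v := hmin (abs_le.1 hv)
  have h1 : g v ≤ deriv f (v + η) - deriv f v := min_le_left _ _
  have h2 : g v ≤ deriv f v - deriv f (v - η) := min_le_right _ _
  have hd' := abs_le.1 hd
  obtain ⟨v', hv', he⟩ := intermediate_value_Icc (show v - η ≤ v + η by linarith)
    hf.continuous_deriv.continuousOn (show deriv f v + d ∈ _ from ⟨by linarith, by linarith⟩)
  exact ⟨v', abs_le.2 ⟨by linarith [hv'.1], by linarith [hv'.2]⟩, he⟩

end Legendre

/-! ### The Hopf–Lax cost -/

/-- The cost `K(x - τ f'(v)) + τ f*(f'(v))` of reaching `x` in time `τ` along a straight line of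
speed `f'(v)`, for the initial potential `K`. -/
def cost (f K : ℝ → ℝ) (τ x v : ℝ) : ℝ := K (x - τ * deriv f v) + τ * legendre f v

/-- `v` minimizes the Hopf–Lax cost at `(x,τ)`. -/
def IsLaxMin (f K : ℝ → ℝ) (τ x v : ℝ) : Prop := ∀ v', cost f K τ x v ≤ cost f K τ x v'

section Cost

variable {f K : ℝ → ℝ} {M : ℝ}

theorem cost_lt_of_gt (hf : IsFlux f) (hK : ∀ x y, |K x - K y| ≤ M * |x - y|) {τ : ℝ} (hτ : 0 < τ)
    (x : ℝ) {v : ℝ} (hv : M < v) : cost f K τ x M < cost f K τ x v := by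
  have h1 := legendre_sub_gt hf hv.ne
  have h2 := (abs_le.1 (hK (x - τ * deriv f M) (x - τ * deriv f v))).2
  have h3 := hf.strictMono hv
  rw [abs_of_nonneg (by nlinarith)] at h2
  unfold cost
  nlinarith

theorem cost_lt_of_lt (hf : IsFlux f) (hK : ∀ x y, |K x - K y| ≤ M * |x - y|) {τ : ℝ} (hτ : 0 < τ)
    (x : ℝ) {v : ℝ} (hv : v < -M) : cost f K τ x (-M) < cost f K τ x v := by
  have h1 := legendre_sub_gt hf hv.ne'
  have h2 := (abs_le.1 (hK (x - τ * deriv f (-M)) (x - τ * deriv f v))).2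
  have h3 := hf.strictMono hv
  rw [abs_of_nonpos (by nlinarith)] at h2
  unfold cost
  nlinarith

theorem IsLaxMin.abs_le (hf : IsFlux f) (hK : ∀ x y, |K x - K y| ≤ M * |x - y|) {τ : ℝ} (hτ : 0 < τ)
    {x v : ℝ} (h : IsLaxMin f K τ x v) : |v| ≤ M := by
  refine _root_.abs_le.2 ⟨?_, ?_⟩ <;> by_contra! hv
  · exact (h (-M)).not_gt (cost_lt_of_lt hf hK hτ x hv)
  · exact (h M).not_gt (cost_lt_of_gt hf hK hτ x hv)

theorem continuous_of_abs_sub_le (hK : ∀ x y, |K x - K y| ≤ M * |x - y|) : Continuous K := by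
  refine (LipschitzWith.of_dist_le_mul (K := M.toNNReal) fun x y => ?_).continuous
  rw [Real.dist_eq, Real.dist_eq]
  exact (hK x y).trans (mul_le_mul_of_nonneg_right (Real.le_coe_toNNReal M) (abs_nonneg _))

theorem continuous_cost (hf : IsFlux f) (hK : Continuous K) (τ x : ℝ) :
    Continuous (cost f K τ x) :=
  (hK.comp (continuous_const.sub (continuous_const.mul hf.continuous_deriv))).add
    (continuous_const.mul (continuous_legendre hf))

theorem exists_isLaxMin (hf : IsFlux f) (hM : 0 ≤ M) (hK : ∀ x y, |K x - K y| ≤ M * |x - y|)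
    {τ : ℝ} (hτ : 0 < τ) (x : ℝ) : ∃ v, IsLaxMin f K τ x v := by
  have hc : Continuous (cost f K τ x) := continuous_cost hf (continuous_of_abs_sub_le hK) τ x
  obtain ⟨v₀, hv₀, hmin⟩ := (isCompact_Icc (a := -M) (b := M)).exists_isMinOn
    (nonempty_Icc.2 (by linarith)) hc.continuousOn
  refine ⟨v₀, fun v => ?_⟩
  rcases lt_or_ge v (-M) with h | h
  · exact (hmin (show -M ∈ Icc (-M) M from ⟨le_rfl, by linarith⟩)).trans
      (cost_lt_of_lt hf hK hτ x h).le
  rcases lt_or_ge M v with h' | h'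
  · exact (hmin (show M ∈ Icc (-M) M from ⟨by linarith, le_rfl⟩)).trans
      (cost_lt_of_gt hf hK hτ x h').le
  · exact hmin ⟨h, h'⟩

end Cost

/-! ### Two lemmas on distributional derivatives -/

/-- The du Bois-Reymond lemma on an open interval. -/
theorem exists_ae_eq_const_of_integral_mul_deriv_eq_zero {U : Set ℝ} (hU : IsOpen U)
    (hc : U.OrdConnected) (hne : U.Nonempty) {h : ℝ → ℝ} (hh : LocallyIntegrableOn h U)
    (H : ∀ θ : ℝ → ℝ, ContDiff ℝ ∞ θ → HasCompactSupport θ → tsupport θ ⊆ U →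
      ∫ x, h x * deriv θ x = 0) :
    ∃ C, ∀ᵐ x, x ∈ U → h x = C := by
  obtain ⟨x₀, hx₀⟩ := hne
  obtain ⟨g₀, hg₀U, hg₀c, hg₀s, hg₀r, hg₀1⟩ :=
    exists_contDiff_tsupport_subset (n := ⊤) (hU.mem_nhds hx₀)
  have hnn : ∀ x, 0 ≤ g₀ x := fun x => (hg₀r (mem_range_self x)).1
  have hI₀ : 0 < ∫ x, g₀ x := by
    refine integral_pos_of_integrable_nonneg_nonzero (x := x₀) hg₀s.continuous
      (hg₀s.continuous.integrable_of_hasCompactSupport hg₀c) hnn (by rw [hg₀1]; norm_num)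
  have hint : ∀ g : ℝ → ℝ, Continuous g → HasCompactSupport g → tsupport g ⊆ U →
      Integrable fun x => g x * h x := by
    intro g hg hgc hgU
    have h1 : IntegrableOn h (tsupport g) := hh.integrableOn_compact_subset hgU hgc
    have h2 : IntegrableOn (fun x => g x * h x) (tsupport g) :=
      h1.continuousOn_mul hg.continuousOn hgc
    refine (integrableOn_iff_integrable_of_support_subset ?_).1 h2
    intro x hx
    exact subset_tsupport _ (left_ne_zero_of_mul hx)
  set C := (∫ x, g₀ x * h x) / ∫ x, g₀ x with hC
  refine ⟨C, ?_⟩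
  have key := hU.ae_eq_zero_of_integral_contDiff_smul_eq_zero (μ := volume)
    (f := fun x => h x - C) (hh.sub (locallyIntegrableOn_const C)) ?_
  · filter_upwards [key] with x hx hxU
    exact sub_eq_zero.1 (hx hxU)
  intro g hgs hgc hgU
  -- a multiple of `g₀` makes the mean of `g` vanish, so that the primitive is a test function
  set k := (∫ x, g x) / ∫ x, g₀ x with hk
  set G : ℝ → ℝ := fun x => g x - k * g₀ x with hG
  have hGs : ContDiff ℝ ∞ G := hgs.sub (contDiff_const.mul hg₀s)
  have hGi : ∫ x, G x = 0 := by
    rw [hG, integral_sub (hgs.continuous.integrable_of_hasCompactSupport hgc)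
      ((hg₀s.continuous.integrable_of_hasCompactSupport hg₀c).const_mul k), integral_const_mul, hk,
      div_mul_cancel₀ _ hI₀.ne', sub_self]
  have hKc : IsCompact (tsupport g ∪ tsupport g₀) := IsCompact.union hgc hg₀c
  have hKne : (tsupport g ∪ tsupport g₀).Nonempty :=
    ⟨x₀, Or.inr (subset_tsupport _ (by rw [Function.mem_support, hg₀1]; norm_num))⟩
  set a := sInf (tsupport g ∪ tsupport g₀)
  set b := sSup (tsupport g ∪ tsupport g₀)
  have haU : a ∈ U := (union_subset hgU hg₀U) (hKc.sInf_mem hKne)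
  have hbU : b ∈ U := (union_subset hgU hg₀U) (hKc.sSup_mem hKne)
  have hab : Icc a b ⊆ U := hc.out haU hbU
  have hsub : tsupport g ∪ tsupport g₀ ⊆ Icc a b := fun x hx =>
    ⟨csInf_le hKc.bddBelow hx, le_csSup hKc.bddAbove hx⟩
  have hG0 : ∀ x, x ∉ Icc a b → G x = 0 := by
    intro x hx
    have h1 : x ∉ tsupport g := fun h => hx (hsub (Or.inl h))
    have h2 : x ∉ tsupport g₀ := fun h => hx (hsub (Or.inr h))
    simp [hG, image_eq_zero_of_notMem_tsupport h1, image_eq_zero_of_notMem_tsupport h2]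
  have hle : a ≤ b := (hsub hKne.some_mem).1.trans (hsub hKne.some_mem).2
  set θ : ℝ → ℝ := fun x => ∫ y in a..x, G y with hθ
  have hderiv : ∀ x, HasDerivAt θ (G x) x := fun x =>
    (hGs.continuous.integral_hasStrictDerivAt a x).hasDerivAt
  have hθ' : deriv θ = G := funext fun x => (hderiv x).deriv
  have hθs : ContDiff ℝ ∞ θ := contDiff_infty_iff_deriv.2
    ⟨fun x => (hderiv x).differentiableAt, hθ' ▸ hGs⟩
  have hθ0 : ∀ x, x ∉ Icc a b → θ x = 0 := by
    intro x hx
    rcases lt_or_ge x a with h | h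
    · refine intervalIntegral.integral_zero_ae (Filter.Eventually.of_forall fun y hy => ?_) |>.trans rfl
      rw [uIoc_of_ge h.le] at hy
      by_cases hya : y = a
      · have hcont : Tendsto G (𝓝[<] a) (𝓝 (G a)) :=
          hGs.continuous.continuousAt.tendsto.mono_left nhdsWithin_le_nhds
        have : Tendsto G (𝓝[<] a) (𝓝 0) := by
          refine tendsto_const_nhds.congr' ?_
          filter_upwards [self_mem_nhdsWithin] with z hz
          exact (hG0 z fun hz' => absurd hz'.1 (not_le.2 hz)).symm
        rw [hya]; exact tendsto_nhds_unique hcont this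
      · exact hG0 y fun hy' => hya (le_antisymm hy.2 hy'.1)
    · have hxb : b < x := by
        by_contra! h'
        exact hx ⟨h, h'⟩
      have : ∫ y, G y = ∫ y in a..x, G y := by
        rw [intervalIntegral.integral_of_le h, ← integral_Icc_eq_integral_Ioc]
        refine (setIntegral_eq_integral_of_forall_compl_eq_zero fun y hy => hG0 y fun hy' => hy ?_).symm
        exact ⟨hy'.1, hy'.2.trans hxb.le⟩
      rw [hθ]
      exact this.symm.trans hGi
  have hθt : tsupport θ ⊆ Icc a b := by
    refine closure_minimal (fun x hx => ?_) isClosed_Icc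
    by_contra h
    exact hx (hθ0 x h)
  have h0 := H θ hθs (HasCompactSupport.of_support_subset_isCompact isCompact_Icc
    ((subset_tsupport _).trans hθt)) (hθt.trans hab)
  rw [hθ'] at h0
  have i1 := hint g hgs.continuous hgc hgU
  have i2 := hint g₀ hg₀s.continuous hg₀c hg₀U
  have h1 : ∫ x, h x * G x = (∫ x, g x * h x) - k * ∫ x, g₀ x * h x := by
    rw [← integral_const_mul, ← integral_sub i1 (i2.const_mul k)]
    congr 1
    ext x
    simp only [hG]; ring
  have h2 : ∫ x, g x • (h x - C) = (∫ x, g x * h x) - (∫ x, g x) * C := by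
    rw [← integral_mul_const, ← integral_sub i1
      ((hgs.continuous.integrable_of_hasCompactSupport hgc).mul_const C)]
    congr 1
    ext x
    simp only [smul_eq_mul]; ring
  rw [h2]
  rw [h1, hk] at h0
  rw [hC]
  field_simp at h0 ⊢
  linarith

/-- Integration by parts for the primitive of a locally integrable function. -/
theorem integral_primitive_mul_deriv {n : ℝ → ℝ} (hn : ∀ a b, IntervalIntegrable n volume a b)
    (c : ℝ) {θ : ℝ → ℝ} (hθ : ContDiff ℝ ∞ θ) (hθc : HasCompactSupport θ) :
    ∫ x, (∫ y in c..x, n y) * deriv θ x = -∫ x, n x * θ x := by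
  obtain ⟨R, hR⟩ := hθc.isBounded.subset_closedBall 0
  set b := |R| + |c| + 1 with hb
  have hbpos : 0 < b := by positivity
  have hz : ∀ x, x ∉ Ioc (-b) b → x ∉ tsupport θ := by
    intro x hx hx'
    have h1 := hR hx'
    rw [mem_closedBall_zero_iff, Real.norm_eq_abs] at h1
    have h2 := abs_le.1 (h1.trans (le_abs_self R))
    exact hx ⟨by linarith [h2.1, abs_nonneg c], by linarith [h2.2, abs_nonneg c]⟩
  have e : ∀ g : ℝ → ℝ, (∀ x, x ∉ tsupport θ → g x = 0) → ∫ x, g x = ∫ x in (-b)..b, g x := by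
    intro g hg
    rw [intervalIntegral.integral_of_le (by linarith)]
    exact (setIntegral_eq_integral_of_forall_compl_eq_zero fun y hy => hg y (hz y hy)).symm
  have hθ'0 : ∀ x, x ∉ tsupport θ → deriv θ x = 0 := fun x hx =>
    image_eq_zero_of_notMem_tsupport fun h => hx (tsupport_deriv_subset h)
  rw [e _ fun x hx => by rw [hθ'0 x hx, mul_zero],
    e _ fun x hx => by rw [image_eq_zero_of_notMem_tsupport hx, mul_zero]]
  have hac := (hn (-b) b).absolutelyContinuousOnInterval_intervalIntegral (c := c) (by
    rw [uIcc_of_le (by linarith)]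
    exact ⟨by linarith [neg_abs_le c, abs_nonneg R], by linarith [le_abs_self c, abs_nonneg R]⟩)
  have hac' : AbsolutelyContinuousOnInterval θ (-b) b :=
    (hθ.contDiffOn.of_le (by norm_cast)).absolutelyContinuousOnInterval
  rw [hac.integral_mul_deriv_eq_deriv_mul hac']
  have hb1 : θ b = 0 := by
    refine image_eq_zero_of_notMem_tsupport fun h => ?_
    have h1 := hR h
    rw [mem_closedBall_zero_iff, Real.norm_eq_abs] at h1
    linarith [le_abs_self b, le_abs_self R, abs_nonneg c]
  have hb2 : θ (-b) = 0 := image_eq_zero_of_notMem_tsupport (hz _ fun h => lt_irrefl _ h.1)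
  rw [hb1, hb2, mul_zero, mul_zero, sub_zero, zero_sub, neg_inj]
  refine intervalIntegral.integral_congr_ae ?_
  filter_upwards [(hn (-b) b).ae_hasDerivAt_integral] with x hx hx'
  rw [(hx (uIoc_subset_uIcc hx') c (by
    rw [uIcc_of_le (by linarith)]
    exact ⟨by linarith [neg_abs_le c, abs_nonneg R], by linarith [le_abs_self c, abs_nonneg R]⟩)).deriv]

/-! ### The potential of an entropy solution -/

section Basic

variable {f φ : ℝ → ℝ} {u : ℝ → ℝ → ℝ}

/-- Oleinik's inequality says that the feet of the characteristics are ordered. -/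
theorem IsEntropySolution.antitone (hu : IsEntropySolution f φ u) {t : ℝ} (ht : 0 < t) :
    Antitone fun x => deriv f (u x t) - x / t := by
  intro x y hxy
  rcases hxy.eq_or_lt with rfl | h
  · exact le_rfl
  · have := hu.oleinik x y t h ht
    rw [sub_div] at this
    simp only; linarith

theorem IsEntropySolution.measurable_section (hf : IsFlux f) (hu : IsEntropySolution f φ u) {t : ℝ}
    (ht : 0 < t) : Measurable fun x => u x t := by
  have hm : Measurable (deriv f ∘ fun x => u x t) := by
    have h := (hu.antitone ht).measurable.add (measurable_id.div_const t)
    have e : (deriv f ∘ fun x => u x t) =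
        (fun x => deriv f (u x t) - x / t) + fun x => id x / t := by
      ext x; simp
    rw [e]; exact h
  exact (hf.continuous_deriv.measurableEmbedding hf.strictMono.injective).measurable_comp_iff.1 hm

theorem intervalIntegrable_of_abs_le {g : ℝ → ℝ} {C : ℝ} (hg : AEStronglyMeasurable g volume)
    (hC : ∀ x, |g x| ≤ C) (a b : ℝ) : IntervalIntegrable g volume a b :=
  (intervalIntegrable_const (c := C)).mono_fun hg.restrict
    (Eventually.of_forall fun x => by
      simpa using (hC x).trans (le_abs_self C))

/-- The product measure on the half plane. -/
theorem restrict_halfPlane : (volume : Measure (ℝ × ℝ)).restrict (univ ×ˢ Ioi 0) =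
    (volume : Measure ℝ).prod (volume.restrict (Ioi 0)) := by
  rw [Measure.volume_eq_prod, ← Measure.prod_restrict, Measure.restrict_univ]

theorem IsWeakSolution.aestronglyMeasurable_comp (hu : IsWeakSolution f φ u) {g : ℝ → ℝ}
    (hg : Continuous g) : AEStronglyMeasurable (fun P : ℝ × ℝ => g (u P.1 P.2))
      ((volume : Measure ℝ).prod (volume.restrict (Ioi 0))) := by
  rw [← restrict_halfPlane]
  exact (hg.measurable.comp_aemeasurable hu.aemeasurable).aestronglyMeasurable

theorem ae_halfPlane {p : ℝ × ℝ → Prop} (h : ∀ x t, 0 < t → p (x, t)) :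
    ∀ᵐ P ∂((volume : Measure ℝ).prod (volume.restrict (Ioi 0))), p P := by
  rw [← restrict_halfPlane]
  filter_upwards [ae_restrict_mem (MeasurableSet.univ.prod measurableSet_Ioi)] with P hP
  exact h P.1 P.2 hP.2

/-- A bound for the flux along a bounded solution. -/
theorem IsFlux.exists_bound (hf : IsFlux f) (M : ℝ) : ∃ B, 0 ≤ B ∧ ∀ v, |v| ≤ M → |f v| ≤ B := by
  obtain ⟨B, hB⟩ := (isCompact_Icc (a := -M) (b := M)).exists_bound_of_continuousOn
    hf.continuous.continuousOn
  exact ⟨max B 0, le_max_right _ _, fun v hv => (hB v (abs_le.1 hv)).trans (le_max_left _ _)⟩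

/-- The weak formulation for test functions of the form `η(x)θ(t)`. -/
theorem IsWeakSolution.product_test (hf : IsFlux f) (hu : IsWeakSolution f φ u) {η θ : ℝ → ℝ}
    (hη : ContDiff ℝ ∞ η) (hηc : HasCompactSupport η) (hθ : ContDiff ℝ ∞ θ)
    (hθc : HasCompactSupport θ) (hθU : tsupport θ ⊆ Ioi 0) :
    (∫ r in Ioi 0, (∫ x, u x r * η x) * deriv θ r) +
      ∫ r in Ioi 0, (∫ x, f (u x r) * deriv η x) * θ r = 0 := by
  obtain ⟨M, hM⟩ := hu.bounded
  obtain ⟨B, hB0, hB⟩ := hf.exists_bound M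
  set ψ : ℝ × ℝ → ℝ := fun P => η P.1 * θ P.2 with hψ
  have hψs : ContDiff ℝ ∞ ψ := (hη.comp contDiff_fst).mul (hθ.comp contDiff_snd)
  have hsupp : Function.support ψ ⊆ tsupport η ×ˢ tsupport θ := fun P hP =>
    ⟨subset_tsupport _ (left_ne_zero_of_mul hP), subset_tsupport _ (right_ne_zero_of_mul hP)⟩
  have hts : tsupport ψ ⊆ tsupport η ×ˢ tsupport θ :=
    closure_minimal hsupp ((isClosed_tsupport η).prod (isClosed_tsupport θ))
  have hψc : HasCompactSupport ψ :=
    HasCompactSupport.of_support_subset_isCompact (IsCompact.prod hηc hθc) hsupp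
  have hw := hu.weak ψ hψs hψc (hts.trans fun P hP => ⟨mem_univ _, hθU hP.2⟩)
  have hd : ∀ P : ℝ × ℝ, HasFDerivAt ψ (η P.1 • (deriv θ P.2 • ContinuousLinearMap.snd ℝ ℝ ℝ) +
      θ P.2 • (deriv η P.1 • ContinuousLinearMap.fst ℝ ℝ ℝ)) P := by
    intro P
    have h1 : HasFDerivAt (fun P : ℝ × ℝ => η P.1) (deriv η P.1 • ContinuousLinearMap.fst ℝ ℝ ℝ) P :=
      ((hη.differentiable (by simp)).differentiableAt.hasDerivAt).comp_hasFDerivAt P hasFDerivAt_fst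
    have h2 : HasFDerivAt (fun P : ℝ × ℝ => θ P.2) (deriv θ P.2 • ContinuousLinearMap.snd ℝ ℝ ℝ) P :=
      ((hθ.differentiable (by simp)).differentiableAt.hasDerivAt).comp_hasFDerivAt P hasFDerivAt_snd
    exact h1.mul h2
  have he : ∀ P : ℝ × ℝ, u P.1 P.2 * fderiv ℝ ψ P (0, 1) + f (u P.1 P.2) * fderiv ℝ ψ P (1, 0) =
      (u P.1 P.2 * (η P.1 * deriv θ P.2)) + f (u P.1 P.2) * (deriv η P.1 * θ P.2) := by
    intro P
    rw [(hd P).fderiv]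
    simp [-mul_eq_mul_left_iff, mul_comm]
  simp_rw [he] at hw
  rw [restrict_halfPlane] at hw
  have hθ' : Continuous (deriv θ) := hθ.continuous_deriv (by simp)
  have hη' : Continuous (deriv η) := hη.continuous_deriv (by simp)
  have i1 : Integrable (fun P : ℝ × ℝ => u P.1 P.2 * (η P.1 * deriv θ P.2))
      ((volume : Measure ℝ).prod (volume.restrict (Ioi 0))) := by
    refine Integrable.bdd_mul (c := M) ((hη.continuous.integrable_of_hasCompactSupport hηc).mul_prod
      (hθ'.integrable_of_hasCompactSupport hθc.deriv).restrict)
      (hu.aestronglyMeasurable_comp continuous_id) (ae_halfPlane fun x t ht => hM x t ht)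
  have i2 : Integrable (fun P : ℝ × ℝ => f (u P.1 P.2) * (deriv η P.1 * θ P.2))
      ((volume : Measure ℝ).prod (volume.restrict (Ioi 0))) := by
    refine Integrable.bdd_mul (c := B) ((hη'.integrable_of_hasCompactSupport hηc.deriv).mul_prod
      (hθ.continuous.integrable_of_hasCompactSupport hθc).restrict)
      (hu.aestronglyMeasurable_comp hf.continuous)
      (ae_halfPlane fun x t ht => hB _ (hM x t ht))
  rw [integral_add i1 i2, integral_prod_symm _ i1, integral_prod_symm _ i2] at hw
  simp_rw [← integral_mul_const]
  simpa only [mul_assoc] using hw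

/-- Flux balance for a test function of `x` between two positive times. -/
theorem IsEntropySolution.time_balance (hf : IsFlux f) (hu : IsEntropySolution f φ u)
    (hut : IsTimeContinuous u) {η : ℝ → ℝ} (hη : ContDiff ℝ ∞ η) (hηc : HasCompactSupport η)
    {t : ℝ} (ht : 0 < t) :
    (∫ x, u x t * η x) - ∫ x, u x 1 * η x = ∫ r in 1..t, ∫ x, f (u x r) * deriv η x := by
  obtain ⟨M, hM⟩ := hu.bounded
  obtain ⟨B, hB0, hB⟩ := hf.exists_bound M
  have hη' : Continuous (deriv η) := hη.continuous_deriv (by simp)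
  have hηi := hη'.integrable_of_hasCompactSupport (μ := volume) hηc.deriv
  have hui : ∀ t, 0 < t → ∀ a b, IntervalIntegrable (fun x => u x t) volume a b := fun t ht =>
    intervalIntegrable_of_abs_le (hu.measurable_section hf ht).aestronglyMeasurable (hM · t ht)
  set m : ℝ → ℝ := fun r => ∫ x, u x r * η x with hm
  set n : ℝ → ℝ := fun r => ∫ x, f (u x r) * deriv η x with hn
  have hmc : ContinuousOn m (Ioi 0) := by
    have h1 : ∀ r ∈ Ioi (0 : ℝ), m r = -∫ x, (∫ y in (0 : ℝ)..x, u y r) * deriv η x := by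
      intro r hr
      rw [integral_primitive_mul_deriv (hui r hr) 0 hη hηc, neg_neg]
    refine ContinuousOn.congr (ContinuousOn.neg ?_) h1
    refine continuousOn_of_dominated (bound := fun x => (M * |x|) * |deriv η x|) ?_ ?_ ?_ ?_
    · intro r hr
      exact ((intervalIntegral.continuous_primitive (hui r hr) 0).mul hη').aestronglyMeasurable
    · intro r hr
      refine Eventually.of_forall fun x => ?_
      rw [norm_mul, Real.norm_eq_abs (deriv η x)]
      refine mul_le_mul_of_nonneg_right ?_ (abs_nonneg _)
      simpa using intervalIntegral.norm_integral_le_of_norm_le_const (a := 0) (b := x)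
        (f := fun y => u y r) (C := M) fun y _ => hM y r hr
    · exact Continuous.integrable_of_hasCompactSupport (by fun_prop)
        (hηc.deriv.comp_left (g := abs) abs_zero).mul_left
    · exact Eventually.of_forall fun x => (hut 0 x).mul continuousOn_const
  have i2 : AEStronglyMeasurable (fun P : ℝ × ℝ => f (u P.1 P.2) * deriv η P.1)
      ((volume : Measure ℝ).prod (volume.restrict (Ioi 0))) :=
    (hu.aestronglyMeasurable_comp hf.continuous).mul
      (hη'.comp continuous_fst).aestronglyMeasurable
  have hnm : AEStronglyMeasurable n (volume.restrict (Ioi 0)) := by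
    exact AEStronglyMeasurable.integral_prod_right'
      (f := fun P : ℝ × ℝ => f (u P.2 P.1) * deriv η P.2) i2.prod_swap
  set C := B * ∫ x, |deriv η x| with hC
  have hnb : ∀ r, 0 < r → |n r| ≤ C := by
    intro r hr
    rw [hC, ← integral_const_mul]
    change ‖∫ x, f (u x r) * deriv η x‖ ≤ _
    refine norm_integral_le_of_norm_le (hηi.abs.const_mul B) (Eventually.of_forall fun x => ?_)
    rw [norm_mul]
    exact mul_le_mul_of_nonneg_right (hB _ (hM x r hr)) (norm_nonneg _)
  have hC0 : 0 ≤ C := (abs_nonneg _).trans (hnb 1 one_pos)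
  -- `n` is extended by zero to negative times
  set N : ℝ → ℝ := (Ioi 0).indicator n with hN
  have hNm : AEStronglyMeasurable N volume :=
    (aestronglyMeasurable_indicator_iff measurableSet_Ioi).2 hnm
  have hNi : ∀ a b, IntervalIntegrable N volume a b :=
    intervalIntegrable_of_abs_le hNm (C := C) fun r => by
      by_cases h : 0 < r
      · rw [hN, indicator_of_mem (show r ∈ Ioi (0:ℝ) from h)]; exact hnb r h
      · rw [hN, indicator_of_notMem (show r ∉ Ioi (0:ℝ) from h), abs_zero]; exact hC0
  have hNc := intervalIntegral.continuous_primitive hNi 1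
  obtain ⟨c, hc⟩ := exists_ae_eq_const_of_integral_mul_deriv_eq_zero isOpen_Ioi
    ordConnected_Ioi ⟨1, mem_Ioi.2 one_pos⟩ (h := fun r => m r - ∫ y in (1 : ℝ)..r, N y)
    ((hmc.sub hNc.continuousOn).locallyIntegrableOn measurableSet_Ioi) (by
      intro θ hθ hθc hθU
      have hw := hu.product_test hf hη hηc hθ hθc hθU
      have hz : ∀ x, x ∉ Ioi (0 : ℝ) → deriv θ x = 0 := fun x hx =>
        image_eq_zero_of_notMem_tsupport fun h => hx (hθU (tsupport_deriv_subset h))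
      have hz' : ∀ x, x ∉ Ioi (0 : ℝ) → θ x = 0 := fun x hx =>
        image_eq_zero_of_notMem_tsupport fun h => hx (hθU h)
      have e1 : ∫ r in Ioi 0, m r * deriv θ r = ∫ r, m r * deriv θ r :=
        setIntegral_eq_integral_of_forall_compl_eq_zero fun r hr => by rw [hz r hr, mul_zero]
      have e2 : ∫ r in Ioi 0, n r * θ r = ∫ r, N r * θ r := by
        rw [← integral_indicator measurableSet_Ioi]
        congr 1
        ext r
        by_cases h : r ∈ Ioi (0 : ℝ)
        · simp [hN, indicator_of_mem h]
        · simp [hN, indicator_of_notMem h]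
      have hθ' : Continuous (deriv θ) := hθ.continuous_deriv (by simp)
      have i3 : Integrable fun r => m r * deriv θ r := by
        have h1 : IntegrableOn (fun r => m r * deriv θ r) (tsupport θ) :=
          (((hmc.mono hθU).mul hθ'.continuousOn).integrableOn_compact hθc)
        refine (integrableOn_iff_integrable_of_support_subset fun r hr => ?_).1 h1
        exact tsupport_deriv_subset (subset_tsupport _ (right_ne_zero_of_mul hr))
      have i4 : Integrable fun r => (∫ y in (1 : ℝ)..r, N y) * deriv θ r :=
        (hNc.mul hθ').integrable_of_hasCompactSupport hθc.deriv.mul_left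
      have e3 := integral_primitive_mul_deriv hNi 1 hθ hθc
      simp_rw [sub_mul]
      rw [integral_sub i3 i4, e3, ← e1, ← e2]
      linarith)
  have heq := Measure.eqOn_open_of_ae_eq (μ := volume) (U := Ioi (0 : ℝ))
    (f := fun r => m r - ∫ y in (1 : ℝ)..r, N y) (g := fun _ => c)
    ((ae_restrict_iff' measurableSet_Ioi).2 hc) isOpen_Ioi
    (hmc.sub hNc.continuousOn) continuousOn_const
  have h1 := heq (show (1 : ℝ) ∈ Ioi 0 from mem_Ioi.2 one_pos)
  have h2 := heq (show t ∈ Ioi 0 from ht)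
  simp only [intervalIntegral.integral_same, sub_zero] at h1 h2
  have e : ∫ r in (1 : ℝ)..t, n r = ∫ r in (1 : ℝ)..t, N r := by
    refine intervalIntegral.integral_congr fun r hr => ?_
    have : 0 < r := lt_of_lt_of_le (lt_min one_pos ht) hr.1
    rw [hN, indicator_of_mem (show r ∈ Ioi (0:ℝ) from this)]
  rw [e]
  linarith

end Basic

/-- `U` is a potential of the closed form `u dx - f(u) dt` on the open half plane. -/
structure IsPotential (f : ℝ → ℝ) (u U : ℝ → ℝ → ℝ) : Prop where
  sub_eq : ∀ t, 0 < t → ∀ x y, U y t - U x t = ∫ z in x..y, u z t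
  ae_sub_eq : ∀ s t, 0 < s → 0 < t → ∀ᵐ x, U x t - U x s = -∫ r in s..t, f (u x r)

section Potential

variable {f φ : ℝ → ℝ} {u U : ℝ → ℝ → ℝ} {M B : ℝ}

theorem IsEntropySolution.intervalIntegrable_comp (hf : IsFlux f) (hu : IsEntropySolution f φ u)
    {g : ℝ → ℝ} (hg : Continuous g) (hB : ∀ x t, 0 < t → |g (u x t)| ≤ B) {t : ℝ} (ht : 0 < t)
    (a b : ℝ) : IntervalIntegrable (fun x => g (u x t)) volume a b :=
  intervalIntegrable_of_abs_le
    (hg.measurable.comp (hu.measurable_section hf ht)).aestronglyMeasurable (hB · t ht) a b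

theorem IsEntropySolution.ae_intervalIntegrable (hf : IsFlux f) (hu : IsEntropySolution f φ u)
    (hB : ∀ x t, 0 < t → |f (u x t)| ≤ B) :
    ∀ᵐ x, ∀ s t, 0 < s → 0 < t → IntervalIntegrable (fun r => f (u x r)) volume s t := by
  have h := (hu.aestronglyMeasurable_comp hf.continuous).prodMk_left
  filter_upwards [h] with x hx s t hs ht
  have hsub : uIoc s t ⊆ Ioi 0 := fun r hr => lt_of_lt_of_le (lt_min hs ht) hr.1.le
  refine (intervalIntegrable_const (c := B)).mono_fun
    (hx.mono_measure (Measure.restrict_mono hsub le_rfl)) ?_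
  filter_upwards [ae_restrict_mem measurableSet_uIoc] with r hr
  exact (hB x r (hsub hr)).trans (le_abs_self B)

theorem IsEntropySolution.integrable_prod (hf : IsFlux f) (hu : IsEntropySolution f φ u)
    (hB : ∀ x t, 0 < t → |f (u x t)| ≤ B) {s t : ℝ} (hs : 0 < s) (ht : 0 < t) {η : ℝ → ℝ}
    {μ : Measure ℝ} [SFinite μ] (hμ : μ ≪ volume) (hη : Integrable η μ) :
    Integrable (Function.uncurry fun r x => f (u x r) * η x)
      ((volume.restrict (uIoc s t)).prod μ) := by
  have hsub : uIoc s t ⊆ Ioi 0 := fun r hr => lt_of_lt_of_le (lt_min hs ht) hr.1.le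
  have hac : (volume.restrict (uIoc s t)).prod μ ≪ (volume.restrict (Ioi 0)).prod volume :=
    (Measure.absolutelyContinuous_of_le (Measure.restrict_mono hsub le_rfl)).prod hμ
  have h1 : AEStronglyMeasurable (fun P : ℝ × ℝ => f (u P.2 P.1))
      ((volume.restrict (uIoc s t)).prod μ) :=
    ((hu.aestronglyMeasurable_comp hf.continuous).prod_swap).mono_ac hac
  have h2 : Integrable (fun P : ℝ × ℝ => η P.2) ((volume.restrict (uIoc s t)).prod μ) := by
    have : IsFiniteMeasure (volume.restrict (uIoc s t)) := ⟨by simp [uIoc]⟩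
    exact hη.comp_snd _
  refine Integrable.bdd_mul (c := B) h2 h1 ?_
  have h3 : ∀ᵐ P ∂((volume.restrict (Ioi 0)).prod (volume : Measure ℝ)),
      ‖f (u P.2 P.1)‖ ≤ B := by
    have := ae_halfPlane (p := fun P => ‖f (u P.1 P.2)‖ ≤ B) hB
    rw [← Measure.prod_swap] at this
    exact ae_of_ae_map measurable_swap.aemeasurable this
  exact hac.ae_le h3

/-- An entropy solution has a potential. -/
theorem IsEntropySolution.exists_potential (hf : IsFlux f) (hu : IsEntropySolution f φ u)
    (hut : IsTimeContinuous u) : ∃ U, IsPotential f u U := by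
  obtain ⟨M, hM⟩ := hu.bounded
  obtain ⟨B, hB0, hB⟩ := hf.exists_bound M
  have hB' : ∀ x t, 0 < t → |f (u x t)| ≤ B := fun x t ht => hB _ (hM x t ht)
  have hui : ∀ t, 0 < t → ∀ a b, IntervalIntegrable (fun x => u x t) volume a b := fun t ht =>
    hu.intervalIntegrable_comp hf continuous_id hM ht
  have hex : ∀ t : ℝ, ∃ c : ℝ, 0 < t → ∀ᵐ x, (∫ y in (0 : ℝ)..x, u y t) -
      (∫ y in (0 : ℝ)..x, u y 1) + ∫ r in (1 : ℝ)..t, f (u x r) = c := by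
    intro t
    by_cases ht : 0 < t
    swap
    · exact ⟨0, fun h => absurd h ht⟩
    have hc1 := intervalIntegral.continuous_primitive (hui t ht) 0
    have hc2 := intervalIntegral.continuous_primitive (hui 1 one_pos) 0
    have hm3 : AEStronglyMeasurable (fun x => ∫ r in (1 : ℝ)..t, f (u x r)) volume := by
      have h1 := (hu.aestronglyMeasurable_comp hf.continuous)
      have h2 : ∀ a b : ℝ, 0 < a → AEStronglyMeasurable (fun x => ∫ r in Ioc a b, f (u x r))
          volume := by
        intro a b ha
        refine AEStronglyMeasurable.integral_prod_right' (f := fun P : ℝ × ℝ => f (u P.1 P.2))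
          (h1.mono_measure ?_)
        exact Measure.prod_mono le_rfl
          (Measure.restrict_mono (fun r hr => lt_trans ha hr.1) le_rfl)
      simp only [intervalIntegral]
      exact (h2 1 t one_pos).sub (h2 t 1 ht)
    have hb3 : ∀ x, ‖∫ r in (1 : ℝ)..t, f (u x r)‖ ≤ B * |t - 1| := fun x =>
      intervalIntegral.norm_integral_le_of_norm_le_const fun r hr =>
        hB' x r (lt_of_lt_of_le (lt_min one_pos ht) hr.1.le)
    have hli : LocallyIntegrable (fun x => ∫ r in (1 : ℝ)..t, f (u x r)) :=
      (locallyIntegrable_const (B * |t - 1|)).mono hm3 (Eventually.of_forall fun x =>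
        (hb3 x).trans (le_abs_self _))
    obtain ⟨c, hc⟩ := exists_ae_eq_const_of_integral_mul_deriv_eq_zero isOpen_univ
      ordConnected_univ univ_nonempty (h := fun x => (∫ y in (0 : ℝ)..x, u y t) -
      (∫ y in (0 : ℝ)..x, u y 1) + ∫ r in (1 : ℝ)..t, f (u x r))
      (locallyIntegrableOn_univ.2 (((hc1.sub hc2).locallyIntegrable).add hli)) (by
        intro η hη hηc _
        have hη' : Continuous (deriv η) := hη.continuous_deriv (by simp)
        have hηi := hη'.integrable_of_hasCompactSupport (μ := volume) hηc.deriv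
        have j1 : Integrable fun x => (∫ y in (0 : ℝ)..x, u y t) * deriv η x :=
          (hc1.mul hη').integrable_of_hasCompactSupport hηc.deriv.mul_left
        have j2 : Integrable fun x => (∫ y in (0 : ℝ)..x, u y 1) * deriv η x :=
          (hc2.mul hη').integrable_of_hasCompactSupport hηc.deriv.mul_left
        have j3 : Integrable fun x => (∫ r in (1 : ℝ)..t, f (u x r)) * deriv η x :=
          hηi.bdd_mul hm3 (Eventually.of_forall hb3)
        have e1 := integral_primitive_mul_deriv (hui t ht) 0 hη hηc
        have e2 := integral_primitive_mul_deriv (hui 1 one_pos) 0 hη hηc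
        have e3 : ∫ x, (∫ r in (1 : ℝ)..t, f (u x r)) * deriv η x =
            ∫ r in (1 : ℝ)..t, ∫ x, f (u x r) * deriv η x := by
          rw [intervalIntegral_integral_swap
            (hu.integrable_prod hf hB' one_pos ht Measure.AbsolutelyContinuous.rfl hηi)]
          simp_rw [intervalIntegral.integral_mul_const]
        have e4 := hu.time_balance hf hut hη hηc ht
        simp_rw [add_mul, sub_mul]
        have j12 : Integrable fun x => (∫ y in (0 : ℝ)..x, u y t) * deriv η x -
          (∫ y in (0 : ℝ)..x, u y 1) * deriv η x := j1.sub j2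
        rw [integral_add j12 j3, integral_sub j1 j2, e1, e2, e3, ← e4]
        ring)
    exact ⟨c, fun _ => by simpa using hc⟩
  choose c hc using hex
  refine ⟨fun x t => (∫ y in (0 : ℝ)..x, u y t) - c t, ?_, ?_⟩
  · intro t ht x y
    rw [← intervalIntegral.integral_interval_sub_left (hui t ht 0 y) (hui t ht 0 x)]
    ring
  · intro s t hs ht
    filter_upwards [hc s hs, hc t ht, hu.ae_intervalIntegrable hf hB'] with x h1 h2 h3
    rw [← intervalIntegral.integral_interval_sub_left (h3 1 t one_pos ht) (h3 1 s one_pos hs)]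
    linarith

namespace IsPotential

theorem abs_sub_le (hU : IsPotential f u U) (hM : ∀ x t, 0 < t → |u x t| ≤ M) {t : ℝ}
    (ht : 0 < t) (x y : ℝ) : |U y t - U x t| ≤ M * |y - x| := by
  rw [hU.sub_eq t ht]
  exact intervalIntegral.norm_integral_le_of_norm_le_const (f := fun z => u z t)
    fun z _ => hM z t ht

theorem continuous (hU : IsPotential f u U) (hM : ∀ x t, 0 < t → |u x t| ≤ M) {t : ℝ}
    (ht : 0 < t) : Continuous fun x => U x t :=
  continuous_of_abs_sub_le fun x y => hU.abs_sub_le hM ht y x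

theorem abs_sub_le_time (hU : IsPotential f u U) (hM : ∀ x t, 0 < t → |u x t| ≤ M)
    (hB : ∀ x t, 0 < t → |f (u x t)| ≤ B) {s t : ℝ} (hs : 0 < s) (ht : 0 < t) (x : ℝ) :
    |U x t - U x s| ≤ B * |t - s| := by
  have hcl : IsClosed {x | |U x t - U x s| ≤ B * |t - s|} :=
    isClosed_le ((hU.continuous hM ht).sub (hU.continuous hM hs)).abs continuous_const
  have hd : Dense {x | |U x t - U x s| ≤ B * |t - s|} := by
    refine Measure.dense_of_ae (μ := volume) ?_
    filter_upwards [hU.ae_sub_eq s t hs ht] with x hx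
    rw [hx, abs_neg]
    exact intervalIntegral.norm_integral_le_of_norm_le_const (f := fun r => f (u x r)) fun r hr =>
      hB x r (lt_of_lt_of_le (lt_min hs ht) hr.1.le)
  have := hd.closure_eq ▸ hcl.closure_eq
  exact (this ▸ mem_univ x : x ∈ {x | |U x t - U x s| ≤ B * |t - s|})

end IsPotential

/-- A function whose increments are at most linear up to a quadratic error grows at most
linearly. -/
theorem sub_le_of_step {g : ℝ → ℝ} {A C s t : ℝ} (hst : s ≤ t)
    (h : ∀ r h, s ≤ r → 0 < h → r + h ≤ t → g (r + h) - g r ≤ A * h + C * h ^ 2) :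
    g t - g s ≤ A * (t - s) := by
  rcases hst.eq_or_lt with rfl | hlt
  · simp
  have key : ∀ n : ℕ, g t - g s ≤ A * (t - s) + C * (t - s) ^ 2 / (n + 1) := by
    intro n
    set k : ℝ := (t - s) / (n + 1) with hk
    have hn : (0 : ℝ) < n + 1 := by positivity
    have hkpos : 0 < k := div_pos (by linarith) hn
    have hkn : (n + 1) * k = t - s := by rw [hk]; field_simp
    have hind : ∀ m : ℕ, m ≤ n + 1 → g (s + m * k) - g s ≤ m * (A * k + C * k ^ 2) := by
      intro m
      induction m with
      | zero => intro _; simp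
      | succ m ih =>
        intro hm
        have h1 := ih (by omega)
        have hm' : (m : ℝ) + 1 ≤ n + 1 := by exact_mod_cast hm
        have h2 := h (s + m * k) k (by nlinarith [m.cast_nonneg (α := ℝ)]) hkpos (by nlinarith)
        push_cast
        have e : s + (m + 1) * k = s + m * k + k := by ring
        rw [e]
        linarith
    have h3 := hind (n + 1) le_rfl
    push_cast at h3
    rw [hkn, add_sub_cancel] at h3
    have e : (n + 1) * (A * k + C * k ^ 2) = A * (t - s) + C * (t - s) ^ 2 / (n + 1) := by
      rw [hk]; field_simp
    linarith
  have hlim : Tendsto (fun n : ℕ => A * (t - s) + C * (t - s) ^ 2 / ((n : ℝ) + 1)) atTop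
      (𝓝 (A * (t - s) + 0)) :=
    tendsto_const_nhds.add (tendsto_const_nhds.div_atTop
      (tendsto_natCast_atTop_atTop.atTop_add tendsto_const_nhds))
  rw [add_zero] at hlim
  exact ge_of_tendsto' hlim key

end Potential

/-! ### The upper bound in the Hopf–Lax formula -/

section HopfLax

variable {f φ : ℝ → ℝ} {u U : ℝ → ℝ → ℝ} {M B : ℝ}

theorem abs_integral_sub_mul_le {g : ℝ → ℝ} (hg : ∀ x y, |g x - g y| ≤ M * |x - y|) (a b c : ℝ)
    (hc : c ∈ uIcc a b) : |(∫ z in a..b, g z) - (b - a) * g c| ≤ M * (b - a) ^ 2 := by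
  have hcont := continuous_of_abs_sub_le hg
  have hM : 0 ≤ M := by
    have := (abs_nonneg _).trans (hg 1 0)
    simpa using this
  have e : (∫ z in a..b, g z) - (b - a) * g c = ∫ z in a..b, (g z - g c) := by
    rw [intervalIntegral.integral_sub (hcont.intervalIntegrable _ _) (by simp),
      intervalIntegral.integral_const, smul_eq_mul]
  rw [e, ← sq_abs, sq, ← mul_assoc]
  refine intervalIntegral.norm_integral_le_of_norm_le_const (f := fun z => g z - g c) fun z hz => ?_
  refine (hg z c).trans (mul_le_mul_of_nonneg_left ?_ hM)
  exact abs_sub_le_of_uIcc_subset_uIcc (uIcc_subset_uIcc hc (uIoc_subset_uIcc hz))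

/-- The space average of the potential decreases along lines of speed `f'(v)` no slower than the
Legendre transform permits. -/
theorem IsPotential.average_step (hf : IsFlux f) (hu : IsEntropySolution f φ u)
    (hU : IsPotential f u U) (hM : ∀ x t, 0 < t → |u x t| ≤ M)
    (hB : ∀ x t, 0 < t → |f (u x t)| ≤ B) (v y : ℝ) {δ : ℝ} (hδ : 0 < δ) {r h : ℝ} (hr : 0 < r)
    (hh : 0 < h) :
    (∫ z in (y + (r + h) * deriv f v)..(y + (r + h) * deriv f v + δ), U z (r + h)) -
      (∫ z in (y + r * deriv f v)..(y + r * deriv f v + δ), U z r) ≤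
      δ * legendre f v * h + (2 * B * |deriv f v| + 2 * M * deriv f v ^ 2) * h ^ 2 := by
  set σ := deriv f v with hσ
  set x := y + r * σ with hx
  set x' := y + (r + h) * σ with hx'
  have hxx : x' - x = h * σ := by rw [hx, hx']; ring
  have hrh : 0 < r + h := by linarith
  have hcU : ∀ t, 0 < t → ∀ a b, IntervalIntegrable (fun z => U z t) volume a b :=
    fun t ht a b => (hU.continuous hM ht).intervalIntegrable _ _
  -- the displacement in space at time `r`
  have h1 : (∫ z in x'..(x' + δ), U z r) - (∫ z in x..(x + δ), U z r) =
      (∫ z in (x + δ)..(x' + δ), U z r) - ∫ z in x..x', U z r := by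
    rw [← intervalIntegral.integral_add_adjacent_intervals (hcU r hr x' x) (hcU r hr x (x' + δ)),
      ← intervalIntegral.integral_add_adjacent_intervals (hcU r hr x (x + δ))
        (hcU r hr (x + δ) (x' + δ)), intervalIntegral.integral_symm x x']
    ring
  have hlip : ∀ a b, |U a r - U b r| ≤ M * |a - b| := fun a b => hU.abs_sub_le hM hr b a
  have h2 := (abs_le.1 (abs_integral_sub_mul_le hlip (x + δ) (x' + δ) (x' + δ) right_mem_uIcc)).2
  have h3 := (abs_le.1 (abs_integral_sub_mul_le hlip x x' x' right_mem_uIcc)).1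
  -- the displacement in time
  have h4 : (∫ z in x'..(x' + δ), U z (r + h)) - (∫ z in x'..(x' + δ), U z r) =
      -∫ ρ in r..(r + h), ∫ z in x'..(x' + δ), f (u z ρ) := by
    rw [← intervalIntegral.integral_sub (hcU _ hrh _ _) (hcU _ hr _ _)]
    have e1 : ∫ z in x'..(x' + δ), (U z (r + h) - U z r) =
        ∫ z in x'..(x' + δ), -∫ ρ in r..(r + h), f (u z ρ) := by
      refine intervalIntegral.integral_congr_ae ?_
      filter_upwards [hU.ae_sub_eq r (r + h) hr hrh] with z hz _
      exact hz
    rw [e1, intervalIntegral.integral_neg, intervalIntegral.integral_of_le (by linarith)]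
    simp_rw [intervalIntegral.integral_of_le (show x' ≤ x' + δ by linarith)]
    rw [intervalIntegral_integral_swap]
    have := hu.integrable_prod hf hB hr hrh (η := fun _ => 1)
      (μ := volume.restrict (Ioc x' (x' + δ)))
      Measure.absolutelyContinuous_restrict (integrable_const _)
    simpa using this
  have hFi : IntervalIntegrable (fun ρ => ∫ z in x'..(x' + δ), f (u z ρ)) volume r (r + h) := by
    rw [intervalIntegrable_iff]
    have := hu.integrable_prod hf hB hr hrh (η := fun _ => 1)
      (μ := volume.restrict (Ioc x' (x' + δ)))
      Measure.absolutelyContinuous_restrict (integrable_const _)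
    have h5 := this.integral_prod_left
    simp_rw [intervalIntegral.integral_of_le (show x' ≤ x' + δ by linarith)]
    simpa [Function.uncurry, IntegrableOn] using h5
  have h5 : ∀ ρ ∈ Icc r (r + h), σ * (U (x' + δ) r - U x' r) - 2 * B * |σ| * h - δ * legendre f v ≤
      ∫ z in x'..(x' + δ), f (u z ρ) := by
    intro ρ hρ
    have hρ0 : 0 < ρ := lt_of_lt_of_le hr hρ.1
    have i1 : IntervalIntegrable (fun z => u z ρ) volume x' (x' + δ) :=
      hu.intervalIntegrable_comp hf continuous_id hM hρ0 x' (x' + δ)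
    have i2 := hu.intervalIntegrable_comp hf hf.continuous hB hρ0 x' (x' + δ)
    have h6 : ∫ z in x'..(x' + δ), (σ * u z ρ - legendre f v) ≤ ∫ z in x'..(x' + δ), f (u z ρ) := by
      refine intervalIntegral.integral_mono_on (by linarith) ((i1.const_mul σ).sub (by simp)) i2 ?_
      intro z _
      have := deriv_mul_sub_le_legendre hf v (u z ρ)
      simp only [← hσ] at this ⊢; linarith
    rw [intervalIntegral.integral_sub (i1.const_mul σ) (by simp),
      intervalIntegral.integral_const_mul, ← hU.sub_eq ρ hρ0, intervalIntegral.integral_const,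
      smul_eq_mul, add_sub_cancel_left] at h6
    have h7 := hU.abs_sub_le_time hM hB hr hρ0 (x' + δ)
    have h8 := hU.abs_sub_le_time hM hB hr hρ0 x'
    have hB0 : 0 ≤ B := (abs_nonneg _).trans (hB 0 1 one_pos)
    have h9 : |ρ - r| ≤ h := by rw [abs_of_nonneg (by linarith [hρ.1])]; linarith [hρ.2]
    have h10 : |σ * ((U (x' + δ) ρ - U x' ρ) - (U (x' + δ) r - U x' r))| ≤ |σ| * (2 * B * h) := by
      rw [abs_mul]
      refine mul_le_mul_of_nonneg_left ?_ (abs_nonneg _)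
      have e : (U (x' + δ) ρ - U x' ρ) - (U (x' + δ) r - U x' r) =
        (U (x' + δ) ρ - U (x' + δ) r) - (U x' ρ - U x' r) := by ring
      rw [e]
      have := mul_le_mul_of_nonneg_left h9 hB0
      exact (abs_sub _ _).trans (by linarith)
    have := (abs_le.1 h10).1
    nlinarith
  have h6 : (σ * (U (x' + δ) r - U x' r) - 2 * B * |σ| * h - δ * legendre f v) * h ≤
      ∫ ρ in r..(r + h), ∫ z in x'..(x' + δ), f (u z ρ) := by
    have := intervalIntegral.integral_mono_on (by linarith) (by simp) hFi h5
    rw [intervalIntegral.integral_const, smul_eq_mul, add_sub_cancel_left] at this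
    linarith
  rw [add_sub_add_right_eq_sub, hxx] at h2
  rw [hxx] at h3
  nlinarith

/-- The potential lies below the Hopf–Lax cost between two positive times. -/
theorem IsPotential.le_cost (hf : IsFlux f) (hu : IsEntropySolution f φ u)
    (hU : IsPotential f u U) (hM : ∀ x t, 0 < t → |u x t| ≤ M)
    (hB : ∀ x t, 0 < t → |f (u x t)| ≤ B) {s t : ℝ} (hs : 0 < s) (hst : s ≤ t) (x v : ℝ) :
    U x t ≤ cost f (fun z => U z s) (t - s) x v := by
  have ht : 0 < t := by linarith
  have hM0 : 0 ≤ M := (abs_nonneg _).trans (hM 0 1 one_pos)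
  have key : ∀ δ : ℝ, 0 < δ → U x t ≤ cost f (fun z => U z s) (t - s) x v + 2 * M * δ := by
    intro δ hδ
    have h1 := sub_le_of_step (g := fun r => ∫ z in ((x - t * deriv f v) + r * deriv f v)..
      ((x - t * deriv f v) + r * deriv f v + δ), U z r) (A := δ * legendre f v)
      (C := 2 * B * |deriv f v| + 2 * M * deriv f v ^ 2) hst
      fun r h hr hh _ => hU.average_step hf hu hM hB v _ hδ (by linarith) hh
    have e1 : x - t * deriv f v + t * deriv f v = x := by ring
    have e2 : x - t * deriv f v + s * deriv f v = x - (t - s) * deriv f v := by ring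
    rw [e1, e2] at h1
    have h2 := (abs_le.1 (abs_integral_sub_mul_le (fun a b => hU.abs_sub_le hM ht b a) x (x + δ) x
      left_mem_uIcc)).1
    have h3 := (abs_le.1 (abs_integral_sub_mul_le (fun a b => hU.abs_sub_le hM hs b a)
      (x - (t - s) * deriv f v) (x - (t - s) * deriv f v + δ) (x - (t - s) * deriv f v)
      left_mem_uIcc)).2
    rw [add_sub_cancel_left] at h2 h3
    unfold cost
    have : δ * (U x t - (U (x - (t - s) * deriv f v) s + (t - s) * legendre f v + 2 * M * δ)) ≤ 0 := by
      nlinarith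
    nlinarith
  have hlim : Tendsto (fun δ : ℝ => cost f (fun z => U z s) (t - s) x v + 2 * M * δ) (𝓝[>] 0)
      (𝓝 (cost f (fun z => U z s) (t - s) x v + 2 * M * 0)) :=
    (Continuous.tendsto (by fun_prop) 0).mono_left nhdsWithin_le_nhds
  rw [mul_zero, add_zero] at hlim
  refine ge_of_tendsto hlim ?_
  filter_upwards [self_mem_nhdsWithin] with δ hδ
  exact key δ hδ

end HopfLax

/-! ### Following the potential backwards -/

section Backward

variable {f φ : ℝ → ℝ} {u U : ℝ → ℝ → ℝ} {M B : ℝ}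

/-- If the difference quotients of the potential to the left of `z` do not exceed `v` in the limit,
then `u` does not exceed `v` in the limit at `(z,r)`. -/
theorem IsPotential.eventually_lt (hf : IsFlux f) (hu : IsEntropySolution f φ u)
    (hU : IsPotential f u U) (hM : ∀ x t, 0 < t → |u x t| ≤ M)
    (hB : ∀ x t, 0 < t → |f (u x t)| ≤ B) {z r v : ℝ} (hr : 0 < r)
    (hL : ∀ ε, 0 < ε → ∀ᶠ z' in 𝓝[<] z, U z r - U z' r ≤ (v + ε) * (z - z')) {ε : ℝ} (hε : 0 < ε) :
    ∀ᶠ P in 𝓝 (z, r), u P.1 P.2 < v + ε := by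
  have ha : 0 < deriv f (v + ε) - deriv f (v + ε / 2) := sub_pos.2 (hf.strictMono (by linarith))
  -- the length on which the one-sided inequality propagates a large value of `u`
  obtain ⟨z', hz', hz'2, hz'3⟩ : ∃ z', U z r - U z' r ≤ (v + ε / 4) * (z - z') ∧
      z - z' < r / 2 * (deriv f (v + ε) - deriv f (v + ε / 2)) ∧ z' < z := by
    have h1 := hL (ε / 4) (by linarith)
    have h2 : ∀ᶠ z' in 𝓝[<] z, z - r / 2 * (deriv f (v + ε) - deriv f (v + ε / 2)) < z' :=
      (lt_mem_nhds (by nlinarith)).filter_mono nhdsWithin_le_nhds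
    obtain ⟨z', h⟩ := (h1.and (h2.and self_mem_nhdsWithin)).exists
    exact ⟨z', h.1, by linarith [h.2.1], h.2.2⟩
  set d := z - z' with hd
  have hd0 : 0 < d := by linarith
  have hM0 : 0 ≤ M := (abs_nonneg _).trans (hM 0 1 one_pos)
  have hB0 : 0 ≤ B := (abs_nonneg _).trans (hB 0 1 one_pos)
  have hc : ∀ᶠ P : ℝ × ℝ in 𝓝 (z, r), 2 * B * |P.2 - r| + 2 * M * |P.1 - z| < ε / 4 * d := by
    have : Tendsto (fun P : ℝ × ℝ => 2 * B * |P.2 - r| + 2 * M * |P.1 - z|) (𝓝 (z, r))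
        (𝓝 (2 * B * |r - r| + 2 * M * |z - z|)) := Continuous.tendsto (by fun_prop) (z, r)
    refine this.eventually (gt_mem_nhds ?_)
    simp only [sub_self, abs_zero, mul_zero, add_zero]
    positivity
  have hc2 : ∀ᶠ P : ℝ × ℝ in 𝓝 (z, r), r / 2 < P.2 :=
    continuous_snd.continuousAt.eventually (lt_mem_nhds (by change r / 2 < r; linarith))
  filter_upwards [hc, hc2] with P hP hP2
  obtain ⟨y, s⟩ := P
  simp only at hP hP2 ⊢
  have hs : 0 < s := by linarith
  by_contra! hcon
  have hlow : ∀ w ∈ Icc (y - d) y, v + ε / 2 ≤ u w s := by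
    intro w hw
    rcases hw.2.eq_or_lt with rfl | hlt
    · linarith
    have h1 := hu.oleinik w y s hlt hs
    have h2 : deriv f (v + ε) ≤ deriv f (u y s) := hf.strictMono.monotone hcon
    have h3 : (y - w) / s ≤ deriv f (v + ε) - deriv f (v + ε / 2) := by
      rw [div_le_iff₀ hs]
      nlinarith [hw.1]
    exact hf.strictMono.le_iff_le.1 (by linarith)
  have hint : (v + ε / 2) * d ≤ U y s - U (y - d) s := by
    rw [hU.sub_eq s hs]
    have := intervalIntegral.integral_mono_on (a := y - d) (b := y) (by linarith)
      (intervalIntegrable_const (c := v + ε / 2))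
      (hu.intervalIntegrable_comp hf continuous_id hM hs (y - d) y) hlow
    rw [intervalIntegral.integral_const, smul_eq_mul] at this
    simp only [id] at this
    linarith
  have b1 := hU.abs_sub_le_time hM hB hr hs y
  have b2 := hU.abs_sub_le_time hM hB hr hs (y - d)
  have b3 := hU.abs_sub_le hM hr z y
  have b4 := hU.abs_sub_le hM hr z' (y - d)
  have e : y - d - z' = y - z := by rw [hd]; ring
  rw [e] at b4
  have := (abs_le.1 b1).2
  have := (abs_le.1 b2).1
  have := (abs_le.1 b3).2
  have := (abs_le.1 b4).1
  nlinarith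

/-- If the difference quotients of the potential to the right of `z` are not below `v` in the
limit, then `u` is not below `v` in the limit at `(z,r)`. -/
theorem IsPotential.eventually_gt (hf : IsFlux f) (hu : IsEntropySolution f φ u)
    (hU : IsPotential f u U) (hM : ∀ x t, 0 < t → |u x t| ≤ M)
    (hB : ∀ x t, 0 < t → |f (u x t)| ≤ B) {z r v : ℝ} (hr : 0 < r)
    (hR : ∀ ε, 0 < ε → ∀ᶠ z' in 𝓝[>] z, (v - ε) * (z' - z) ≤ U z' r - U z r) {ε : ℝ} (hε : 0 < ε) :
    ∀ᶠ P in 𝓝 (z, r), v - ε < u P.1 P.2 := by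
  have ha : 0 < deriv f (v - ε / 2) - deriv f (v - ε) := sub_pos.2 (hf.strictMono (by linarith))
  obtain ⟨z', hz', hz'2, hz'3⟩ : ∃ z', (v - ε / 4) * (z' - z) ≤ U z' r - U z r ∧
      z' - z < r / 2 * (deriv f (v - ε / 2) - deriv f (v - ε)) ∧ z < z' := by
    have h1 := hR (ε / 4) (by linarith)
    have h2 : ∀ᶠ z' in 𝓝[>] z, z' < z + r / 2 * (deriv f (v - ε / 2) - deriv f (v - ε)) :=
      (gt_mem_nhds (by nlinarith)).filter_mono nhdsWithin_le_nhds
    obtain ⟨z', h⟩ := (h1.and (h2.and self_mem_nhdsWithin)).exists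
    exact ⟨z', h.1, by linarith [h.2.1], h.2.2⟩
  set d := z' - z with hd
  have hd0 : 0 < d := by linarith
  have hM0 : 0 ≤ M := (abs_nonneg _).trans (hM 0 1 one_pos)
  have hB0 : 0 ≤ B := (abs_nonneg _).trans (hB 0 1 one_pos)
  have hc : ∀ᶠ P : ℝ × ℝ in 𝓝 (z, r), 2 * B * |P.2 - r| + 2 * M * |P.1 - z| < ε / 4 * d := by
    have : Tendsto (fun P : ℝ × ℝ => 2 * B * |P.2 - r| + 2 * M * |P.1 - z|) (𝓝 (z, r))
        (𝓝 (2 * B * |r - r| + 2 * M * |z - z|)) := Continuous.tendsto (by fun_prop) (z, r)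
    refine this.eventually (gt_mem_nhds ?_)
    simp only [sub_self, abs_zero, mul_zero, add_zero]
    positivity
  have hc2 : ∀ᶠ P : ℝ × ℝ in 𝓝 (z, r), r / 2 < P.2 :=
    continuous_snd.continuousAt.eventually (lt_mem_nhds (by change r / 2 < r; linarith))
  filter_upwards [hc, hc2] with P hP hP2
  obtain ⟨y, s⟩ := P
  simp only at hP hP2 ⊢
  have hs : 0 < s := by linarith
  by_contra! hcon
  have hlow : ∀ w ∈ Icc y (y + d), u w s ≤ v - ε / 2 := by
    intro w hw
    rcases hw.1.eq_or_lt with rfl | hlt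
    · linarith
    have h1 := hu.oleinik y w s hlt hs
    have h2 : deriv f (u y s) ≤ deriv f (v - ε) := hf.strictMono.monotone hcon
    have h3 : (w - y) / s ≤ deriv f (v - ε / 2) - deriv f (v - ε) := by
      rw [div_le_iff₀ hs]
      nlinarith [hw.2]
    exact hf.strictMono.le_iff_le.1 (by linarith)
  have hint : U (y + d) s - U y s ≤ (v - ε / 2) * d := by
    rw [hU.sub_eq s hs]
    have := intervalIntegral.integral_mono_on (a := y) (b := y + d) (by linarith)
      (hu.intervalIntegrable_comp hf continuous_id hM hs y (y + d))
      (intervalIntegrable_const (c := v - ε / 2)) hlow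
    rw [intervalIntegral.integral_const, smul_eq_mul] at this
    simp only [id] at this
    linarith
  have b1 := hU.abs_sub_le_time hM hB hr hs y
  have b2 := hU.abs_sub_le_time hM hB hr hs (y + d)
  have b3 := hU.abs_sub_le hM hr z y
  have b4 := hU.abs_sub_le hM hr z' (y + d)
  have e : y + d - z' = y - z := by rw [hd]; ring
  rw [e] at b4
  have := (abs_le.1 b1).2
  have := (abs_le.1 b2).1
  have := (abs_le.1 b3).2
  have := (abs_le.1 b4).1
  nlinarith

/-- At a point where `u` is continuous with value `v`, the potential follows the backward
characteristic of speed `f'(v)` to first order. -/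
theorem IsPotential.backward_step (hf : IsFlux f) (hu : IsEntropySolution f φ u)
    (hU : IsPotential f u U) (hM : ∀ x t, 0 < t → |u x t| ≤ M)
    (hB : ∀ x t, 0 < t → |f (u x t)| ≤ B) {z r v : ℝ} (hr : 0 < r)
    (hc : Tendsto (fun P : ℝ × ℝ => u P.1 P.2) (𝓝 (z, r)) (𝓝 v)) {ε : ℝ} (hε : 0 < ε) :
    ∀ᶠ h in 𝓝[>] 0, U (z - h * deriv f v) (r - h) + h * legendre f v ≤ U z r + ε * h := by
  set σ := deriv f v with hσ
  set ε' := ε / (2 * (|σ| + 1)) with hε'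
  have hε'0 : 0 < ε' := by positivity
  have hcf : Tendsto (fun P : ℝ × ℝ => f (u P.1 P.2)) (𝓝 (z, r)) (𝓝 (f v)) :=
    (hf.continuous.tendsto v).comp hc
  have hev : ∀ᶠ P : ℝ × ℝ in 𝓝 (z, r), |u P.1 P.2 - v| < ε' ∧ f (u P.1 P.2) < f v + ε / 2 := by
    refine Eventually.and ?_ (hcf.eventually (gt_mem_nhds (by linarith)))
    have := hc.eventually (Metric.ball_mem_nhds v hε'0)
    filter_upwards [this] with P hP
    exact hP
  obtain ⟨δ, hδ, hball⟩ := Metric.eventually_nhds_iff.1 hev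
  have hloc : ∀ x s, |x - z| < δ → |s - r| < δ → |u x s - v| < ε' ∧ f (u x s) < f v + ε / 2 := by
    intro x s hx hs
    exact hball (y := (x, s)) (by rw [Prod.dist_eq]; exact max_lt hx hs)
  have h1 : ∀ᶠ h : ℝ in 𝓝[>] 0, h * |σ| < δ := by
    have : Tendsto (fun h : ℝ => h * |σ|) (𝓝 0) (𝓝 (0 * |σ|)) := Continuous.tendsto (by fun_prop) 0
    rw [zero_mul] at this
    exact (this.eventually (gt_mem_nhds hδ)).filter_mono nhdsWithin_le_nhds
  have h2 : ∀ᶠ h : ℝ in 𝓝[>] 0, h < min δ r :=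
    (gt_mem_nhds (lt_min hδ hr)).filter_mono nhdsWithin_le_nhds
  filter_upwards [h1, h2, self_mem_nhdsWithin] with h hh1 hh2 hh0
  replace hh0 : 0 < h := hh0
  have hhδ : h < δ := hh2.trans_le (min_le_left _ _)
  have hhr : h < r := hh2.trans_le (min_le_right _ _)
  have habs : |h * σ| = h * |σ| := by rw [abs_mul, abs_of_pos hh0]
  -- the spatial increment at time `r`
  have s1 : |(U z r - U (z - h * σ) r) - h * σ * v| ≤ ε' * (h * |σ|) := by
    rw [hU.sub_eq r hr]
    have e : (∫ w in (z - h * σ)..z, u w r) - h * σ * v = ∫ w in (z - h * σ)..z, (u w r - v) := by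
      have i1 : IntervalIntegrable (fun w => u w r) volume (z - h * σ) z :=
        hu.intervalIntegrable_comp hf continuous_id hM hr _ _
      rw [intervalIntegral.integral_sub i1 (by simp), intervalIntegral.integral_const, smul_eq_mul,
        sub_sub_cancel]
    rw [e]
    have := intervalIntegral.norm_integral_le_of_norm_le_const (a := z - h * σ) (b := z)
      (f := fun w => u w r - v) (C := ε') fun w hw => by
        refine (hloc w r ?_ (by simpa using hδ)).1.le
        have := abs_sub_le_of_uIcc_subset_uIcc
          (uIcc_subset_uIcc (uIoc_subset_uIcc hw) (right_mem_uIcc (a := z - h * σ) (b := z)))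
        rw [sub_sub_cancel, habs, abs_sub_comm] at this
        linarith
    rwa [sub_sub_cancel, habs] at this
  -- the increment in time at `z - hσ`
  have s2 : -(h * (f v + ε / 2)) ≤ U (z - h * σ) r - U (z - h * σ) (r - h) := by
    have hrh : 0 < r - h := by linarith
    have hcl : IsClosed {x | -(h * (f v + ε / 2)) ≤ U x r - U x (r - h)} :=
      isClosed_le continuous_const ((hU.continuous hM hr).sub (hU.continuous hM hrh))
    have hd : Dense {x | |x - z| < δ → -(h * (f v + ε / 2)) ≤ U x r - U x (r - h)} := by
      refine Measure.dense_of_ae (μ := volume) ?_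
      filter_upwards [hU.ae_sub_eq (r - h) r hrh hr, hu.ae_intervalIntegrable hf hB] with x hx hxi hxz
      rw [hx, neg_le_neg_iff]
      have := intervalIntegral.integral_mono_on (a := r - h) (b := r) (by linarith)
        (hxi _ _ hrh hr) (intervalIntegrable_const (c := f v + ε / 2)) fun s hs =>
          (hloc x s hxz (by
            rw [abs_sub_comm, abs_of_nonneg (by linarith [hs.2])]; linarith [hs.1])).2.le
      rwa [intervalIntegral.integral_const, smul_eq_mul, sub_sub_cancel] at this
    have hz : z - h * σ ∈ Metric.ball z δ := by
      rw [Metric.mem_ball, Real.dist_eq, sub_sub_cancel_left, abs_neg, habs]; exact hh1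
    have hcl2 := hd.open_subset_closure_inter Metric.isOpen_ball hz
    have hsub : Metric.ball z δ ∩ {x | |x - z| < δ → -(h * (f v + ε / 2)) ≤ U x r - U x (r - h)} ⊆
        {x | -(h * (f v + ε / 2)) ≤ U x r - U x (r - h)} := fun x hx => hx.2 hx.1
    exact closure_minimal hsub hcl hcl2
  have s3 := (abs_le.1 s1).1
  have s4 : ε' * |σ| ≤ ε / 2 := by
    rw [hε', div_mul_eq_mul_div, div_le_div_iff₀ (by positivity) (by norm_num)]
    nlinarith [abs_nonneg σ]
  have e : legendre f v = v * σ - f v := rfl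
  rw [e]
  nlinarith

/-- At the foot of a minimizing segment the potential is differentiable in the sense required by
`IsPotential.eventually_lt` and `IsPotential.eventually_gt`, so that `u` is continuous there. -/
theorem IsPotential.tendsto_of_isLaxMin (hf : IsFlux f) (hu : IsEntropySolution f φ u)
    (hU : IsPotential f u U) (hM : ∀ x t, 0 < t → |u x t| ≤ M)
    (hB : ∀ x t, 0 < t → |f (u x t)| ≤ B) {r τ x v : ℝ} (hr : 0 < r) (hτ : 0 < τ)
    (hv : IsLaxMin f (fun z => U z r) τ x v) :
    Tendsto (fun P : ℝ × ℝ => u P.1 P.2) (𝓝 (x - τ * deriv f v, r)) (𝓝 v) := by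
  set z := x - τ * deriv f v with hz
  have key : ∀ v', U z r - U (x - τ * deriv f v') r ≤ v' * (z - (x - τ * deriv f v')) := by
    intro v'
    have h1 := hv v'
    have h2 := legendre_sub_le hf v v'
    unfold cost at h1
    simp only [← hz] at h1
    have : z - (x - τ * deriv f v') = τ * (deriv f v' - deriv f v) := by rw [hz]; ring
    rw [this]
    nlinarith
  rw [tendsto_order]
  constructor
  · intro b hb
    have := hU.eventually_gt hf hu hM hB (z := z) (v := v) hr (fun ε hε => ?_) (ε := v - b)
      (by linarith)
    · simpa using this
    have hlt : z < x - τ * deriv f (v - ε) := by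
      have := hf.strictMono (show v - ε < v by linarith)
      rw [hz]; nlinarith
    filter_upwards [Ioo_mem_nhdsGT hlt] with z' hz'
    obtain ⟨w, hw, hwe⟩ := intermediate_value_Icc (show v - ε ≤ v by linarith)
      hf.continuous_deriv.continuousOn (show (x - z') / τ ∈ _ from
        ⟨by rw [le_div_iff₀ hτ]; linarith [hz'.2], by rw [div_le_iff₀ hτ]; linarith [hz'.1]⟩)
    have e : x - τ * deriv f w = z' := by rw [hwe]; field_simp; ring
    have h1 := key w
    rw [e] at h1
    nlinarith [hw.1, hz'.1]
  · intro b hb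
    have := hU.eventually_lt hf hu hM hB (z := z) (v := v) hr (fun ε hε => ?_) (ε := b - v)
      (by linarith)
    · simpa using this
    have hlt : x - τ * deriv f (v + ε) < z := by
      have := hf.strictMono (show v < v + ε by linarith)
      rw [hz]; nlinarith
    filter_upwards [Ioo_mem_nhdsLT hlt] with z' hz'
    obtain ⟨w, hw, hwe⟩ := intermediate_value_Icc (show v ≤ v + ε by linarith)
      hf.continuous_deriv.continuousOn (show (x - z') / τ ∈ _ from
        ⟨by rw [le_div_iff₀ hτ]; linarith [hz'.2], by rw [div_le_iff₀ hτ]; linarith [hz'.1]⟩)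
    have e : x - τ * deriv f w = z' := by rw [hwe]; field_simp; ring
    have h1 := key w
    rw [e] at h1
    nlinarith [hw.2, hz'.2]

/-- From a point of continuity of `u` the potential can be followed back to any earlier time. The
set of times that are reached is closed, and the earliest of them is `s`, since at an earliest time
`r > s` a minimizer of the cost gives a point of continuity to restart from. -/
theorem IsPotential.exists_cost_le_add (hf : IsFlux f) (hu : IsEntropySolution f φ u)
    (hU : IsPotential f u U) (hM : ∀ x t, 0 < t → |u x t| ≤ M)
    (hB : ∀ x t, 0 < t → |f (u x t)| ≤ B) {s t x v₀ : ℝ} (hs : 0 < s) (hst : s < t)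
    (hc : Tendsto (fun P : ℝ × ℝ => u P.1 P.2) (𝓝 (x, t)) (𝓝 v₀)) {ε : ℝ} (hε : 0 < ε) :
    ∃ v, cost f (fun z => U z s) (t - s) x v ≤ U x t + ε * (t - s) := by
  have hM0 : 0 ≤ M := (abs_nonneg _).trans (hM 0 1 one_pos)
  have hB0 : 0 ≤ B := (abs_nonneg _).trans (hB 0 1 one_pos)
  have hpos : ∀ r : ℝ, 0 < max r s := fun r => hs.trans_le (le_max_right _ _)
  -- the potential, frozen before time `s`
  set V : ℝ × ℝ → ℝ := fun P => U P.1 (max P.2 s) with hV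
  have hVc : Continuous V := by
    rw [continuous_iff_continuousAt]
    intro Q
    have hbd : ∀ P : ℝ × ℝ, |V P - V Q| ≤ M * |P.1 - Q.1| + B * |max P.2 s - max Q.2 s| := by
      intro P
      have h1 := hU.abs_sub_le hM (hpos P.2) Q.1 P.1
      have h2 := hU.abs_sub_le_time hM hB (hpos Q.2) (hpos P.2) Q.1
      have e : V P - V Q = (U P.1 (max P.2 s) - U Q.1 (max P.2 s)) +
        (U Q.1 (max P.2 s) - U Q.1 (max Q.2 s)) := by simp only [hV]; ring
      rw [e]
      exact (abs_add_le _ _).trans (add_le_add h1 h2)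
    refine tendsto_iff_norm_sub_tendsto_zero.2 (squeeze_zero (fun _ => norm_nonneg _) hbd ?_)
    have : Tendsto (fun P : ℝ × ℝ => M * |P.1 - Q.1| + B * |max P.2 s - max Q.2 s|) (𝓝 Q)
      (𝓝 (M * |Q.1 - Q.1| + B * |max Q.2 s - max Q.2 s|)) := Continuous.tendsto (by fun_prop) Q
    simpa using this
  set g : ℝ × ℝ → ℝ := fun p => V (x - (t - p.1) * deriv f p.2, p.1) + (t - p.1) * legendre f p.2 -
    ε * (t - p.1) with hg
  have hgc : Continuous g := by
    have h1 := hf.continuous_deriv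
    have h2 := continuous_legendre hf
    fun_prop
  set S : Set (ℝ × ℝ) := (Icc s t ×ˢ Icc (-M) M) ∩ {p | g p ≤ U x t} with hS
  have hSc : IsCompact S :=
    (isCompact_Icc.prod isCompact_Icc).inter_right (isClosed_le hgc continuous_const)
  have ht : 0 < t := hs.trans hst
  have hmaxt : max t s = t := max_eq_left hst.le
  have hSne : S.Nonempty := by
    refine ⟨(t, 0), ⟨⟨hst.le, le_rfl⟩, by simpa using hM0⟩, ?_⟩
    change g (t, 0) ≤ U x t
    simp [hg, hV, hmaxt]
  obtain ⟨⟨r, v⟩, hrv, hmin⟩ := hSc.exists_isMinOn hSne continuous_fst.continuousOn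
  have hsr : s ≤ r := hrv.1.1.1
  have hrt : r ≤ t := hrv.1.1.2
  have hgr : g (r, v) ≤ U x t := hrv.2
  have hmaxr : max r s = r := max_eq_left hsr
  rcases hsr.eq_or_lt with rfl | hlt
  · refine ⟨v, ?_⟩
    simp only [hg, hV, max_self] at hgr
    unfold cost; linarith
  exfalso
  have hr : 0 < r := hs.trans hlt
  -- a continuity point at the earliest time that is reached
  obtain ⟨w, hw1, hw2⟩ : ∃ w, g (r, w) ≤ U x t ∧
      Tendsto (fun P : ℝ × ℝ => u P.1 P.2) (𝓝 (x - (t - r) * deriv f w, r)) (𝓝 w) := by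
    rcases hrt.eq_or_lt with rfl | hlt'
    · refine ⟨v₀, ?_, by simpa using hc⟩
      simp [hg, hV, hmaxt]
    · obtain ⟨w, hw⟩ := exists_isLaxMin hf hM0 (fun a b => hU.abs_sub_le hM hr b a)
        (show 0 < t - r by linarith) x
      refine ⟨w, ?_, hU.tendsto_of_isLaxMin hf hu hM hB hr (by linarith) hw⟩
      have := hw v
      unfold cost at this
      simp only [hg, hV, hmaxr] at hgr ⊢
      linarith
  have hwM : |w| ≤ M := by
    have h1 : Tendsto (fun P : ℝ × ℝ => |u P.1 P.2|) (𝓝 (x - (t - r) * deriv f w, r)) (𝓝 |w|) :=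
      hw2.abs
    refine le_of_tendsto h1 ?_
    filter_upwards [continuous_snd.continuousAt.eventually (lt_mem_nhds hr)] with P hP
    exact hM _ _ hP
  have hstep := hU.backward_step hf hu hM hB hr hw2 hε
  obtain ⟨h, hh1, hh2, hh3⟩ := (hstep.and ((Ioo_mem_nhdsGT (show 0 < r - s by linarith)) :
    ∀ᶠ h in 𝓝[>] 0, h ∈ Ioo 0 (r - s))).exists
  have hmax : max (r - h) s = r - h := max_eq_left (by linarith)
  have hmem : (r - h, w) ∈ S := by
    refine ⟨⟨⟨by simp only; linarith, by simp only; linarith⟩, abs_le.1 hwM⟩, ?_⟩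
    change g (r - h, w) ≤ U x t
    simp only [hg, hV, hmax, hmaxr] at hw1 ⊢
    have e : x - (t - (r - h)) * deriv f w = x - (t - r) * deriv f w - h * deriv f w := by ring
    rw [e]
    linarith
  have := hmin hmem
  simp only at this
  have h5 : r ≤ r - h := this
  linarith

/-- The Hopf–Lax formula between two positive times. -/
theorem IsPotential.eq_cost (hf : IsFlux f) (hu : IsEntropySolution f φ u)
    (hU : IsPotential f u U) (hM : ∀ x t, 0 < t → |u x t| ≤ M)
    (hB : ∀ x t, 0 < t → |f (u x t)| ≤ B) {s t x v : ℝ} (hs : 0 < s) (hst : s < t)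
    (hv : IsLaxMin f (fun z => U z s) (t - s) x v) :
    U x t = cost f (fun z => U z s) (t - s) x v := by
  have hM0 : 0 ≤ M := (abs_nonneg _).trans (hM 0 1 one_pos)
  have ht : 0 < t := hs.trans hst
  refine le_antisymm (hU.le_cost hf hu hM hB hs hst.le x v) ?_
  have hlip : LipschitzWith M.toNNReal fun z => U z t :=
    LipschitzWith.of_dist_le_mul fun a b => by
      rw [Real.dist_eq, Real.dist_eq, Real.coe_toNNReal M hM0]
      exact hU.abs_sub_le hM ht b a
  have hdiff : Dense {y | DifferentiableAt ℝ (fun z => U z t) y} :=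
    Measure.dense_of_ae (μ := volume) hlip.ae_differentiableAt
  refine le_of_forall_pos_le_add fun ε hε => ?_
  set δ := ε / (2 * (2 * M + 1)) with hδ
  have hδ0 : 0 < δ := by positivity
  obtain ⟨y, hy1, hy2⟩ := hdiff.inter_open_nonempty _ (Metric.isOpen_ball (x := x) (ε := δ))
    ⟨x, Metric.mem_ball_self hδ0⟩
  -- `u` is continuous at a point of differentiability of the potential
  have hcont : Tendsto (fun P : ℝ × ℝ => u P.1 P.2) (𝓝 (y, t))
      (𝓝 (deriv (fun z => U z t) y)) := by
    have hd := (show DifferentiableAt ℝ (fun z => U z t) y from hy2).hasDerivAt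
    set d := deriv (fun z => U z t) y
    have hlo : ∀ ε : ℝ, 0 < ε → ∀ᶠ z in 𝓝 y, |U z t - U y t - (z - y) * d| ≤ ε * |z - y| := by
      intro ε hε
      have := (hasDerivAt_iff_isLittleO.1 hd).def hε
      simpa using this
    rw [tendsto_order]
    constructor
    · intro b hb
      have := hU.eventually_gt hf hu hM hB (z := y) (v := d) ht (fun ε hε => ?_) (ε := d - b)
        (by linarith)
      · simpa using this
      filter_upwards [(hlo ε hε).filter_mono nhdsWithin_le_nhds, self_mem_nhdsWithin] with z h1 h2
      have h2 : y < z := h2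
      rw [abs_of_pos (show 0 < z - y by linarith)] at h1
      linarith [(abs_le.1 h1).1]
    · intro b hb
      have := hU.eventually_lt hf hu hM hB (z := y) (v := d) ht (fun ε hε => ?_) (ε := b - d)
        (by linarith)
      · simpa using this
      filter_upwards [(hlo ε hε).filter_mono nhdsWithin_le_nhds, self_mem_nhdsWithin] with z h1 h2
      have h2 : z < y := h2
      rw [abs_of_neg (show z - y < 0 by linarith)] at h1
      linarith [(abs_le.1 h1).1]
  obtain ⟨w, hw⟩ := hU.exists_cost_le_add hf hu hM hB hs hst hcont
    (ε := ε / (2 * (t - s))) (div_pos hε (by linarith))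
  have e1 : ε / (2 * (t - s)) * (t - s) = ε / 2 := by
    have : t - s ≠ 0 := by linarith
    field_simp
  rw [e1] at hw
  have h1 := hv w
  have hyx : |y - x| ≤ δ := (Metric.mem_ball.1 hy1).le
  have h2 := (abs_le.1 (hU.abs_sub_le hM hs (y - (t - s) * deriv f w)
    (x - (t - s) * deriv f w))).2
  have h3 := (abs_le.1 (hU.abs_sub_le hM ht x y)).2
  rw [sub_sub_sub_cancel_right, abs_sub_comm] at h2
  have h4 : M * |y - x| ≤ M * δ := mul_le_mul_of_nonneg_left hyx hM0
  have h5 : 2 * M * δ ≤ ε / 2 := by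
    rw [hδ, mul_div_assoc', div_le_div_iff₀ (by positivity) (by norm_num)]
    nlinarith
  have e2 : cost f (fun z => U z s) (t - s) x w ≤
      cost f (fun z => U z s) (t - s) y w + M * |y - x| := by
    unfold cost; linarith
  linarith

end Backward

/-! ### The initial values -/

section Initial

variable {f φ : ℝ → ℝ} {u U : ℝ → ℝ → ℝ} {M B : ℝ}

theorem IsEntropySolution.abs_primitive_sub_le (hf : IsFlux f) (hu : IsEntropySolution f φ u)
    (hM : ∀ x t, 0 < t → |u x t| ≤ M) (x y : ℝ) :
    |primitive φ x - primitive φ y| ≤ M * |x - y| := by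
  have h : Tendsto (fun t => |(∫ z in (0 : ℝ)..x, u z t) - ∫ z in (0 : ℝ)..y, u z t|) (𝓝[>] 0)
      (𝓝 |primitive φ x - primitive φ y|) := ((hu.initial 0 x).sub (hu.initial 0 y)).abs
  refine le_of_tendsto h ?_
  filter_upwards [self_mem_nhdsWithin] with t ht
  have hi := fun a b => hu.intervalIntegrable_comp hf continuous_id hM ht a b
  have e := intervalIntegral.integral_interval_sub_left (hi 0 x) (hi 0 y)
  simp only [id] at e
  rw [e]
  exact intervalIntegral.norm_integral_le_of_norm_le_const (f := fun z => u z t)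
    fun z _ => hM z t ht

/-- The potential attains the initial primitive, up to a constant, at a linear rate. -/
theorem IsPotential.exists_initial (hu : IsEntropySolution f φ u)
    (hU : IsPotential f u U) (hM : ∀ x t, 0 < t → |u x t| ≤ M)
    (hB : ∀ x t, 0 < t → |f (u x t)| ≤ B) :
    ∃ k, ∀ x t, 0 < t → |U x t - (primitive φ x + k)| ≤ B * t := by
  have hB0 : 0 ≤ B := (abs_nonneg _).trans (hB 0 1 one_pos)
  have hlip : LipschitzOnWith B.toNNReal (fun s => U 0 s) (Ioi 0) :=
    LipschitzOnWith.of_dist_le_mul fun a ha b hb => by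
      rw [Real.dist_eq, Real.dist_eq, Real.coe_toNNReal B hB0]
      exact hU.abs_sub_le_time hM hB hb ha 0
  obtain ⟨g, hg, hge⟩ := hlip.extend_real
  have hk : Tendsto (fun s => U 0 s) (𝓝[>] 0) (𝓝 (g 0)) := by
    refine ((hg.continuous.tendsto 0).mono_left nhdsWithin_le_nhds).congr' ?_
    filter_upwards [self_mem_nhdsWithin] with s hs
    exact (hge hs).symm
  refine ⟨g 0, fun x t ht => ?_⟩
  have hx : Tendsto (fun s => U x s) (𝓝[>] 0) (𝓝 (primitive φ x + g 0)) := by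
    refine ((hu.initial 0 x).add hk).congr' ?_
    filter_upwards [self_mem_nhdsWithin] with s hs
    rw [← hU.sub_eq s hs]; ring
  have h1 : Tendsto (fun s => |U x t - U x s|) (𝓝[>] 0) (𝓝 |U x t - (primitive φ x + g 0)|) :=
    (tendsto_const_nhds.sub hx).abs
  refine le_of_tendsto h1 ?_
  filter_upwards [Ioo_mem_nhdsGT ht] with s hs
  refine (hU.abs_sub_le_time hM hB hs.1 ht x).trans (mul_le_mul_of_nonneg_left ?_ hB0)
  rw [abs_of_nonneg (by linarith [hs.2])]; linarith [hs.1]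

/-- The Hopf–Lax formula for the potential of an entropy solution. -/
theorem IsPotential.hopfLax (hf : IsFlux f) (hu : IsEntropySolution f φ u)
    (hU : IsPotential f u U) (hM : ∀ x t, 0 < t → |u x t| ≤ M)
    (hB : ∀ x t, 0 < t → |f (u x t)| ≤ B) :
    ∃ k, ∀ x t, 0 < t → (∀ v, U x t ≤ cost f (primitive φ) t x v + k) ∧
      ∀ v, IsLaxMin f (primitive φ) t x v → U x t = cost f (primitive φ) t x v + k := by
  have hM0 : 0 ≤ M := (abs_nonneg _).trans (hM 0 1 one_pos)
  have hB0 : 0 ≤ B := (abs_nonneg _).trans (hB 0 1 one_pos)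
  obtain ⟨k, hk⟩ := hU.exists_initial hu hM hB
  refine ⟨k, fun x t ht => ?_⟩
  -- the costs from time `s` and from time `0` differ by `O(s)`
  have hdiff : ∀ s v, 0 < s → |cost f (fun z => U z s) (t - s) x v -
      (cost f (primitive φ) t x v + k)| ≤ s * (B + M * |deriv f v| + |legendre f v|) := by
    intro s v hs
    have h1 := hk (x - (t - s) * deriv f v) s hs
    have h2 := hu.abs_primitive_sub_le hf hM (x - (t - s) * deriv f v) (x - t * deriv f v)
    have e1 : x - (t - s) * deriv f v - (x - t * deriv f v) = s * deriv f v := by ring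
    rw [e1, abs_mul, abs_of_pos hs] at h2
    have e : cost f (fun z => U z s) (t - s) x v - (cost f (primitive φ) t x v + k) =
        (U (x - (t - s) * deriv f v) s - (primitive φ (x - (t - s) * deriv f v) + k)) +
        (primitive φ (x - (t - s) * deriv f v) - primitive φ (x - t * deriv f v)) -
        s * legendre f v := by unfold cost; ring
    rw [e]
    have h3 : |s * legendre f v| = s * |legendre f v| := by rw [abs_mul, abs_of_pos hs]
    refine (abs_sub _ _).trans ((add_le_add_left (abs_add_le _ _) _).trans ?_)
    rw [h3]
    linarith
  have hlim : ∀ c C : ℝ, Tendsto (fun s : ℝ => c + s * C) (𝓝[>] 0) (𝓝 c) := by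
    intro c C
    have : Tendsto (fun s : ℝ => c + s * C) (𝓝 0) (𝓝 (c + 0 * C)) := Continuous.tendsto (by fun_prop) 0
    rw [zero_mul, add_zero] at this
    exact this.mono_left nhdsWithin_le_nhds
  have hle : ∀ v, U x t ≤ cost f (primitive φ) t x v + k := by
    intro v
    refine ge_of_tendsto (hlim _ (B + M * |deriv f v| + |legendre f v|)) ?_
    filter_upwards [Ioo_mem_nhdsGT ht] with s hs
    have h1 := hU.le_cost hf hu hM hB hs.1 hs.2.le x v
    have h2 := (abs_le.1 (hdiff s v hs.1)).2
    linarith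
  refine ⟨hle, fun v hv => le_antisymm (hle v) ?_⟩
  obtain ⟨A, hA⟩ := (isCompact_Icc (a := -M) (b := M)).exists_bound_of_continuousOn
    (f := fun v => B + M * |deriv f v| + |legendre f v|) (by
      have h1 := hf.continuous_deriv
      have h2 := continuous_legendre hf
      exact Continuous.continuousOn (by fun_prop))
  refine ge_of_tendsto (hlim _ A) ?_
  filter_upwards [Ioo_mem_nhdsGT ht] with s hs
  obtain ⟨w, hw⟩ := exists_isLaxMin hf hM0 (fun a b => hU.abs_sub_le hM hs.1 b a)
    (show 0 < t - s by linarith [hs.2]) x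
  have hwM := hw.abs_le hf (fun a b => hU.abs_sub_le hM hs.1 b a) (show 0 < t - s by linarith [hs.2])
  have h1 := hU.eq_cost hf hu hM hB hs.1 hs.2 hw
  have h2 := (abs_le.1 (hdiff s w hs.1)).1
  have h3 := hv w
  have h4 := mul_le_mul_of_nonneg_left ((le_abs_self _).trans (hA w (abs_le.1 hwM))) hs.1.le
  linarith

end Initial

/-! ### Traces and minimizers -/

section Traces

variable {f φ : ℝ → ℝ} {u U : ℝ → ℝ → ℝ} {M B : ℝ}

theorem tendsto_of_tendsto_deriv (hf : IsFlux f) {l : Filter ℝ} {g : ℝ → ℝ} {v : ℝ}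
    (h : Tendsto (fun y => deriv f (g y)) l (𝓝 (deriv f v))) : Tendsto g l (𝓝 v) := by
  rw [tendsto_order] at h ⊢
  refine ⟨fun b hb => ?_, fun b hb => ?_⟩
  · filter_upwards [h.1 _ (hf.strictMono hb)] with y hy
    exact hf.strictMono.lt_iff_lt.1 hy
  · filter_upwards [h.2 _ (hf.strictMono hb)] with y hy
    exact hf.strictMono.lt_iff_lt.1 hy

theorem IsEntropySolution.exists_tendsto (hf : IsFlux f) (hM : ∀ x t, 0 < t → |u x t| ≤ M)
    {t x A : ℝ} (ht : 0 < t) {l : Filter ℝ} [l.NeBot] (hl : l ≤ 𝓝 x)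
    (h : Tendsto (fun y => deriv f (u y t) - y / t) l (𝓝 A)) :
    ∃ v, Tendsto (fun y => u y t) l (𝓝 v) := by
  have h1 : Tendsto (fun y => deriv f (u y t)) l (𝓝 (A + x / t)) := by
    have := h.add ((tendsto_id.mono_left hl).div_const t)
    simpa using this
  have h2 : A + x / t ∈ Icc (deriv f (-M)) (deriv f M) :=
    isClosed_Icc.mem_of_tendsto h1 (Eventually.of_forall fun y =>
      ⟨hf.strictMono.monotone (abs_le.1 (hM y t ht)).1,
        hf.strictMono.monotone (abs_le.1 (hM y t ht)).2⟩)
  have hM0 : 0 ≤ M := (abs_nonneg _).trans (hM 0 t ht)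
  obtain ⟨v, -, hv⟩ := intermediate_value_Icc (show -M ≤ M by linarith)
    hf.continuous_deriv.continuousOn h2
  exact ⟨v, tendsto_of_tendsto_deriv hf (hv ▸ h1)⟩

theorem IsEntropySolution.tendsto_traceLeft (hf : IsFlux f) (hu : IsEntropySolution f φ u) {t : ℝ}
    (ht : 0 < t) (x : ℝ) : Tendsto (fun y => u y t) (𝓝[<] x) (𝓝 (traceLeft u x t)) := by
  obtain ⟨M, hM⟩ := hu.bounded
  obtain ⟨v, hv⟩ := IsEntropySolution.exists_tendsto hf hM ht nhdsWithin_le_nhds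
    ((hu.antitone ht).tendsto_leftLim x)
  rwa [traceLeft, leftLim_eq_of_tendsto hv]

theorem IsEntropySolution.tendsto_traceRight (hf : IsFlux f) (hu : IsEntropySolution f φ u) {t : ℝ}
    (ht : 0 < t) (x : ℝ) : Tendsto (fun y => u y t) (𝓝[>] x) (𝓝 (traceRight u x t)) := by
  obtain ⟨M, hM⟩ := hu.bounded
  obtain ⟨v, hv⟩ := IsEntropySolution.exists_tendsto hf hM ht nhdsWithin_le_nhds
    ((hu.antitone ht).tendsto_rightLim x)
  rwa [traceRight, rightLim_eq_of_tendsto hv]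

/-- The foot on the `x`-axis of the characteristic with the value `u(x,t)`. -/
def foot (f : ℝ → ℝ) (u : ℝ → ℝ → ℝ) (x t : ℝ) : ℝ := x - t * deriv f (u x t)

theorem IsEntropySolution.foot_mono (hu : IsEntropySolution f φ u) {t : ℝ} (ht : 0 < t) :
    Monotone fun x => foot f u x t := by
  intro x y hxy
  have h := mul_le_mul_of_nonneg_left (hu.antitone ht hxy) ht.le
  have e : ∀ z, t * (deriv f (u z t) - z / t) = t * deriv f (u z t) - z := by
    intro z; field_simp
  simp only [e] at h
  unfold foot; linarith

theorem IsEntropySolution.tendsto_footLeft (hf : IsFlux f) (hu : IsEntropySolution f φ u) {t : ℝ}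
    (ht : 0 < t) (x : ℝ) : Tendsto (fun y => foot f u y t) (𝓝[<] x) (𝓝 (footLeft f u x t)) :=
  (tendsto_id.mono_left nhdsWithin_le_nhds).sub
    (((hf.continuous_deriv.tendsto _).comp (hu.tendsto_traceLeft hf ht x)).const_mul t)

theorem IsEntropySolution.tendsto_footRight (hf : IsFlux f) (hu : IsEntropySolution f φ u) {t : ℝ}
    (ht : 0 < t) (x : ℝ) : Tendsto (fun y => foot f u y t) (𝓝[>] x) (𝓝 (footRight f u x t)) :=
  (tendsto_id.mono_left nhdsWithin_le_nhds).sub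
    (((hf.continuous_deriv.tendsto _).comp (hu.tendsto_traceRight hf ht x)).const_mul t)

theorem IsEntropySolution.foot_le_footLeft (hf : IsFlux f) (hu : IsEntropySolution f φ u) {t : ℝ}
    (ht : 0 < t) {x y : ℝ} (h : x < y) : foot f u x t ≤ footLeft f u y t := by
  refine ge_of_tendsto (hu.tendsto_footLeft hf ht y) ?_
  filter_upwards [Ioo_mem_nhdsLT h] with z hz
  exact hu.foot_mono ht hz.1.le

theorem IsEntropySolution.footRight_le_foot (hf : IsFlux f) (hu : IsEntropySolution f φ u) {t : ℝ}
    (ht : 0 < t) {x y : ℝ} (h : x < y) : footRight f u x t ≤ foot f u y t := by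
  refine le_of_tendsto (hu.tendsto_footRight hf ht x) ?_
  filter_upwards [Ioo_mem_nhdsGT h] with z hz
  exact hu.foot_mono ht hz.2.le

theorem IsEntropySolution.footLeft_le_foot (hf : IsFlux f) (hu : IsEntropySolution f φ u) {t : ℝ}
    (ht : 0 < t) (x : ℝ) : footLeft f u x t ≤ foot f u x t := by
  refine le_of_tendsto (hu.tendsto_footLeft hf ht x) ?_
  filter_upwards [self_mem_nhdsWithin] with z hz
  exact hu.foot_mono ht (le_of_lt hz)

theorem IsEntropySolution.foot_le_footRight (hf : IsFlux f) (hu : IsEntropySolution f φ u) {t : ℝ}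
    (ht : 0 < t) (x : ℝ) : foot f u x t ≤ footRight f u x t := by
  refine ge_of_tendsto (hu.tendsto_footRight hf ht x) ?_
  filter_upwards [self_mem_nhdsWithin] with z hz
  exact hu.foot_mono ht (le_of_lt hz)

theorem IsEntropySolution.footRight_le_footLeft (hf : IsFlux f) (hu : IsEntropySolution f φ u)
    {t : ℝ} (ht : 0 < t) {x y : ℝ} (h : x < y) : footRight f u x t ≤ footLeft f u y t :=
  (hu.footRight_le_foot hf ht (left_lt_add_div_two.2 h)).trans
    (hu.foot_le_footLeft hf ht (add_div_two_lt_right.2 h))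

theorem IsEntropySolution.le_traceLeft (hf : IsFlux f) (hu : IsEntropySolution f φ u) {t : ℝ}
    (ht : 0 < t) (x : ℝ) : u x t ≤ traceLeft u x t := by
  have h := hu.footLeft_le_foot hf ht x
  unfold foot footLeft at h
  exact hf.strictMono.le_iff_le.1 (le_of_mul_le_mul_left (by linarith) ht)

theorem IsEntropySolution.traceRight_le (hf : IsFlux f) (hu : IsEntropySolution f φ u) {t : ℝ}
    (ht : 0 < t) (x : ℝ) : traceRight u x t ≤ u x t := by
  have h := hu.foot_le_footRight hf ht x
  unfold foot footRight at h
  exact hf.strictMono.le_iff_le.1 (le_of_mul_le_mul_left (by linarith) ht)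

/-- A minimizer of the Hopf–Lax cost does not exceed the left trace. -/
theorem IsEntropySolution.isLaxMin_le_traceLeft (hf : IsFlux f) (hu : IsEntropySolution f φ u)
    (hut : IsTimeContinuous u) {t x v : ℝ} (ht : 0 < t) (hv : IsLaxMin f (primitive φ) t x v) :
    v ≤ traceLeft u x t := by
  obtain ⟨M, hM⟩ := hu.bounded
  obtain ⟨B, -, hB⟩ := hf.exists_bound M
  obtain ⟨U, hU⟩ := hu.exists_potential hf hut
  obtain ⟨k, hk⟩ := hU.hopfLax hf hu hM fun x t ht => hB _ (hM x t ht)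
  refine le_of_forall_pos_le_add fun ε hε => ?_
  have hlim := hu.tendsto_traceLeft hf ht x
  have hev : ∀ᶠ y in 𝓝[<] x, u y t < traceLeft u x t + ε / 2 :=
    hlim.eventually (gt_mem_nhds (by linarith))
  obtain ⟨a, ha, hax⟩ := (mem_nhdsLT_iff_exists_Ioo_subset).1 hev
  have ha : a < x := ha
  have hlt : x - t * (deriv f v - deriv f (v - ε / 2)) < x := by
    have := hf.strictMono (show v - ε / 2 < v by linarith)
    nlinarith
  obtain ⟨y, hy1, hy2⟩ := exists_between (max_lt ha hlt)
  have hya := (max_lt_iff.1 hy1).1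
  have hyb := (max_lt_iff.1 hy1).2
  obtain ⟨w, hw, hwe⟩ := intermediate_value_Icc (show v - ε / 2 ≤ v by linarith)
    hf.continuous_deriv.continuousOn (show deriv f v - (x - y) / t ∈ _ from
      ⟨by rw [le_sub_comm, div_le_iff₀ ht]; linarith, by
        have : 0 ≤ (x - y) / t := div_nonneg (by linarith) ht.le
        linarith⟩)
  have h1 := (hk y t ht).1 w
  have h2 := (hk x t ht).2 v hv
  have e : y - t * deriv f w = x - t * deriv f v := by rw [hwe]; field_simp; ring
  have h3 := legendre_sub_ge hf w v
  have h4 : deriv f v - deriv f w = (x - y) / t := by rw [hwe]; ring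
  rw [h4] at h3
  have h5 : w * (x - y) ≤ U x t - U y t := by
    unfold cost at h1 h2
    rw [e] at h1
    have := mul_le_mul_of_nonneg_left h3 ht.le
    have e2 : t * (w * ((x - y) / t)) = w * (x - y) := by field_simp
    linarith
  have h6 : U x t - U y t ≤ (traceLeft u x t + ε / 2) * (x - y) := by
    rw [hU.sub_eq t ht]
    have := intervalIntegral.integral_mono_on_of_le_Ioo (a := y) (b := x) hy2.le
      (hu.intervalIntegrable_comp hf continuous_id hM ht y x)
      (intervalIntegrable_const (c := traceLeft u x t + ε / 2))
      fun z hz => le_of_lt (hax ⟨hya.trans hz.1, hz.2⟩)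
    rw [intervalIntegral.integral_const, smul_eq_mul] at this
    simp only [id] at this
    linarith
  have h7 : w ≤ traceLeft u x t + ε / 2 := le_of_mul_le_mul_right (h5.trans h6) (by linarith)
  linarith [hw.1]

/-- A minimizer of the Hopf–Lax cost is at least the right trace. -/
theorem IsEntropySolution.traceRight_le_isLaxMin (hf : IsFlux f) (hu : IsEntropySolution f φ u)
    (hut : IsTimeContinuous u) {t x v : ℝ} (ht : 0 < t) (hv : IsLaxMin f (primitive φ) t x v) :
    traceRight u x t ≤ v := by
  obtain ⟨M, hM⟩ := hu.bounded
  obtain ⟨B, -, hB⟩ := hf.exists_bound M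
  obtain ⟨U, hU⟩ := hu.exists_potential hf hut
  obtain ⟨k, hk⟩ := hU.hopfLax hf hu hM fun x t ht => hB _ (hM x t ht)
  refine le_of_forall_pos_le_add fun ε hε => ?_
  have hlim := hu.tendsto_traceRight hf ht x
  have hev : ∀ᶠ y in 𝓝[>] x, traceRight u x t - ε / 2 < u y t :=
    hlim.eventually (lt_mem_nhds (by linarith))
  obtain ⟨a, ha, hax⟩ := (mem_nhdsGT_iff_exists_Ioo_subset).1 hev
  have ha : x < a := ha
  have hlt : x < x + t * (deriv f (v + ε / 2) - deriv f v) := by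
    have := hf.strictMono (show v < v + ε / 2 by linarith)
    nlinarith
  obtain ⟨y, hy1, hy2⟩ := exists_between (lt_min ha hlt)
  have hya := (lt_min_iff.1 hy2).1
  have hyb := (lt_min_iff.1 hy2).2
  obtain ⟨w, hw, hwe⟩ := intermediate_value_Icc (show v ≤ v + ε / 2 by linarith)
    hf.continuous_deriv.continuousOn (show deriv f v + (y - x) / t ∈ _ from
      ⟨by
        have : 0 ≤ (y - x) / t := div_nonneg (by linarith) ht.le
        linarith, by rw [← le_sub_iff_add_le', div_le_iff₀ ht]; linarith⟩)
  have h1 := (hk y t ht).1 w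
  have h2 := (hk x t ht).2 v hv
  have e : y - t * deriv f w = x - t * deriv f v := by rw [hwe]; field_simp; ring
  have h3 := legendre_sub_le hf v w
  have h4 : deriv f w - deriv f v = (y - x) / t := by rw [hwe]; ring
  rw [h4] at h3
  have h5 : U y t - U x t ≤ w * (y - x) := by
    unfold cost at h1 h2
    rw [e] at h1
    have := mul_le_mul_of_nonneg_left h3 ht.le
    have e2 : t * (w * ((y - x) / t)) = w * (y - x) := by field_simp
    linarith
  have h6 : (traceRight u x t - ε / 2) * (y - x) ≤ U y t - U x t := by
    rw [hU.sub_eq t ht]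
    have := intervalIntegral.integral_mono_on_of_le_Ioo (a := x) (b := y) hy1.le
      (intervalIntegrable_const (c := traceRight u x t - ε / 2))
      (hu.intervalIntegrable_comp hf continuous_id hM ht x y)
      fun z hz => le_of_lt (hax ⟨hz.1, hz.2.trans hya⟩)
    rw [intervalIntegral.integral_const, smul_eq_mul] at this
    simp only [id] at this
    linarith
  have h7 : traceRight u x t - ε / 2 ≤ w := le_of_mul_le_mul_right (h6.trans h5) (by linarith)
  linarith [hw.2]

theorem isLaxMin_of_tendsto (hf : IsFlux f) {K : ℝ → ℝ} (hK : Continuous K) {t x v : ℝ}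
    {l : Filter ℝ} [l.NeBot] (hl : l ≤ 𝓝 x) {w : ℝ → ℝ} (hw : Tendsto w l (𝓝 v))
    (h : ∀ y, IsLaxMin f K t y (w y)) : IsLaxMin f K t x v := by
  intro v'
  have hc : Continuous fun p : ℝ × ℝ => cost f K t p.1 p.2 := by
    have h1 := hf.continuous_deriv
    have h2 := continuous_legendre hf
    unfold cost
    fun_prop
  have h1 : Tendsto (fun y => cost f K t y (w y)) l (𝓝 (cost f K t x v)) :=
    (hc.tendsto (x, v)).comp ((tendsto_id.mono_left hl).prodMk_nhds hw)
  have h2 : Tendsto (fun y => cost f K t y v') l (𝓝 (cost f K t x v')) :=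
    (hc.tendsto (x, v')).comp ((tendsto_id.mono_left hl).prodMk_nhds tendsto_const_nhds)
  exact le_of_tendsto_of_tendsto' h1 h2 fun y => h y v'

/-- The one-sided traces are themselves minimizers, as limits of minimizers at neighbouring
points. -/
theorem IsEntropySolution.isLaxMin_traces (hf : IsFlux f) (hu : IsEntropySolution f φ u)
    (hut : IsTimeContinuous u) {t : ℝ} (ht : 0 < t) (x : ℝ) :
    IsLaxMin f (primitive φ) t x (traceLeft u x t) ∧
      IsLaxMin f (primitive φ) t x (traceRight u x t) := by
  obtain ⟨M, hM⟩ := hu.bounded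
  have hM0 : 0 ≤ M := (abs_nonneg _).trans (hM 0 1 one_pos)
  have hlip := hu.abs_primitive_sub_le hf hM
  choose w hw using fun y => exists_isLaxMin hf hM0 hlip ht y
  have hc := continuous_of_abs_sub_le hlip
  have hfw : ∀ y, footLeft f u y t ≤ y - t * deriv f (w y) ∧
      y - t * deriv f (w y) ≤ footRight f u y t := by
    intro y
    have h1 := hf.strictMono.monotone (hu.isLaxMin_le_traceLeft hf hut ht (hw y))
    have h2 := hf.strictMono.monotone (hu.traceRight_le_isLaxMin hf hut ht (hw y))
    unfold footLeft footRight
    constructor <;> nlinarith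
  -- the feet of the minimizers are squeezed between feet of the solution at neighbouring points
  have key : ∀ (l : Filter ℝ) (v : ℝ), l ≤ 𝓝 x →
      Tendsto (fun y => y - t * deriv f (w y)) l (𝓝 (x - t * deriv f v)) → Tendsto w l (𝓝 v) := by
    intro l v hl h
    refine tendsto_of_tendsto_deriv hf ?_
    have h1 := ((tendsto_id.mono_left hl).sub h).div_const t
    simpa [mul_div_cancel_left₀ _ ht.ne'] using h1
  constructor
  · refine isLaxMin_of_tendsto hf hc nhdsWithin_le_nhds (key (𝓝[<] x) _ nhdsWithin_le_nhds ?_) hw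
    have h1 := hu.tendsto_footLeft hf ht x
    change Tendsto _ _ (𝓝 (footLeft f u x t))
    rw [tendsto_order] at h1 ⊢
    refine ⟨fun b hb => ?_, fun b hb => ?_⟩
    · obtain ⟨a, ha, hax⟩ := (mem_nhdsLT_iff_exists_Ioo_subset).1 (h1.1 b hb)
      filter_upwards [Ioo_mem_nhdsLT (show a < x from ha)] with y hy
      have h3 : b < foot f u ((a + y) / 2) t := hax ⟨by linarith [hy.1], by linarith [hy.1, hy.2]⟩
      exact h3.trans_le ((hu.foot_le_footLeft hf ht (by linarith [hy.1])).trans (hfw y).1)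
    · filter_upwards [self_mem_nhdsWithin] with y hy
      exact ((hfw y).2.trans (hu.footRight_le_footLeft hf ht hy)).trans_lt hb
  · refine isLaxMin_of_tendsto hf hc nhdsWithin_le_nhds (key (𝓝[>] x) _ nhdsWithin_le_nhds ?_) hw
    have h1 := hu.tendsto_footRight hf ht x
    change Tendsto _ _ (𝓝 (footRight f u x t))
    rw [tendsto_order] at h1 ⊢
    refine ⟨fun b hb => ?_, fun b hb => ?_⟩
    · filter_upwards [self_mem_nhdsWithin] with y hy
      exact hb.trans_le ((hu.footRight_le_footLeft hf ht hy).trans (hfw y).1)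
    · obtain ⟨a, ha, hax⟩ := (mem_nhdsGT_iff_exists_Ioo_subset).1 (h1.2 b hb)
      filter_upwards [Ioo_mem_nhdsGT (show x < a from ha)] with y hy
      have h3 : foot f u ((y + a) / 2) t < b := hax ⟨by linarith [hy.1, hy.2], by linarith [hy.2]⟩
      exact ((hfw y).2.trans (hu.footRight_le_foot hf ht (by linarith [hy.2]))).trans_lt h3

end Traces

/-! ### Supporting lines of the initial primitive -/

/-- The line of slope `c` through `(x, K x)` supports the graph of `K` from below. -/
def IsSupport (K : ℝ → ℝ) (x c : ℝ) : Prop := ∀ z, K x + c * (z - x) ≤ K z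

section Support

variable {f K φ : ℝ → ℝ} {M : ℝ}

theorem abs_le_of_affine_le (hK : ∀ x y, |K x - K y| ≤ M * |x - y|) {c d : ℝ}
    (h : ∀ z, c * z + d ≤ K z) : |c| ≤ M := by
  have key : ∀ z, 0 < z → |c| * z ≤ M * z + (K 0 - d) := by
    intro z hz
    rcases abs_cases c with ⟨hc, _⟩ | ⟨hc, _⟩
    · have h1 := (abs_le.1 (hK z 0)).2
      rw [sub_zero, abs_of_pos hz] at h1
      have := h z
      rw [hc]; linarith
    · have h1 := (abs_le.1 (hK (-z) 0)).2
      rw [sub_zero, abs_neg, abs_of_pos hz] at h1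
      have := h (-z)
      rw [hc]; linarith
  by_contra! hcon
  have h1 := key ((|K 0 - d| + 1) / (|c| - M)) (div_pos (by positivity) (by linarith))
  have h2 : (|c| - M) * ((|K 0 - d| + 1) / (|c| - M)) = |K 0 - d| + 1 :=
    mul_div_cancel₀ _ (by linarith)
  linarith [le_abs_self (K 0 - d)]

theorem IsSupport.abs_le (hK : ∀ x y, |K x - K y| ≤ M * |x - y|) {x c : ℝ} (h : IsSupport K x c) :
    |c| ≤ M :=
  abs_le_of_affine_le hK (d := K x - c * x) fun z => by linarith [h z]

theorem IsSupport.mono {x y c d : ℝ} (hx : IsSupport K x c) (hy : IsSupport K y d) (h : x < y) :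
    c ≤ d := by
  have h1 := hx y
  have h2 := hy x
  have : (y - x) * c ≤ (y - x) * d := by linarith
  exact le_of_mul_le_mul_left this (by linarith)

theorem isSupport_of_tendsto (hK : Continuous K) {ι : Type*} {l : Filter ι} [l.NeBot] {x c : ι → ℝ}
    {x₀ c₀ : ℝ} (hx : Tendsto x l (𝓝 x₀)) (hc : Tendsto c l (𝓝 c₀))
    (h : ∀ᶠ i in l, IsSupport K (x i) (c i)) : IsSupport K x₀ c₀ := by
  intro z
  refine le_of_tendsto (((hK.tendsto x₀).comp hx).add (hc.mul (tendsto_const_nhds.sub hx))) ?_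
  filter_upwards [h] with i hi using hi z

theorem convexOn_line (k c x : ℝ) : ConvexOn ℝ univ fun z => k + c * (z - x) := by
  refine ⟨convex_univ, fun y _ z _ a b _ _ hab => le_of_eq ?_⟩
  simp only [smul_eq_mul]
  linear_combination (c * x - k) * hab

/-- A point of the contact set is one at which the primitive has a supporting line. -/
theorem mem_contactSet_iff (hK : ∀ x y, |primitive φ x - primitive φ y| ≤ M * |x - y|) {x : ℝ} :
    x ∈ contactSet φ ↔ ∃ c, IsSupport (primitive φ) x c := by
  constructor
  · intro hx
    have hx : (primitive φ x : EReal) = convHull φ x := hx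
    have hex : ∀ n : ℕ, ∃ c, ∀ z, primitive φ x - 1 / ((n : ℝ) + 1) + c * (z - x) ≤
        primitive φ z := by
      intro n
      have hlt : ((primitive φ x - 1 / ((n : ℝ) + 1) : ℝ) : EReal) < convHull φ x := by
        rw [← hx, EReal.coe_lt_coe_iff]
        have : 0 < 1 / ((n : ℝ) + 1) := by positivity
        linarith
      obtain ⟨⟨g, hg, hle⟩, hgx⟩ := lt_iSup_iff.1 hlt
      rw [EReal.coe_lt_coe_iff] at hgx
      have hgc : ContinuousOn g univ := by
        simpa using hg.continuousOn_interior
      obtain ⟨c, c', h1, h2⟩ := hg.exists_affine_le_of_lt_real (mem_univ x) hgx isClosed_univ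
        hgc.lowerSemicontinuousOn
      refine ⟨c, fun z => ?_⟩
      have := (h1 z (mem_univ z)).trans (hle z)
      linarith
    choose c hc using hex
    have hcM : ∀ n, c n ∈ Icc (-M) M := fun n => abs_le.1 <|
      abs_le_of_affine_le hK (d := primitive φ x - 1 / ((n : ℝ) + 1) - c n * x)
        fun z => by linarith [hc n z]
    obtain ⟨a, -, ψ, hψ, hlim⟩ := isCompact_Icc.tendsto_subseq hcM
    refine ⟨a, fun z => ?_⟩
    have h1 : Tendsto (fun n => primitive φ x - 1 / ((ψ n : ℝ) + 1) + c (ψ n) * (z - x)) atTop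
        (𝓝 (primitive φ x - 0 + a * (z - x))) :=
      (tendsto_const_nhds.sub (tendsto_one_div_add_atTop_nhds_zero_nat.comp hψ.tendsto_atTop)).add
        (hlim.mul_const _)
    rw [sub_zero] at h1
    exact le_of_tendsto' h1 fun n => hc (ψ n) z
  · rintro ⟨c, hc⟩
    refine le_antisymm ?_ (iSup_le fun g => EReal.coe_le_coe_iff.2 (g.2.2 x))
    have := le_iSup (fun g : {g : ℝ → ℝ // ConvexOn ℝ univ g ∧ ∀ y, g y ≤ primitive φ y} =>
      ((g.1 x : ℝ) : EReal)) ⟨_, convexOn_line _ c x, hc⟩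
    simpa [convHull] using this

theorem isClosed_contactSet (hK : ∀ x y, |primitive φ x - primitive φ y| ≤ M * |x - y|) :
    IsClosed (contactSet φ) := by
  refine isClosed_of_closure_subset fun x hx => ?_
  obtain ⟨y, hy, hyx⟩ := mem_closure_iff_seq_limit.1 hx
  choose c hc using fun n => (mem_contactSet_iff hK).1 (hy n)
  obtain ⟨a, -, ψ, hψ, hlim⟩ := isCompact_Icc.tendsto_subseq
    fun n => abs_le.1 ((hc n).abs_le hK)
  exact (mem_contactSet_iff hK).2 ⟨a, isSupport_of_tendsto (continuous_of_abs_sub_le hK)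
    (hyx.comp hψ.tendsto_atTop) hlim (Eventually.of_forall fun n => hc (ψ n))⟩

/-! ### Minimizers at large times -/

/-- At large times a minimizer is nearly the slope of a supporting line at the foot of its
segment. -/
theorem IsLaxMin.exists_almost_support (hf : IsFlux f) (hK : ∀ x y, |K x - K y| ≤ M * |x - y|)
    {η R : ℝ} (hη : 0 < η) : ∃ T, 0 < T ∧ ∀ t, T ≤ t → ∀ x v, IsLaxMin f K t x v →
      ∀ z, |z - (x - t * deriv f v)| ≤ R →
        K (x - t * deriv f v) + v * (z - (x - t * deriv f v)) - η * |z - (x - t * deriv f v)| ≤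
          K z := by
  obtain ⟨κ, hκ, h⟩ := hf.exists_near M hη
  refine ⟨max (R / κ) 1, by positivity, fun t ht x v hv z hz => ?_⟩
  have ht0 : 0 < t := lt_of_lt_of_le (by positivity) ht
  have htR : R / κ ≤ t := (le_max_left _ _).trans ht
  set y := x - t * deriv f v with hy
  obtain ⟨w, hw1, hw2⟩ := h v (hv.abs_le hf hK ht0) ((y - z) / t) (by
    rw [abs_div, abs_of_pos ht0, div_le_iff₀ ht0, abs_sub_comm]
    rw [div_le_iff₀ hκ] at htR
    linarith)
  have h1 := hv w
  unfold cost at h1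
  have e : x - t * deriv f w = z := by rw [hw2, hy]; field_simp; ring
  rw [e, ← hy] at h1
  have h2 := legendre_sub_ge hf w v
  have h3 : deriv f v - deriv f w = (z - y) / t := by rw [hw2]; field_simp; ring
  rw [h3] at h2
  have h4 := mul_le_mul_of_nonneg_left h2 ht0.le
  have e2 : t * (w * ((z - y) / t)) = w * (z - y) := by field_simp
  rw [e2] at h4
  have h5 : |(v - w) * (z - y)| ≤ η * |z - y| := by
    rw [abs_mul, abs_sub_comm]
    exact mul_le_mul_of_nonneg_right hw1 (abs_nonneg _)
  have h6 := (_root_.abs_le.1 h5).2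
  linarith

/-- Limits at large times of feet and minimizers are points of contact and slopes of supporting
lines. -/
theorem isSupport_of_tendsto_foot (hf : IsFlux f) (hK : ∀ x y, |K x - K y| ≤ M * |x - y|)
    {ι : Type*} {l : Filter ι} [l.NeBot] {t x v : ι → ℝ} {y c : ℝ} (ht : Tendsto t l atTop)
    (hv : ∀ᶠ i in l, IsLaxMin f K (t i) (x i) (v i))
    (hy : Tendsto (fun i => x i - t i * deriv f (v i)) l (𝓝 y)) (hc : Tendsto v l (𝓝 c)) :
    IsSupport K y c := by
  intro z
  have hKc := continuous_of_abs_sub_le hK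
  have key : ∀ η : ℝ, 0 < η → K y + c * (z - y) - η * |z - y| ≤ K z := by
    intro η hη
    obtain ⟨T, -, hT⟩ := IsLaxMin.exists_almost_support hf hK (R := |z - y| + 1) hη
    have hlim : Tendsto (fun i => K (x i - t i * deriv f (v i)) +
        v i * (z - (x i - t i * deriv f (v i))) - η * |z - (x i - t i * deriv f (v i))|) l
        (𝓝 (K y + c * (z - y) - η * |z - y|)) :=
      (((hKc.tendsto y).comp hy).add (hc.mul (tendsto_const_nhds.sub hy))).sub
        ((tendsto_const_nhds.sub hy).abs.const_mul η)
    refine le_of_tendsto hlim ?_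
    have hn : ∀ᶠ i in l, |z - (x i - t i * deriv f (v i))| < |z - y| + 1 :=
      (tendsto_const_nhds.sub hy).abs.eventually (gt_mem_nhds (by linarith))
    filter_upwards [ht.eventually_ge_atTop T, hv, hn] with i h1 h2 h3
    exact hT (t i) h1 (x i) (v i) h2 z h3.le
  have hlim : Tendsto (fun η : ℝ => K y + c * (z - y) - η * |z - y|) (𝓝[>] 0)
      (𝓝 (K y + c * (z - y) - 0 * |z - y|)) :=
    (Continuous.tendsto (by fun_prop) 0).mono_left nhdsWithin_le_nhds
  rw [zero_mul, sub_zero] at hlim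
  refine le_of_tendsto hlim ?_
  filter_upwards [self_mem_nhdsWithin] with η hη using key η hη

theorem exists_isSupport_of_tendsto_foot (hf : IsFlux f) (hK : ∀ x y, |K x - K y| ≤ M * |x - y|)
    {x v : ℝ → ℝ} {y : ℝ} (hv : ∀ᶠ t in atTop, IsLaxMin f K t (x t) (v t))
    (hy : Tendsto (fun t => x t - t * deriv f (v t)) atTop (𝓝 y)) : ∃ c, IsSupport K y c := by
  have h1 : ∀ᶠ t : ℝ in atTop, IsLaxMin f K t (x t) (v t) ∧ 0 < t :=
    hv.and (eventually_gt_atTop 0)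
  obtain ⟨T, hT⟩ := eventually_atTop.1 h1
  have hcM : ∀ n : ℕ, v (T + n) ∈ Icc (-M) M := fun n =>
    abs_le.1 ((hT (T + n) (by linarith [n.cast_nonneg (α := ℝ)])).1.abs_le hf hK
      (hT (T + n) (by linarith [n.cast_nonneg (α := ℝ)])).2)
  obtain ⟨c, -, ψ, hψ, hlim⟩ := isCompact_Icc.tendsto_subseq hcM
  have htt : Tendsto (fun n => T + (ψ n : ℝ)) atTop atTop :=
    tendsto_const_nhds.add_atTop (tendsto_natCast_atTop_atTop.comp hψ.tendsto_atTop)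
  exact ⟨c, isSupport_of_tendsto_foot hf hK (t := fun n => T + (ψ n : ℝ))
    (x := fun n => x (T + ψ n)) (v := fun n => v (T + ψ n)) htt
    (Eventually.of_forall fun n => (hT _ (by linarith [(ψ n).cast_nonneg (α := ℝ)])).1)
    (hy.comp htt) hlim⟩

/-- A supporting line of slope `c` at `x₀` makes `c` the only minimizer along a line. -/
theorem IsSupport.cost_lt (hf : IsFlux f) {x₀ c : ℝ} (h : IsSupport K x₀ c) {t : ℝ} (ht : 0 < t)
    {v : ℝ} (hv : v ≠ c) :
    cost f K t (x₀ + t * deriv f c) c < cost f K t (x₀ + t * deriv f c) v := by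
  have h1 := h (x₀ + t * deriv f c - t * deriv f v)
  have h2 := mul_lt_mul_of_pos_left (legendre_sub_gt hf hv.symm) ht
  unfold cost
  rw [add_sub_cancel_right]
  linarith

theorem IsSupport.isLaxMin_iff (hf : IsFlux f) {x₀ c : ℝ} (h : IsSupport K x₀ c) {t : ℝ}
    (ht : 0 < t) {v : ℝ} : IsLaxMin f K t (x₀ + t * deriv f c) v ↔ v = c := by
  constructor
  · intro hv
    by_contra hne
    exact (hv c).not_gt (h.cost_lt hf ht hne)
  · rintro rfl w
    rcases eq_or_ne w v with rfl | hne
    · exact le_rfl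
    · exact (h.cost_lt hf ht hne).le

/-! ### The energy -/

/-- Substituting `y = x - t f'(s)` turns the energy into the negative Hopf–Lax cost, up to a
constant. -/
theorem energy_eq (hf : IsFlux f) (hφ : LocallyIntegrable φ) (v x t : ℝ) (ht : 0 < t) :
    energy f φ v x t = cost f (primitive φ) t x 0 - cost f (primitive φ) t x v := by
  set g : ℝ → ℝ := fun s => x - t * deriv f s with hg
  set g' : ℝ → ℝ := fun s => -(t * deriv (deriv f) s) with hg'
  have hgd : ∀ s, HasDerivAt g (g' s) s := fun s =>
    ((hf.differentiable_deriv s).hasDerivAt.const_mul t).const_sub x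
  have hgc : Continuous g := by have := hf.continuous_deriv; fun_prop
  have hg'0 : ∀ s, g' s ≤ 0 := fun s => neg_nonpos.2 (mul_nonneg ht.le (hf.nonneg s))
  have hi : ∀ a b, IntervalIntegrable φ volume a b := fun a b =>
    (hφ.integrableOn_isCompact isCompact_uIcc).intervalIntegrable
  have h1 := intervalIntegral.integral_comp_mul_deriv_of_deriv_nonpos (a := 0) (b := v) (g := φ)
    hgc.continuousOn (fun s _ => hgd s) (fun s _ => hg'0 s)
  have h2 := (intervalIntegral.integrable_comp_mul_deriv_iff_of_deriv_nonpos (a := 0) (b := v)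
    (g := φ) hgc.continuousOn (fun s _ => hgd s) (fun s _ => hg'0 s)).2 (hi _ _)
  have h3 : ∫ s in (0 : ℝ)..v, s * deriv (deriv f) s = legendre f v - legendre f 0 := by
    refine intervalIntegral.integral_eq_sub_of_hasDerivAt (fun s _ => ?_)
      ((continuous_id.mul hf.continuous_deriv2).intervalIntegrable _ _)
    have := ((hasDerivAt_id s).mul (hf.differentiable_deriv s).hasDerivAt).sub
      (hf.differentiable s).hasDerivAt
    refine this.congr_deriv ?_
    simp
  have h4 : IntervalIntegrable (fun s => t * (s * deriv (deriv f) s)) volume 0 v :=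
    (continuous_const.mul (continuous_id.mul hf.continuous_deriv2)).intervalIntegrable _ _
  unfold energy
  rw [← intervalIntegral.integral_const_mul]
  have e : ∀ s, t * (deriv (deriv f) s * (φ (x - t * deriv f s) - s)) =
      -((φ ∘ g) s * g' s) - t * (s * deriv (deriv f) s) := by
    intro s; simp only [hg, hg', Function.comp]; ring
  simp_rw [e]
  have h5 : IntervalIntegrable (fun s => -((φ ∘ g) s * g' s)) volume 0 v := h2.neg
  rw [intervalIntegral.integral_sub h5 h4, intervalIntegral.integral_neg, h1,
    intervalIntegral.integral_const_mul, h3,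
    ← intervalIntegral.integral_interval_sub_left (hi 0 (g v)) (hi 0 (g 0))]
  unfold cost primitive
  simp only [hg]
  ring

theorem mem_maximizers_iff (hf : IsFlux f) (hφ : LocallyIntegrable φ) {v x t : ℝ} (ht : 0 < t) :
    v ∈ maximizers f φ x t ↔ IsLaxMin f (primitive φ) t x v := by
  refine forall_congr' fun w => ?_
  rw [energy_eq hf hφ w x t ht, energy_eq hf hφ v x t ht]
  constructor <;> intro h <;> linarith

/-- The divide generation values of `x₀` are the slopes of the supporting lines at `x₀`. -/
theorem mem_divideValues_iff (hf : IsFlux f) (hφ : LocallyIntegrable φ)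
    (hK : ∀ x y, |primitive φ x - primitive φ y| ≤ M * |x - y|) {x₀ c : ℝ} :
    c ∈ divideValues f φ x₀ ↔ IsSupport (primitive φ) x₀ c := by
  constructor
  · intro h
    refine isSupport_of_tendsto_foot hf hK (l := atTop) (t := id)
      (x := fun t => x₀ + t * deriv f c) (v := fun _ => c) tendsto_id ?_ ?_ tendsto_const_nhds
    · filter_upwards [eventually_gt_atTop 0] with t ht
      exact (mem_maximizers_iff hf hφ ht).1 ((h t ht).ge rfl)
    · simp
  · intro h t ht
    ext v
    rw [mem_maximizers_iff hf hφ ht, h.isLaxMin_iff hf ht, mem_singleton_iff]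

end Support

/-! ### Reflection -/

section Reflection

variable {f K : ℝ → ℝ}

theorem deriv_reflect (f : ℝ → ℝ) (v : ℝ) : deriv (fun v => f (-v)) v = -deriv f (-v) :=
  deriv_comp_neg f v

theorem deriv_deriv_reflect (f : ℝ → ℝ) (v : ℝ) :
    deriv (deriv fun v => f (-v)) v = deriv (deriv f) (-v) := by
  have : (deriv fun v => f (-v)) = fun v => -deriv f (-v) := funext (deriv_reflect f)
  rw [this]
  have := deriv_comp_neg (fun v => -deriv f v) v
  rw [this, deriv.fun_neg, neg_neg]

theorem IsFlux.reflect (hf : IsFlux f) : IsFlux fun v => f (-v) where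
  contDiff := hf.contDiff.comp contDiff_neg
  nonneg v := by rw [deriv_deriv_reflect]; exact hf.nonneg _
  null := by
    have : {v | deriv (deriv fun v => f (-v)) v = 0} = Neg.neg ⁻¹' {v | deriv (deriv f) v = 0} := by
      ext v; simp [deriv_deriv_reflect]
    rw [this, Measure.measure_preimage_neg]
    exact hf.null

theorem legendre_reflect (f : ℝ → ℝ) (v : ℝ) :
    legendre (fun v => f (-v)) v = legendre f (-v) := by
  unfold legendre
  rw [deriv_reflect]; ring

theorem IsLaxMin.reflect {t x v : ℝ} (h : IsLaxMin f K t x v) :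
    IsLaxMin (fun v => f (-v)) (fun x => K (-x)) t (-x) (-v) := by
  intro w
  have := h (-w)
  unfold cost at this ⊢
  rw [legendre_reflect, legendre_reflect, deriv_reflect, deriv_reflect, neg_neg]
  convert this using 3
  · ring
  · ring

theorem IsSupport.reflect {x c : ℝ} (h : IsSupport K x c) :
    IsSupport (fun x => K (-x)) (-x) (-c) := by
  intro z
  have := h (-z)
  simp only [neg_neg]
  linarith

theorem abs_reflect_sub_le {M : ℝ} (hK : ∀ x y, |K x - K y| ≤ M * |x - y|) (x y : ℝ) :
    |K (-x) - K (-y)| ≤ M * |x - y| := by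
  have := hK (-x) (-y)
  rwa [neg_sub_neg, abs_sub_comm y x] at this

end Reflection

/-! ### Slopes at infinity -/

/-- `c` is the lower limit of `K x / x` as `x → ∞`. -/
structure IsSlopeAtTop (K : ℝ → ℝ) (c : ℝ) : Prop where
  eventually_le : ∀ c' < c, ∀ᶠ x in atTop, c' * x ≤ K x
  frequently_le : ∀ c' > c, ∃ᶠ x in atTop, K x ≤ c' * x

section Slope

variable {f φ K : ℝ → ℝ} {M c : ℝ}

/-- An affine minorant on a half line has slope at most `c`. -/
theorem IsSlopeAtTop.le_of_affine_le (h : IsSlopeAtTop K c) {d k z₀ : ℝ}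
    (hd : ∀ z, z₀ < z → d * z + k ≤ K z) : d ≤ c := by
  by_contra! hcon
  obtain ⟨c', h1, h2⟩ := exists_between hcon
  have h3 : ∀ᶠ z : ℝ in atTop, -k < (d - c') * z :=
    (tendsto_id.const_mul_atTop (sub_pos.2 h2)).eventually_gt_atTop _
  obtain ⟨z, hz, h4, h5⟩ := ((h.frequently_le c' h1).and_eventually
    (h3.and (eventually_gt_atTop z₀))).exists
  have := hd z h5
  linarith

theorem IsSupport.le_slope (h : IsSlopeAtTop K c) {x d : ℝ} (hd : IsSupport K x d) : d ≤ c :=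
  h.le_of_affine_le (k := K x - d * x) (z₀ := 0) fun z _ => by linarith [hd z]

/-- At the last point of contact the slope at infinity is the slope of a supporting line: a
supporting line of a smaller slope tilted upwards would touch the graph further to the right. -/
theorem IsSlopeAtTop.isSupport (hK : Continuous K) (h : IsSlopeAtTop K c) {b c₀ : ℝ}
    (hb : IsSupport K b c₀) (hlast : ∀ z d, IsSupport K z d → z ≤ b) : IsSupport K b c := by
  have h0 : c₀ ≤ c := hb.le_slope h
  rcases h0.eq_or_lt with rfl | h0
  · exact hb
  have key : ∀ c', c₀ < c' → c' < c → IsSupport K b c' := by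
    intro c' h1 h2
    obtain ⟨c'', h3, h4⟩ := exists_between h2
    have hco : Tendsto (fun z => K z - c' * z) (cocompact ℝ ⊓ 𝓟 (Ici b)) atTop := by
      have : (cocompact ℝ ⊓ 𝓟 (Ici b)) ≤ (atTop : Filter ℝ) := by
        rw [cocompact_eq_atBot_atTop, inf_sup_right]
        refine sup_le ?_ inf_le_left
        have : (atBot ⊓ 𝓟 (Ici b) : Filter ℝ) = ⊥ := by
          rw [← disjoint_iff]
          exact disjoint_principal_right.2 ((eventually_lt_atBot b).mono fun z hz => not_le.2 hz)
        rw [this]; exact bot_le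
      refine Tendsto.mono_left ?_ this
      refine tendsto_atTop_mono' _ ?_ (tendsto_id.const_mul_atTop (sub_pos.2 h3))
      filter_upwards [h.eventually_le c'' h4] with z hz
      simp only [id]; linarith
    obtain ⟨z, hz, hmin⟩ := ContinuousOn.exists_isMinOn' (s := Ici b)
      (f := fun z => K z - c' * z) (by fun_prop) isClosed_Ici (x₀ := b) self_mem_Ici
      (hco.eventually_ge_atTop _)
    have hsup : IsSupport K z c' := by
      intro y
      rcases le_or_gt b y with hy | hy
      · have := hmin hy
        simp only [mem_ofPred_eq] at this
        linarith
      · have h5 := hmin (self_mem_Ici (a := b))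
        simp only [mem_ofPred_eq] at h5
        have h6 := hb y
        nlinarith
    have : z = b := le_antisymm (hlast z c' hsup) hz
    rwa [this] at hsup
  have : Tendsto (fun c' : ℝ => c') (𝓝[<] c) (𝓝 c) := tendsto_id.mono_left nhdsWithin_le_nhds
  refine isSupport_of_tendsto hK (l := 𝓝[<] c) (tendsto_const_nhds (x := b)) this ?_
  filter_upwards [Ioo_mem_nhdsLT h0] with c' hc' using key c' hc'.1 hc'.2

/-- Right of `b` a convex minorant grows at most with the slope at infinity. -/
theorem IsSlopeAtTop.convexOn_le (h : IsSlopeAtTop K c) {g : ℝ → ℝ} (hg : ConvexOn ℝ univ g)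
    (hle : ∀ y, g y ≤ K y) {b z : ℝ} (hz : b < z) : g z ≤ g b + c * (z - b) := by
  have hs : (g z - g b) / (z - b) ≤ c := by
    refine h.le_of_affine_le (k := g b - (g z - g b) / (z - b) * b) (z₀ := z) fun y hy => ?_
    have h1 := hg.secant_mono (mem_univ b) (mem_univ z) (mem_univ y) hz.ne' (hz.trans hy).ne' hy.le
    rw [le_div_iff₀ (sub_pos.2 (hz.trans hy))] at h1
    have := hle y
    linarith
  rw [div_le_iff₀ (sub_pos.2 hz)] at hs
  linarith

theorem locallyIntegrable_of_memLp_top (hφ : MemLp φ ∞ volume) : LocallyIntegrable φ :=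
  hφ.locallyIntegrable le_top

theorem primitive_sub (hφ : LocallyIntegrable φ) (x y : ℝ) :
    primitive φ y - primitive φ x = ∫ z in x..y, φ z :=
  have hi : ∀ a b, IntervalIntegrable φ volume a b := fun _ _ =>
    (hφ.integrableOn_isCompact isCompact_uIcc).intervalIntegrable
  intervalIntegral.integral_interval_sub_left (hi _ _) (hi _ _)

theorem integral_sub_const_eq (hφ : LocallyIntegrable φ) (c x y : ℝ) :
    ∫ z in x..y, (φ z - c) = primitive φ y - primitive φ x - c * (y - x) := by
  have hi : IntervalIntegrable φ volume x y :=
    (hφ.integrableOn_isCompact isCompact_uIcc).intervalIntegrable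
  rw [intervalIntegral.integral_sub hi intervalIntegrable_const, primitive_sub hφ]
  simp [mul_comm]

theorem abs_mean_le (hK : ∀ x y, |primitive φ x - primitive φ y| ≤ M * |x - y|) (x : ℝ)
    (hx : x ≠ 0) : |(1 / x) * ∫ y in (0 : ℝ)..x, φ y| ≤ M := by
  have h1 := hK x 0
  have h2 : primitive φ 0 = 0 := by simp [primitive]
  rw [h2, sub_zero, sub_zero] at h1
  rw [abs_mul, abs_div, abs_one, one_div, ← div_eq_inv_mul]
  exact (div_le_iff₀ (abs_pos.2 hx)).2 h1

theorem isSlopeAtTop_right (hK : ∀ x y, |primitive φ x - primitive φ y| ≤ M * |x - y|) :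
    IsSlopeAtTop (primitive φ) (meanLowerRight φ) := by
  have hb : ∀ᶠ x : ℝ in atTop, |(1 / x) * ∫ y in (0 : ℝ)..x, φ y| ≤ M :=
    (eventually_gt_atTop 0).mono fun x hx => abs_mean_le hK x hx.ne'
  have hb1 : IsBoundedUnder (· ≥ ·) atTop fun x : ℝ => (1 / x) * ∫ y in (0 : ℝ)..x, φ y :=
    isBoundedUnder_of_eventually_ge (hb.mono fun x hx => (abs_le.1 hx).1)
  have hb2 : IsBoundedUnder (· ≤ ·) atTop fun x : ℝ => (1 / x) * ∫ y in (0 : ℝ)..x, φ y :=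
    isBoundedUnder_of_eventually_le (hb.mono fun x hx => (abs_le.1 hx).2)
  constructor
  · intro c' hc'
    filter_upwards [eventually_lt_of_lt_liminf hc' hb1, eventually_gt_atTop 0] with x h1 h2
    rw [one_div, ← div_eq_inv_mul, lt_div_iff₀ h2] at h1
    exact h1.le
  · intro c' hc'
    have := frequently_lt_of_liminf_lt hb2.isCoboundedUnder_ge hc'
    refine (this.and_eventually (eventually_gt_atTop 0)).mono fun x hx => ?_
    have h1 := hx.1
    rw [one_div, ← div_eq_inv_mul, div_lt_iff₀ hx.2] at h1
    exact h1.le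

theorem isSlopeAtTop_left (hK : ∀ x y, |primitive φ x - primitive φ y| ≤ M * |x - y|) :
    IsSlopeAtTop (fun x => primitive φ (-x)) (-meanUpperLeft φ) := by
  have hb : ∀ᶠ x : ℝ in atBot, |(1 / x) * ∫ y in (0 : ℝ)..x, φ y| ≤ M :=
    (eventually_lt_atBot 0).mono fun x hx => abs_mean_le hK x hx.ne
  have hb1 : IsBoundedUnder (· ≥ ·) atBot fun x : ℝ => (1 / x) * ∫ y in (0 : ℝ)..x, φ y :=
    isBoundedUnder_of_eventually_ge (hb.mono fun x hx => (abs_le.1 hx).1)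
  have hb2 : IsBoundedUnder (· ≤ ·) atBot fun x : ℝ => (1 / x) * ∫ y in (0 : ℝ)..x, φ y :=
    isBoundedUnder_of_eventually_le (hb.mono fun x hx => (abs_le.1 hx).2)
  constructor
  · intro c' hc'
    have h0 : meanUpperLeft φ < -c' := by linarith
    have h1 := (eventually_lt_of_limsup_lt h0 hb2).and (eventually_lt_atBot 0)
    filter_upwards [tendsto_neg_atTop_atBot.eventually h1] with x hx
    have h2 := hx.1
    rw [one_div, ← div_eq_inv_mul, div_lt_iff_of_neg hx.2] at h2
    unfold primitive
    linarith
  · intro c' hc'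
    have h0 : -c' < meanUpperLeft φ := by linarith
    have h1 := (frequently_lt_of_lt_limsup hb1.isCoboundedUnder_le h0).and_eventually
      (eventually_lt_atBot 0)
    rw [← map_neg_atTop, frequently_map] at h1
    refine h1.mono fun x hx => ?_
    have h2 := hx.1
    rw [one_div, ← div_eq_inv_mul, lt_div_iff_of_neg hx.2] at h2
    unfold primitive
    linarith

theorem mem_contactSet_of_isLUB (hK : ∀ x y, |primitive φ x - primitive φ y| ≤ M * |x - y|)
    {b : ℝ} (hb : IsLUB (contactSet φ) b) : b ∈ contactSet φ := by
  refine (isClosed_contactSet hK).isLUB_mem hb ?_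
  by_contra hne
  rw [not_nonempty_iff_eq_empty] at hne
  have := hb.2 (show b - 1 ∈ upperBounds (contactSet φ) by rw [hne]; simp)
  linarith

theorem mem_contactSet_of_isGLB (hK : ∀ x y, |primitive φ x - primitive φ y| ≤ M * |x - y|)
    {a : ℝ} (ha : IsGLB (contactSet φ) a) : a ∈ contactSet φ := by
  refine (isClosed_contactSet hK).isGLB_mem ha ?_
  by_contra hne
  rw [not_nonempty_iff_eq_empty] at hne
  have := ha.2 (show a + 1 ∈ lowerBounds (contactSet φ) by rw [hne]; simp)
  linarith

theorem isSupport_meanLowerRight (hK : ∀ x y, |primitive φ x - primitive φ y| ≤ M * |x - y|)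
    {b : ℝ} (hb : IsLUB (contactSet φ) b) : IsSupport (primitive φ) b (meanLowerRight φ) := by
  obtain ⟨c₀, hc₀⟩ := (mem_contactSet_iff hK).1 (mem_contactSet_of_isLUB hK hb)
  exact (isSlopeAtTop_right hK).isSupport (continuous_of_abs_sub_le hK) hc₀
    fun z d hd => hb.1 ((mem_contactSet_iff hK).2 ⟨d, hd⟩)

theorem isSupport_meanUpperLeft (hK : ∀ x y, |primitive φ x - primitive φ y| ≤ M * |x - y|)
    {a : ℝ} (ha : IsGLB (contactSet φ) a) : IsSupport (primitive φ) a (meanUpperLeft φ) := by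
  obtain ⟨c₀, hc₀⟩ := (mem_contactSet_iff hK).1 (mem_contactSet_of_isGLB hK ha)
  have h1 := (isSlopeAtTop_left hK).isSupport
    (continuous_of_abs_sub_le (abs_reflect_sub_le hK)) hc₀.reflect fun z d hd => by
      have h2 := hd.reflect
      simp only [neg_neg] at h2
      have := ha.1 ((mem_contactSet_iff hK).2 ⟨_, h2⟩)
      linarith
  simpa using h1.reflect

theorem convHull_eq_of_isSupport {x c z : ℝ} (h : IsSupport (primitive φ) x c)
    (hle : ∀ g : ℝ → ℝ, ConvexOn ℝ univ g → (∀ y, g y ≤ primitive φ y) →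
      g z ≤ primitive φ x + c * (z - x)) :
    (convHull φ z).toReal = primitive φ x + c * (z - x) := by
  have : convHull φ z = ((primitive φ x + c * (z - x) : ℝ) : EReal) := by
    refine le_antisymm (iSup_le fun g => EReal.coe_le_coe_iff.2 (hle g.1 g.2.1 g.2.2)) ?_
    exact le_iSup (fun g : {g : ℝ → ℝ // ConvexOn ℝ univ g ∧ ∀ y, g y ≤ primitive φ y} =>
      ((g.1 z : ℝ) : EReal)) ⟨_, convexOn_line _ c x, h⟩
  rw [this, EReal.toReal_coe]

theorem hullDerivRight_eq (hK : ∀ x y, |primitive φ x - primitive φ y| ≤ M * |x - y|)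
    {b : ℝ} (hb : IsLUB (contactSet φ) b) : hullDerivRight φ b = meanLowerRight φ := by
  have hs := isSupport_meanLowerRight hK hb
  have key : ∀ z, b ≤ z → (convHull φ z).toReal =
      primitive φ b + meanLowerRight φ * (z - b) := by
    intro z hz
    refine convHull_eq_of_isSupport hs fun g hg hle => ?_
    rcases hz.eq_or_lt with rfl | hz
    · simpa using hle b
    · linarith [(isSlopeAtTop_right hK).convexOn_le hg hle hz, hle b]
  unfold hullDerivRight
  rw [derivWithin_congr (fun z hz => key z (mem_Ioi.1 hz).le) (key b le_rfl)]
  have : HasDerivAt (fun z => primitive φ b + meanLowerRight φ * (z - b)) (meanLowerRight φ) b := by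
    simpa using (((hasDerivAt_id b).sub_const b).const_mul (meanLowerRight φ)).const_add
      (primitive φ b)
  exact this.hasDerivWithinAt.derivWithin (uniqueDiffWithinAt_Ioi b)

theorem hullDerivLeft_eq (hK : ∀ x y, |primitive φ x - primitive φ y| ≤ M * |x - y|)
    {a : ℝ} (ha : IsGLB (contactSet φ) a) : hullDerivLeft φ a = meanUpperLeft φ := by
  have hs := isSupport_meanUpperLeft hK ha
  have key : ∀ z, z ≤ a → (convHull φ z).toReal =
      primitive φ a + meanUpperLeft φ * (z - a) := by
    intro z hz
    refine convHull_eq_of_isSupport hs fun g hg hle => ?_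
    rcases hz.eq_or_lt with rfl | hz
    · simpa using hle z
    · have hg' : ConvexOn ℝ univ fun y => g (-y) := by
        refine ⟨convex_univ, fun x _ y _ r s hr hs hrs => ?_⟩
        have := hg.2 (mem_univ (-x)) (mem_univ (-y)) hr hs hrs
        convert this using 2
        simp only [smul_eq_mul]; ring
      have := (isSlopeAtTop_left hK).convexOn_le hg' (fun y => hle (-y)) (neg_lt_neg hz)
      simp only [neg_neg] at this
      linarith [hle a]
  unfold hullDerivLeft
  rw [derivWithin_congr (fun z hz => key z (mem_Iio.1 hz).le) (key a le_rfl)]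
  have : HasDerivAt (fun z => primitive φ a + meanUpperLeft φ * (z - a)) (meanUpperLeft φ) a := by
    simpa using (((hasDerivAt_id a).sub_const a).const_mul (meanUpperLeft φ)).const_add
      (primitive φ a)
  exact this.hasDerivWithinAt.derivWithin (uniqueDiffWithinAt_Iio a)

/-- The condition on the lower Dini derivative: near `b` the primitive grows faster than its
supporting line. -/
theorem exists_lt_of_hullDerivRight_lt (hφ : LocallyIntegrable φ)
    (hK : ∀ x y, |primitive φ x - primitive φ y| ≤ M * |x - y|)
    {b : ℝ} (hb : IsLUB (contactSet φ) b) (h : hullDerivRight φ b < diniLowerRight φ b) :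
    ∃ κ, 0 < κ ∧ ∀ᶠ z in 𝓝[>] b,
      κ * (z - b) ≤ primitive φ z - primitive φ b - meanLowerRight φ * (z - b) := by
  rw [hullDerivRight_eq hK hb] at h
  obtain ⟨κ, h1, h2⟩ := exists_between h
  have hbd : IsBoundedUnder (· ≥ ·) (𝓝[>] (0 : ℝ))
      fun l : ℝ => (1 / l) * ∫ y in b..(b + l), φ y := by
    refine isBoundedUnder_of_eventually_ge (a := -M) ?_
    filter_upwards [self_mem_nhdsWithin] with l hl
    have hl : 0 < l := hl
    have := (abs_le.1 (hK (b + l) b)).1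
    rw [add_sub_cancel_left, abs_of_pos hl, primitive_sub hφ] at this
    rw [one_div, ← div_eq_inv_mul, le_div_iff₀ hl]
    linarith
  have h3 := eventually_lt_of_lt_liminf h2 hbd
  have hm : Tendsto (fun z : ℝ => z - b) (𝓝[>] b) (𝓝[>] 0) := by
    refine tendsto_nhdsWithin_iff.2 ⟨?_, ?_⟩
    · have : Tendsto (fun z : ℝ => z - b) (𝓝 b) (𝓝 (b - b)) := by
        exact (continuous_id.sub continuous_const).tendsto b
      rw [sub_self] at this
      exact this.mono_left nhdsWithin_le_nhds
    · filter_upwards [self_mem_nhdsWithin] with z hz using sub_pos.2 (mem_Ioi.1 hz)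
  refine ⟨κ - meanLowerRight φ, sub_pos.2 h1, ?_⟩
  filter_upwards [hm.eventually h3, self_mem_nhdsWithin] with z hz hz'
  have hz' : 0 < z - b := sub_pos.2 hz'
  rw [one_div, ← div_eq_inv_mul, lt_div_iff₀ hz', add_sub_cancel, ← primitive_sub hφ] at hz
  linarith

theorem exists_lt_of_lt_hullDerivLeft (hφ : LocallyIntegrable φ)
    (hK : ∀ x y, |primitive φ x - primitive φ y| ≤ M * |x - y|)
    {a : ℝ} (ha : IsGLB (contactSet φ) a) (h : diniUpperLeft φ a < hullDerivLeft φ a) :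
    ∃ κ, 0 < κ ∧ ∀ᶠ z in 𝓝[<] a,
      κ * (a - z) ≤ primitive φ z - primitive φ a - meanUpperLeft φ * (z - a) := by
  rw [hullDerivLeft_eq hK ha] at h
  obtain ⟨κ, h1, h2⟩ := exists_between h
  have hbd : IsBoundedUnder (· ≤ ·) (𝓝[<] (0 : ℝ))
      fun l : ℝ => (1 / l) * ∫ y in a..(a + l), φ y := by
    refine isBoundedUnder_of_eventually_le (a := M) ?_
    filter_upwards [self_mem_nhdsWithin] with l hl
    have hl : l < 0 := hl
    have := (abs_le.1 (hK (a + l) a)).1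
    rw [add_sub_cancel_left, abs_of_neg hl, primitive_sub hφ] at this
    rw [one_div, ← div_eq_inv_mul, div_le_iff_of_neg hl]
    linarith
  have h3 := eventually_lt_of_limsup_lt h1 hbd
  have hm : Tendsto (fun z : ℝ => z - a) (𝓝[<] a) (𝓝[<] 0) := by
    refine tendsto_nhdsWithin_iff.2 ⟨?_, ?_⟩
    · have : Tendsto (fun z : ℝ => z - a) (𝓝 a) (𝓝 (a - a)) := by
        exact (continuous_id.sub continuous_const).tendsto a
      rw [sub_self] at this
      exact this.mono_left nhdsWithin_le_nhds
    · filter_upwards [self_mem_nhdsWithin] with z hz using sub_neg.2 (mem_Iio.1 hz)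
  refine ⟨meanUpperLeft φ - κ, sub_pos.2 h2, ?_⟩
  filter_upwards [hm.eventually h3, self_mem_nhdsWithin] with z hz hz'
  have hz' : z - a < 0 := sub_neg.2 hz'
  rw [one_div, ← div_eq_inv_mul, div_lt_iff_of_neg hz', add_sub_cancel, ← primitive_sub hφ] at hz
  linarith

end Slope

/-! ### Gaps of the contact set -/

section Gap

variable {f φ K : ℝ → ℝ} {M : ℝ}

/-- The chord of the primitive over a gap supports it at both endpoints. -/
theorem IsGap.isSupport_left (hK : ∀ x y, |primitive φ x - primitive φ y| ≤ M * |x - y|) {e h : ℝ}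
    (hg : IsGap φ e h) : IsSupport (primitive φ) e (gapValue φ e h) := by
  obtain ⟨ce, hce⟩ := (mem_contactSet_iff hK).1 hg.left_mem
  obtain ⟨ch, hch⟩ := (mem_contactSet_iff hK).1 hg.right_mem
  have hlt := hg.lt
  set c := gapValue φ e h with hc
  have hval : primitive φ h = primitive φ e + c * (h - e) := by
    rw [hc, gapValue, div_mul_cancel₀ _ (by linarith)]; ring
  have h1 : ce ≤ c := by
    have := hce h
    rw [hval] at this
    exact le_of_mul_le_mul_right (a := h - e) (by linarith) (by linarith)
  have h2 : c ≤ ch := by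
    have := hch e
    rw [hval] at this
    exact le_of_mul_le_mul_right (a := h - e) (by linarith) (by linarith)
  have hcont := continuous_of_abs_sub_le hK
  obtain ⟨m, hm, hmin⟩ := isCompact_Icc.exists_isMinOn (nonempty_Icc.2 hlt.le)
    (f := fun z => primitive φ z - c * z) (by fun_prop)
  have hsup : IsSupport (primitive φ) m c := by
    intro z
    rcases lt_or_ge z e with hz | hz
    · have h3 := hmin (left_mem_Icc.2 hlt.le)
      simp only [mem_ofPred_eq] at h3
      have h4 := hce z
      nlinarith
    · rcases lt_or_ge h z with hz' | hz'
      · have h3 := hmin (right_mem_Icc.2 hlt.le)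
        simp only [mem_ofPred_eq] at h3
        have h4 := hch z
        nlinarith
      · have h3 := hmin ⟨hz, hz'⟩
        simp only [mem_ofPred_eq] at h3
        linarith
  have hme : primitive φ m - c * m = primitive φ e - c * e := by
    rcases hm.1.eq_or_lt with rfl | h3
    · rfl
    · rcases hm.2.eq_or_lt with rfl | h4
      · linarith
      · exact absurd ((mem_contactSet_iff hK).2 ⟨c, hsup⟩) (hg.disjoint m h3 h4)
  intro z
  linarith [hsup z]

theorem IsGap.primitive_right {e h : ℝ} (hg : IsGap φ e h) :
    primitive φ h = primitive φ e + gapValue φ e h * (h - e) := by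
  have := hg.lt
  rw [gapValue, div_mul_cancel₀ _ (by linarith)]; ring

theorem IsGap.isSupport_right (hK : ∀ x y, |primitive φ x - primitive φ y| ≤ M * |x - y|) {e h : ℝ}
    (hg : IsGap φ e h) : IsSupport (primitive φ) h (gapValue φ e h) := by
  intro z
  have := hg.isSupport_left hK z
  rw [hg.primitive_right]
  linarith

theorem IsSupport.of_mem_Icc {x c d v : ℝ} (hc : IsSupport K x c) (hd : IsSupport K x d)
    (hv : v ∈ Icc c d) : IsSupport K x v := by
  intro z
  rcases le_total x z with h | h
  · have := hd z
    nlinarith [hv.2]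
  · have := hc z
    nlinarith [hv.1]

/-- A point between two divides that issue from the same contact point lies on a divide. -/
theorem IsSupport.exists_eq_add (hf : IsFlux f) {x₀ c d t x : ℝ} (hc : IsSupport K x₀ c)
    (hd : IsSupport K x₀ d) (ht : 0 < t) (h1 : x₀ + t * deriv f c ≤ x)
    (h2 : x ≤ x₀ + t * deriv f d) : ∃ v, IsSupport K x₀ v ∧ x = x₀ + t * deriv f v := by
  have hcd : c ≤ d := by
    have : t * deriv f c ≤ t * deriv f d := by linarith
    exact hf.strictMono.le_iff_le.1 (le_of_mul_le_mul_left this ht)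
  obtain ⟨v, hv, hvx⟩ := intermediate_value_Icc hcd
    (f := fun v => x₀ + t * deriv f v) (by have := hf.continuous_deriv; fun_prop) ⟨h1, h2⟩
  exact ⟨v, hc.of_mem_Icc hd hv, hvx.symm⟩

/-- Between two divides every point lies on a divide or over a gap. -/
theorem exists_divide_or_gap (hf : IsFlux f)
    (hK : ∀ x y, |primitive φ x - primitive φ y| ≤ M * |x - y|) {x₁ x₂ c₁ c₂ t x : ℝ}
    (h₁ : IsSupport (primitive φ) x₁ c₁) (h₂ : IsSupport (primitive φ) x₂ c₂) (ht : 0 < t)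
    (hx₁ : x₁ + t * deriv f c₁ ≤ x) (hx₂ : x ≤ x₂ + t * deriv f c₂) :
    (∃ z d, IsSupport (primitive φ) z d ∧ x = z + t * deriv f d) ∨
      ∃ e h, IsGap φ e h ∧ x₁ ≤ e ∧ h ≤ x₂ ∧ e + t * deriv f (gapValue φ e h) < x ∧
        x < h + t * deriv f (gapValue φ e h) := by
  have hcont := continuous_of_abs_sub_le hK
  have hcl : IsCompact {P : ℝ × ℝ | P ∈ Icc x₁ x₂ ×ˢ Icc (-M) M ∧
      IsSupport (primitive φ) P.1 P.2} := by
    refine (isCompact_Icc.prod isCompact_Icc).inter_right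
      (t := {P : ℝ × ℝ | IsSupport (primitive φ) P.1 P.2}) ?_
    have : {P : ℝ × ℝ | IsSupport (primitive φ) P.1 P.2} =
        ⋂ z, {P : ℝ × ℝ | primitive φ P.1 + P.2 * (z - P.1) ≤ primitive φ z} := by
      ext P; simp [IsSupport]
    rw [this]
    exact isClosed_iInter fun z => isClosed_le (by fun_prop) (by fun_prop)
  have hline : Continuous fun P : ℝ × ℝ => P.1 + t * deriv f P.2 := by
    have := hf.continuous_deriv; fun_prop
  have hx12 : x₁ ≤ x₂ := by
    by_contra! hcon
    have h3 := h₂.mono h₁ hcon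
    have h4 := mul_le_mul_of_nonneg_left (hf.strictMono.monotone h3) ht.le
    linarith
  have hS := hcl.inter_right (isClosed_le hline (continuous_const (y := x)))
  have hS' := hcl.inter_right (isClosed_le (continuous_const (y := x)) hline)
  obtain ⟨⟨e, de⟩, ⟨⟨heI, hes⟩, hex⟩, hemax⟩ := hS.exists_isMaxOn (f := Prod.fst)
    ⟨(x₁, c₁), ⟨⟨⟨left_mem_Icc.2 hx12, abs_le.1 (h₁.abs_le hK)⟩, h₁⟩, hx₁⟩⟩ (by fun_prop)
  obtain ⟨⟨h, dh⟩, ⟨⟨hhI, hhs⟩, hhx⟩, hhmin⟩ := hS'.exists_isMinOn (f := Prod.fst)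
    ⟨(x₂, c₂), ⟨⟨⟨right_mem_Icc.2 hx12, abs_le.1 (h₂.abs_le hK)⟩, h₂⟩, hx₂⟩⟩ (by fun_prop)
  simp only [mem_ofPred_eq] at hex hhx hes hhs
  have heh : e ≤ h := by
    by_contra! hcon
    have h3 := hhs.mono hes hcon
    have h4 := mul_le_mul_of_nonneg_left (hf.strictMono.monotone h3) ht.le
    linarith
  rcases heh.eq_or_lt with rfl | heh
  · obtain ⟨v, hv, hvx⟩ := hes.exists_eq_add hf hhs ht hex hhx
    exact Or.inl ⟨_, v, hv, hvx⟩
  have hgap : IsGap φ e h := by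
    refine ⟨heh, (mem_contactSet_iff hK).2 ⟨_, hes⟩, (mem_contactSet_iff hK).2 ⟨_, hhs⟩,
      fun z hz1 hz2 hz => ?_⟩
    obtain ⟨d, hd⟩ := (mem_contactSet_iff hK).1 hz
    have hzI : z ∈ Icc x₁ x₂ := ⟨heI.1.1.trans hz1.le, hz2.le.trans hhI.1.2⟩
    have hdI := abs_le.1 (hd.abs_le hK)
    rcases le_total (z + t * deriv f d) x with h3 | h3
    · have := hemax (show (z, d) ∈ _ from ⟨⟨⟨hzI, hdI⟩, hd⟩, h3⟩)
      simp only [mem_ofPred_eq] at this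
      linarith
    · have := hhmin (show (z, d) ∈ _ from ⟨⟨⟨hzI, hdI⟩, hd⟩, h3⟩)
      simp only [mem_ofPred_eq] at this
      linarith
  rcases le_or_gt x (e + t * deriv f (gapValue φ e h)) with h3 | h3
  · obtain ⟨v, hv, hvx⟩ := hes.exists_eq_add hf (hgap.isSupport_left hK) ht hex h3
    exact Or.inl ⟨_, v, hv, hvx⟩
  rcases le_or_gt (h + t * deriv f (gapValue φ e h)) x with h4 | h4
  · obtain ⟨v, hv, hvx⟩ := (hgap.isSupport_right hK).exists_eq_add hf hhs ht h4 hhx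
    exact Or.inl ⟨_, v, hv, hvx⟩
  exact Or.inr ⟨e, h, hgap, heI.1.1, hhI.1.2, h3, h4⟩

end Gap

/-! ### The excess of the Legendre cost -/

/-- The excess `∫_c^v (s - c) f''(s) ds` of the cost of `v` over that of `c`, after subtraction of
the linear part. -/
def excess (f : ℝ → ℝ) (c v : ℝ) : ℝ :=
  legendre f v - legendre f c - c * (deriv f v - deriv f c)

section Excess

variable {f : ℝ → ℝ} {c : ℝ}

theorem hasDerivAt_legendre (hf : IsFlux f) (v : ℝ) :
    HasDerivAt (legendre f) (v * deriv (deriv f) v) v := by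
  have := ((hasDerivAt_id v).mul (hf.differentiable_deriv v).hasDerivAt).sub
    (hf.differentiable v).hasDerivAt
  refine this.congr_deriv ?_
  simp

theorem hasDerivAt_excess (hf : IsFlux f) (c v : ℝ) :
    HasDerivAt (excess f c) ((v - c) * deriv (deriv f) v) v := by
  refine (((hasDerivAt_legendre hf v).sub_const _).sub
    (((hf.differentiable_deriv v).hasDerivAt.sub_const _).const_mul c)).congr_deriv ?_
  ring

theorem excess_self (f : ℝ → ℝ) (c : ℝ) : excess f c c = 0 := by simp [excess]

theorem excess_nonneg (hf : IsFlux f) (c v : ℝ) : 0 ≤ excess f c v := by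
  have := legendre_sub_ge hf c v
  unfold excess; linarith

theorem HasDegeneracy.reflect {α N₁ N₂ : ℝ} (h : HasDegeneracy f c α N₁ N₂) :
    HasDegeneracy (fun v => f (-v)) (-c) α N₂ N₁ := by
  have e : (fun v => deriv (deriv fun v => f (-v)) v / |v - -c| ^ α) =
      (fun v => deriv (deriv f) v / |v - c| ^ α) ∘ Neg.neg := by
    ext v
    simp only [deriv_deriv_reflect, Function.comp]
    rw [← abs_neg]; congr 3; ring
  refine ⟨h.order_nonneg, h.plus_pos, h.minus_pos, ?_, ?_⟩
  · rw [e]; exact h.plus.comp (by simpa using tendsto_neg_nhdsLT (a := -c))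
  · rw [e]; exact h.minus.comp (by simpa using tendsto_neg_nhdsGT (a := -c))

/-- Power bounds for `f''` on the right of `c`. -/
def PowerBounds (f : ℝ → ℝ) (c α k l r : ℝ) : Prop :=
  ∀ v, c < v → v ≤ c + r → k * (v - c) ^ α ≤ deriv (deriv f) v ∧
    deriv (deriv f) v ≤ l * (v - c) ^ α

theorem HasDegeneracy.exists_powerBounds {α N₁ N₂ : ℝ} (h : HasDegeneracy f c α N₁ N₂) :
    ∃ k l r, 0 < k ∧ 0 < l ∧ 0 < r ∧ PowerBounds f c α k l r := by
  have hN := h.plus_pos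
  have h1 := h.plus.eventually (Icc_mem_nhds (show N₂ / 2 < N₂ by linarith)
    (show N₂ < 2 * N₂ by linarith))
  obtain ⟨d, hd, h2⟩ := mem_nhdsGT_iff_exists_Ioc_subset.1 h1
  have hd : c < d := hd
  refine ⟨N₂ / 2, 2 * N₂, d - c, by linarith, by linarith, by linarith, fun v hv1 hv2 => ?_⟩
  have h3 := h2 ⟨hv1, by linarith⟩
  have hpos : 0 < v - c := by linarith
  rw [mem_ofPred_eq, abs_of_pos hpos] at h3
  have h4 := Real.rpow_pos_of_pos hpos α
  rwa [le_div_iff₀ h4, div_le_iff₀ h4] at h3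

/-- The wave speed rises from `c` to `v` by at most the order `(v - c) ^ (1 + α)`. -/
theorem PowerBounds.deriv_sub_le (hf : IsFlux f) {α k l r : ℝ} (h : PowerBounds f c α k l r)
    (hα : 0 ≤ α) (hl : 0 ≤ l) {v : ℝ} (hv : c ≤ v) (hvr : v ≤ c + r) :
    deriv f v - deriv f c ≤ l * (v - c) ^ (1 + α) := by
  rcases hv.eq_or_lt with rfl | hv
  · rw [sub_self, sub_self, Real.zero_rpow (by linarith), mul_zero]
  obtain ⟨ξ, hξ, he⟩ := exists_deriv_eq_slope (deriv f) hv hf.continuous_deriv.continuousOn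
    hf.differentiable_deriv.differentiableOn
  rw [eq_div_iff (by linarith)] at he
  have h1 := (h ξ hξ.1 (hξ.2.le.trans hvr)).2
  have h2 : (ξ - c) ^ α ≤ (v - c) ^ α :=
    Real.rpow_le_rpow (by linarith [hξ.1]) (by linarith [hξ.2]) hα
  rw [← he, add_comm 1 α, Real.rpow_add (by linarith), Real.rpow_one, ← mul_assoc]
  exact mul_le_mul_of_nonneg_right (h1.trans (by gcongr)) (by linarith)

/-- The lower bound comes from the right half of `[c, v]`, where `f''` is at least of order
`((v - c) / 2) ^ α`. -/
theorem PowerBounds.le_deriv_sub (hf : IsFlux f) {α k l r : ℝ} (h : PowerBounds f c α k l r)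
    (hα : 0 ≤ α) (hk : 0 ≤ k) {v : ℝ} (hv : c ≤ v) (hvr : v ≤ c + r) :
    k * ((v - c) / 2) ^ (1 + α) ≤ deriv f v - deriv f c := by
  rcases hv.eq_or_lt with rfl | hv
  · rw [sub_self, sub_self, zero_div, Real.zero_rpow (by linarith), mul_zero]
  have hm : (c + v) / 2 < v := by linarith
  obtain ⟨ξ, hξ, he⟩ := exists_deriv_eq_slope (deriv f) hm hf.continuous_deriv.continuousOn
    hf.differentiable_deriv.differentiableOn
  rw [eq_div_iff (by linarith)] at he
  have h1 := (h ξ (by linarith [hξ.1]) (hξ.2.le.trans hvr)).1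
  have h2 : ((v - c) / 2) ^ α ≤ (ξ - c) ^ α :=
    Real.rpow_le_rpow (by linarith) (by linarith [hξ.1]) hα
  have h3 : deriv f c ≤ deriv f ((c + v) / 2) := hf.strictMono.monotone (by linarith)
  have h4 : k * ((v - c) / 2) ^ α ≤ deriv (deriv f) ξ := le_trans (by gcongr) h1
  have h5 := mul_le_mul_of_nonneg_right h4 (show 0 ≤ (v - c) / 2 by linarith)
  rw [Real.rpow_add (by linarith), Real.rpow_one]
  have e : v - (c + v) / 2 = (v - c) / 2 := by ring
  rw [e] at he
  linarith

/-- The excess is at least of the order `(v - c) ^ (2 + α)`. -/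
theorem PowerBounds.le_excess (hf : IsFlux f) {α k l r : ℝ} (h : PowerBounds f c α k l r)
    (hα : 0 ≤ α) (hk : 0 ≤ k) {v : ℝ} (hv : c ≤ v) (hvr : v ≤ c + r) :
    k * ((v - c) / 2) ^ (2 + α) ≤ excess f c v := by
  rcases hv.eq_or_lt with rfl | hv
  · rw [sub_self, zero_div, Real.zero_rpow (by linarith), mul_zero, excess_self]
  have hm : (c + v) / 2 < v := by linarith
  obtain ⟨ξ, hξ, he⟩ := exists_hasDerivAt_eq_slope (excess f c)
    (fun v => (v - c) * deriv (deriv f) v) hm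
    (fun x _ => (hasDerivAt_excess hf c x).continuousAt.continuousWithinAt)
    fun x _ => hasDerivAt_excess hf c x
  rw [eq_div_iff (by linarith)] at he
  have h1 := (h ξ (by linarith [hξ.1]) (hξ.2.le.trans hvr)).1
  have h2 : ((v - c) / 2) ^ α ≤ (ξ - c) ^ α :=
    Real.rpow_le_rpow (by linarith) (by linarith [hξ.1]) hα
  have h3 := excess_nonneg hf c ((c + v) / 2)
  have h4 : k * ((v - c) / 2) ^ α ≤ deriv (deriv f) ξ := le_trans (by gcongr) h1
  have h0 : 0 ≤ (v - c) / 2 := by linarith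
  have h5 : (v - c) / 2 * (k * ((v - c) / 2) ^ α) ≤ (ξ - c) * deriv (deriv f) ξ :=
    mul_le_mul (by linarith [hξ.1]) h4 (by positivity) (by linarith [hξ.1])
  have h6 := mul_le_mul_of_nonneg_right h5 h0
  have e : v - (c + v) / 2 = (v - c) / 2 := by ring
  rw [e] at he
  rw [Real.rpow_add (by linarith), Real.rpow_two]
  nlinarith

theorem le_of_hasDerivAt_nonneg {g g' : ℝ → ℝ} (hg : ∀ s, HasDerivAt g (g' s) s) {A : ℝ}
    (hA : 0 ≤ A) (h : ∀ s, 0 < s → s < A → 0 ≤ g' s) : g 0 ≤ g A := by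
  refine monotoneOn_of_deriv_nonneg (convex_Icc 0 A)
    (fun s _ => (hg s).continuousAt.continuousWithinAt)
    (fun s _ => (hg s).differentiableAt.differentiableWithinAt) (fun s hs => ?_)
    (left_mem_Icc.2 hA) (right_mem_Icc.2 hA) hA
  rw [interior_Icc] at hs
  rw [(hg s).deriv]
  exact h s hs.1 hs.2

/-- If `f''` is nearly symmetric about `c`, then a state on the right of `c` whose excess is at most
that of a state on the left of `c` is, in characteristic speed, hardly further away from `c`. -/
theorem deriv_sub_le_of_excess_le (hf : IsFlux f) {κ r A B : ℝ} (hκ : 0 ≤ κ)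
    (hs : ∀ s, 0 < s → s ≤ r → deriv (deriv f) (c + s) ≤ (1 + κ) * deriv (deriv f) (c - s) ∧
      deriv (deriv f) (c - s) ≤ (1 + κ) * deriv (deriv f) (c + s))
    (hA : 0 ≤ A) (hAr : A ≤ r) (hB : 0 ≤ B) (hBr : B ≤ r)
    (h : excess f c (c + A) ≤ excess f c (c - B)) :
    deriv f (c + A) - deriv f c ≤ (1 + κ) ^ 2 * (deriv f c - deriv f (c - B)) := by
  have hp : ∀ s, HasDerivAt (fun s => deriv f (c + s)) (deriv (deriv f) (c + s)) s := fun s =>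
    (hf.differentiable_deriv (c + s)).hasDerivAt.comp_const_add c s
  have hm : ∀ s, HasDerivAt (fun s => deriv f (c - s)) (-deriv (deriv f) (c - s)) s := fun s =>
    (hf.differentiable_deriv (c - s)).hasDerivAt.comp_const_sub c s
  have hpe : ∀ s, HasDerivAt (fun s => excess f c (c + s)) (s * deriv (deriv f) (c + s)) s :=
    fun s => ((hasDerivAt_excess hf c (c + s)).comp_const_add c s).congr_deriv (by ring)
  have hme : ∀ s, HasDerivAt (fun s => excess f c (c - s)) (s * deriv (deriv f) (c - s)) s :=
    fun s => ((hasDerivAt_excess hf c (c - s)).comp_const_sub c s).congr_deriv (by ring)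
  have hcomp : ∀ S, 0 ≤ S → S ≤ r →
      deriv f (c + S) - deriv f c ≤ (1 + κ) * (deriv f c - deriv f (c - S)) := by
    intro S hS hSr
    have := le_of_hasDerivAt_nonneg (g := fun s => -deriv f (c + s) - (1 + κ) * deriv f (c - s))
      (fun s => (hp s).neg.sub ((hm s).const_mul (1 + κ))) hS
      (fun s h1 h2 => by linarith [(hs s h1 (h2.le.trans hSr)).1])
    simp only [add_zero, sub_zero] at this
    linarith
  rcases le_or_gt A B with hAB | hAB
  · have h1 := hcomp A hA hAr
    have h2 : deriv f (c - B) ≤ deriv f (c - A) := hf.strictMono.monotone (by linarith)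
    have h3 : deriv f (c - A) ≤ deriv f c := hf.strictMono.monotone (by linarith)
    have h4 : (1 + κ) * (deriv f c - deriv f (c - A)) ≤
        (1 + κ) * (deriv f c - deriv f (c - B)) := by gcongr
    have h5 : 0 ≤ κ * (1 + κ) * (deriv f c - deriv f (c - B)) :=
      mul_nonneg (by positivity) (by linarith)
    nlinarith
  · -- The part of the excess beyond `c + B` is bounded by the asymmetry within `[c - B, c + B]`.
    have h1 := le_of_hasDerivAt_nonneg
      (g := fun s => (1 + κ) * excess f c (c + s) - excess f c (c - s))
      (fun s => ((hpe s).const_mul (1 + κ)).sub (hme s)) hB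
      (fun s h1 h2 => by
        have := mul_le_mul_of_nonneg_left (hs s h1 (h2.le.trans hBr)).2 h1.le
        linarith)
    have h2 := le_of_hasDerivAt_nonneg
      (g := fun s => B * deriv f (c + s) - excess f c (c + s))
      (fun s => ((hp s).const_mul B).sub (hpe s)) hB
      (fun s h1 h2 => by
        have := mul_le_mul_of_nonneg_right h2.le (hf.nonneg (c + s))
        linarith)
    have h3 : excess f c (c + B) + B * (deriv f (c + A) - deriv f (c + B)) ≤
        excess f c (c + A) := by
      have e1 := legendre_sub_ge hf (c + B) (c + A)
      have e2 : deriv f (c + B) ≤ deriv f (c + A) := hf.strictMono.monotone (by linarith)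
      unfold excess
      linarith
    simp only [add_zero, sub_zero, excess_self, mul_zero] at h1 h2
    have h4 := hcomp B hB hBr
    rcases hB.eq_or_lt with rfl | hB'
    · rw [sub_zero, excess_self] at h
      have h5 := excess_nonneg hf c (c + A)
      have h6 := legendre_sub_gt hf (show c ≠ c + A by linarith)
      unfold excess at h
      linarith
    · have h5 : B * (deriv f (c + A) - deriv f (c + B)) ≤
          B * (κ * (deriv f (c + B) - deriv f c)) := by nlinarith
      have h6 := le_of_mul_le_mul_left h5 hB'
      have h7 : (1 + κ) * (deriv f (c + B) - deriv f c) ≤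
          (1 + κ) * ((1 + κ) * (deriv f c - deriv f (c - B))) := by gcongr
      nlinarith

/-- With equal coefficients on both sides, `f''` is nearly symmetric about `c`. -/
theorem HasDegeneracy.exists_symm {α N : ℝ} (h : HasDegeneracy f c α N N) {κ : ℝ} (hκ : 0 < κ) :
    ∃ r, 0 < r ∧ ∀ s, 0 < s → s ≤ r →
      deriv (deriv f) (c + s) ≤ (1 + κ) * deriv (deriv f) (c - s) ∧
        deriv (deriv f) (c - s) ≤ (1 + κ) * deriv (deriv f) (c + s) := by
  have hN := h.plus_pos
  have hp : Tendsto (fun s : ℝ => c + s) (𝓝[>] 0) (𝓝[>] c) := by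
    refine tendsto_nhdsWithin_iff.2 ⟨?_, ?_⟩
    · have : Tendsto (fun s : ℝ => c + s) (𝓝 0) (𝓝 (c + 0)) :=
        (continuous_const.add continuous_id).tendsto 0
      rw [add_zero] at this
      exact this.mono_left nhdsWithin_le_nhds
    · filter_upwards [self_mem_nhdsWithin] with s hs
      simpa using hs
  have hm : Tendsto (fun s : ℝ => c - s) (𝓝[>] 0) (𝓝[<] c) := by
    refine tendsto_nhdsWithin_iff.2 ⟨?_, ?_⟩
    · have : Tendsto (fun s : ℝ => c - s) (𝓝 0) (𝓝 (c - 0)) :=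
        (continuous_const.sub continuous_id).tendsto 0
      rw [sub_zero] at this
      exact this.mono_left nhdsWithin_le_nhds
    · filter_upwards [self_mem_nhdsWithin] with s hs
      simpa using hs
  have h1 := h.plus.comp hp
  have h2 := h.minus.comp hm
  have hlt : N < (1 + κ) * N := by nlinarith
  have h3 : ∀ᶠ s : ℝ in 𝓝[>] 0, _ := h1.eventually_lt (h2.const_mul (1 + κ)) hlt
  have h4 : ∀ᶠ s : ℝ in 𝓝[>] 0, _ := h2.eventually_lt (h1.const_mul (1 + κ)) hlt
  obtain ⟨r, hr, h5⟩ := mem_nhdsGT_iff_exists_Ioc_subset.1 (h3.and h4)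
  refine ⟨r, hr, fun s hs hsr => ?_⟩
  have h6 := h5 ⟨hs, hsr⟩
  have hpos := Real.rpow_pos_of_pos hs α
  have e1 : |c + s - c| = s := by rw [add_sub_cancel_left, abs_of_pos hs]
  have e2 : |c - s - c| = s := by rw [sub_sub_cancel_left, abs_neg, abs_of_pos hs]
  simp only [Function.comp, mem_ofPred_eq, e1, e2, mul_div_assoc', div_lt_div_iff_of_pos_right hpos]
    at h6
  exact ⟨h6.1.le, h6.2.le⟩

end Excess

/-! ### Curves with nested backward characteristics -/

/-- A curve `X` from time `T > 0` on, with extreme minimizers `vR ≤ vL` at its points, along which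
the backward characteristics of `vL` move to the left and those of `vR` move to the right. This
keeps of a forward generalized characteristic what its large-time behaviour depends on, in a form
that is stable under reflection of the line. -/
structure IsShockCurve (f K : ℝ → ℝ) (T : ℝ) (X vL vR : ℝ → ℝ) : Prop where
  pos : 0 < T
  min_left : ∀ t, T ≤ t → IsLaxMin f K t (X t) (vL t)
  min_right : ∀ t, T ≤ t → IsLaxMin f K t (X t) (vR t)
  le : ∀ t, T ≤ t → vR t ≤ vL t
  nested_left : ∀ t₁ t₂ τ, T ≤ t₁ → t₁ < t₂ → 0 < τ → τ < t₁ →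
    X t₂ - (t₂ - τ) * deriv f (vL t₂) ≤ X t₁ - (t₁ - τ) * deriv f (vL t₁)
  nested_right : ∀ t₁ t₂ τ, T ≤ t₁ → t₁ < t₂ → 0 < τ → τ < t₁ →
    X t₁ - (t₁ - τ) * deriv f (vR t₁) ≤ X t₂ - (t₂ - τ) * deriv f (vR t₂)

/-- The traces along a forward generalized characteristic are the extreme minimizers, and nesting of
the triangles compares their left and right sides. -/
theorem IsForwardChar.isShockCurve {f φ : ℝ → ℝ} {u : ℝ → ℝ → ℝ} {s T : ℝ} {X : ℝ → ℝ}
    (hf : IsFlux f) (hu : IsEntropySolution f φ u) (hut : IsTimeContinuous u)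
    (hX : IsForwardChar f u s X) (hT : 0 < T) (hsT : s ≤ T) :
    IsShockCurve f (primitive φ) T X (fun t => traceLeft u (X t) t)
      fun t => traceRight u (X t) t := by
  have hle : ∀ t, T ≤ t → traceRight u (X t) t ≤ traceLeft u (X t) t := fun t ht =>
    (hu.traceRight_le hf (hT.trans_le ht) _).trans (hu.le_traceLeft hf (hT.trans_le ht) _)
  have key : ∀ t₁ t₂ τ v, T ≤ t₁ → t₁ < t₂ → 0 < τ → τ < t₁ →
      v ∈ Icc (traceRight u (X t₁) t₁) (traceLeft u (X t₁) t₁) →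
      ∃ w ∈ Icc (traceRight u (X t₂) t₂) (traceLeft u (X t₂) t₂),
        X t₁ + (τ - t₁) * deriv f v = X t₂ + (τ - t₂) * deriv f w := by
    intro t₁ t₂ τ v h1 h2 h3 h4 hv
    obtain ⟨-, -, w, hw, he⟩ := hX.nested t₁ t₂ (hsT.trans h1) (hT.trans_le h1) h2
      (show (X t₁ + (τ - t₁) * deriv f v, τ) ∈ _ from ⟨h3, h4, v, hv, rfl⟩)
    exact ⟨w, hw, he⟩
  refine ⟨hT, fun t ht => (hu.isLaxMin_traces hf hut (hT.trans_le ht) _).1,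
    fun t ht => (hu.isLaxMin_traces hf hut (hT.trans_le ht) _).2, hle, ?_, ?_⟩
  · intro t₁ t₂ τ h1 h2 h3 h4
    obtain ⟨w, hw, he⟩ := key t₁ t₂ τ _ h1 h2 h3 h4 (right_mem_Icc.2 (hle t₁ h1))
    have := mul_le_mul_of_nonneg_left (hf.strictMono.monotone hw.2)
      (show 0 ≤ t₂ - τ by linarith)
    linarith
  · intro t₁ t₂ τ h1 h2 h3 h4
    obtain ⟨w, hw, he⟩ := key t₁ t₂ τ _ h1 h2 h3 h4 (left_mem_Icc.2 (hle t₁ h1))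
    have := mul_le_mul_of_nonneg_left (hf.strictMono.monotone hw.1)
      (show 0 ≤ t₂ - τ by linarith)
    linarith

/-- A minimizer at a point right of a divide has its foot right of the origin of the divide. -/
theorem IsSupport.le_foot {f K : ℝ → ℝ} (hf : IsFlux f) {b c t x v : ℝ} (hb : IsSupport K b c)
    (ht : 0 < t) (hx : b + t * deriv f c < x) (hv : IsLaxMin f K t x v) :
    b ≤ x - t * deriv f v := by
  by_contra! hcon
  have h1 : deriv f c < deriv f v := by
    have : t * deriv f c < t * deriv f v := by linarith
    exact lt_of_mul_lt_mul_left this ht.le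
  obtain ⟨w, hw, hwx⟩ := intermediate_value_Icc (hf.strictMono.lt_iff_lt.1 h1).le
    (f := fun v => t * deriv f v) (by have := hf.continuous_deriv; fun_prop)
    (show x - b ∈ Icc (t * deriv f c) (t * deriv f v) from ⟨by linarith, by linarith⟩)
  simp only at hwx
  have hcw : c < w := by
    refine hf.strictMono.lt_iff_lt.1 (lt_of_mul_lt_mul_left (a := t) ?_ ht.le)
    linarith
  have h2 := hv w
  unfold cost at h2
  have e : x - t * deriv f w = b := by linarith
  rw [e] at h2
  have h3 := hb (x - t * deriv f v)
  rw [show x - t * deriv f v - b = -(t * deriv f v - t * deriv f w) by linarith] at h3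
  have h4 := mul_le_mul_of_nonneg_left (legendre_sub_ge hf w v) ht.le
  have h5 : 0 < (w - c) * (t * deriv f v - t * deriv f w) :=
    mul_pos (by linarith) (by linarith)
  linarith

namespace IsShockCurve

variable {f K : ℝ → ℝ} {T M : ℝ} {X vL vR : ℝ → ℝ}

theorem reflect (h : IsShockCurve f K T X vL vR) :
    IsShockCurve (fun v => f (-v)) (fun x => K (-x)) T (fun t => -X t) (fun t => -vR t)
      fun t => -vL t where
  pos := h.pos
  min_left t ht := (h.min_right t ht).reflect
  min_right t ht := (h.min_left t ht).reflect
  le t ht := neg_le_neg (h.le t ht)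
  nested_left t₁ t₂ τ h1 h2 h3 h4 := by
    have := h.nested_right t₁ t₂ τ h1 h2 h3 h4
    simp only [deriv_reflect, neg_neg]
    linarith
  nested_right t₁ t₂ τ h1 h2 h3 h4 := by
    have := h.nested_left t₁ t₂ τ h1 h2 h3 h4
    simp only [deriv_reflect, neg_neg]
    linarith

theorem footLeft_antitone (h : IsShockCurve f K T X vL vR) {t₁ t₂ : ℝ} (h1 : T ≤ t₁)
    (h2 : t₁ ≤ t₂) : X t₂ - t₂ * deriv f (vL t₂) ≤ X t₁ - t₁ * deriv f (vL t₁) := by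
  rcases h2.eq_or_lt with rfl | h2
  · exact le_rfl
  have hc : ∀ s a b : ℝ, Tendsto (fun τ : ℝ => a - (s - τ) * b) (𝓝[>] 0) (𝓝 (a - s * b)) := by
    intro s a b
    have : Tendsto (fun τ : ℝ => a - (s - τ) * b) (𝓝 0) (𝓝 (a - (s - 0) * b)) :=
      Continuous.tendsto (by fun_prop) 0
    rw [sub_zero] at this
    exact this.mono_left nhdsWithin_le_nhds
  refine le_of_tendsto_of_tendsto (hc t₂ _ _) (hc t₁ _ _) ?_
  filter_upwards [Ioo_mem_nhdsGT (h.pos.trans_le h1)] with τ hτ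
  exact h.nested_left t₁ t₂ τ h1 h2 hτ.1 hτ.2

theorem footRight_monotone (h : IsShockCurve f K T X vL vR) {t₁ t₂ : ℝ} (h1 : T ≤ t₁)
    (h2 : t₁ ≤ t₂) : X t₁ - t₁ * deriv f (vR t₁) ≤ X t₂ - t₂ * deriv f (vR t₂) := by
  have := h.reflect.footLeft_antitone h1 h2
  simp only [deriv_reflect, neg_neg] at this
  linarith

theorem footLeft_le_footRight (hf : IsFlux f) (h : IsShockCurve f K T X vL vR) {t : ℝ}
    (ht : T ≤ t) : X t - t * deriv f (vL t) ≤ X t - t * deriv f (vR t) := by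
  have := mul_le_mul_of_nonneg_left (hf.strictMono.monotone (h.le t ht)) (h.pos.trans_le ht).le
  linarith

/-- If both feet stay at one point, the curve is a divide issuing from it. -/
theorem exists_isSupport_of_foot_eq (hf : IsFlux f) (hK : ∀ x y, |K x - K y| ≤ M * |x - y|)
    (h : IsShockCurve f K T X vL vR) {T' y : ℝ} (hT : T ≤ T')
    (hL : ∀ t, T' ≤ t → X t - t * deriv f (vL t) = y)
    (hR : ∀ t, T' ≤ t → X t - t * deriv f (vR t) = y) :
    ∃ v, IsSupport K y v ∧ ∀ t, T' ≤ t → X t = y + t * deriv f v := by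
  have h0 := h.pos.trans_le hT
  have hLR : ∀ t, T' ≤ t → vL t = vR t := fun t ht => by
    refine hf.strictMono.injective (mul_left_cancel₀ (h0.trans_le ht).ne' ?_)
    linarith [hL t ht, hR t ht]
  have hconst : ∀ t, T' ≤ t → vL t = vL T' := by
    intro t ht
    rcases ht.eq_or_lt with rfl | ht'
    · rfl
    have h1 := h.nested_left T' t (T' / 2) hT ht' (by linarith) (by linarith)
    have h2 := h.nested_right T' t (T' / 2) hT ht' (by linarith) (by linarith)
    rw [← hLR t ht, ← hLR T' le_rfl] at h2
    have h3 := hL t ht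
    have h4 := hL T' le_rfl
    refine hf.strictMono.injective (mul_left_cancel₀ (a := T' / 2) (by positivity) ?_)
    linarith
  refine ⟨vL T', ?_, fun t ht => ?_⟩
  · refine isSupport_of_tendsto_foot hf hK (l := atTop) (t := id) (x := X) (v := vL) tendsto_id
      ?_ ?_ ?_
    · filter_upwards [eventually_ge_atTop T] with t ht using h.min_left t ht
    · refine tendsto_const_nhds.congr' ?_
      filter_upwards [eventually_ge_atTop T'] with t ht using (hL t ht).symm
    · refine tendsto_const_nhds.congr' ?_
      filter_upwards [eventually_ge_atTop T'] with t ht using (hconst t ht).symm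
  · have := hL t ht
    rw [hconst t ht] at this
    linarith

/-- The left feet converge to a contact point, if they are bounded below. -/
theorem exists_tendsto_footLeft (hf : IsFlux f) (hK : ∀ x y, |K x - K y| ≤ M * |x - y|)
    (h : IsShockCurve f K T X vL vR) {b : ℝ} (hb : ∀ t, T ≤ t → b ≤ X t - t * deriv f (vL t)) :
    ∃ y, b ≤ y ∧ (∀ t, T ≤ t → y ≤ X t - t * deriv f (vL t)) ∧
      Tendsto (fun t => X t - t * deriv f (vL t)) atTop (𝓝 y) ∧ ∃ c, IsSupport K y c := by
  have hanti : Antitone fun t => X (max t T) - max t T * deriv f (vL (max t T)) := fun s t hst =>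
    h.footLeft_antitone (le_max_right _ _) (max_le_max_right T hst)
  have hbdd : BddBelow (range fun t => X (max t T) - max t T * deriv f (vL (max t T))) :=
    ⟨b, by rintro _ ⟨t, rfl⟩; exact hb _ (le_max_right _ _)⟩
  have hlim := tendsto_atTop_ciInf hanti hbdd
  set y := ⨅ t, (X (max t T) - max t T * deriv f (vL (max t T)))
  have hlim' : Tendsto (fun t => X t - t * deriv f (vL t)) atTop (𝓝 y) := by
    refine hlim.congr' ?_
    filter_upwards [eventually_ge_atTop T] with t ht
    rw [max_eq_left ht]
  refine ⟨y, le_ciInf fun t => hb _ (le_max_right _ _), fun t ht => ?_, hlim',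
    exists_isSupport_of_tendsto_foot hf hK
      ((eventually_ge_atTop T).mono fun t ht => h.min_left t ht) hlim'⟩
  have := ciInf_le hbdd t
  rwa [max_eq_left ht] at this

/-- In the strip over a gap the left feet converge to the left endpoint of the gap. -/
theorem tendsto_footLeft_of_gap (hf : IsFlux f) (hK : ∀ x y, |K x - K y| ≤ M * |x - y|)
    (hX : IsShockCurve f K T X vL vR) {e h c : ℝ} (heh : e < h) (he : IsSupport K e c)
    (hh : IsSupport K h c) (hgap : ∀ z d, e < z → z < h → ¬IsSupport K z d)
    (hXl : ∀ t, T ≤ t → e + t * deriv f c < X t) (hXr : ∀ t, T ≤ t → X t < h + t * deriv f c) :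
    Tendsto (fun t => X t - t * deriv f (vL t)) atTop (𝓝 e) := by
  have h0 : ∀ t, T ≤ t → 0 < t := fun t ht => hX.pos.trans_le ht
  have hR : ∀ t, T ≤ t → X t - t * deriv f (vR t) ≤ h := by
    intro t ht
    have := hh.reflect.le_foot hf.reflect (h0 t ht) (x := -X t) (v := -vR t) (by
      have := hXr t ht
      simp only [deriv_reflect, neg_neg]; linarith) (hX.min_right t ht).reflect
    simp only [deriv_reflect, neg_neg] at this
    linarith
  obtain ⟨y, hy1, hy2, hlim, d, hd⟩ := hX.exists_tendsto_footLeft hf hK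
    fun t ht => he.le_foot hf (h0 t ht) (hXl t ht) (hX.min_left t ht)
  have hyT := hy2 T le_rfl
  have hLR := fun t (ht : T ≤ t) => hX.footLeft_le_footRight hf ht
  rcases hy1.eq_or_lt with rfl | hy1
  · exact hlim
  exfalso
  rcases lt_or_ge y h with hyh | hyh
  · exact hgap y d hy1 hyh hd
  -- The feet would stay at `h`, so that the curve would be a divide right of the strip.
  obtain ⟨v, hv, hvX⟩ := hX.exists_isSupport_of_foot_eq hf hK le_rfl (y := h)
    (fun t ht => le_antisymm ((hLR t ht).trans (hR t ht)) (hyh.trans (hy2 t ht)))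
    (fun t ht => le_antisymm (hR t ht) ((hyh.trans (hy2 t ht)).trans (hLR t ht)))
  have h1 := he.mono hv heh
  have h2 := hXr T le_rfl
  rw [hvX T le_rfl] at h2
  have := mul_le_mul_of_nonneg_left (hf.strictMono.monotone h1) hX.pos.le
  linarith

/-- Right of the last point of contact the left feet converge to that point. -/
theorem tendsto_footLeft_of_last (hf : IsFlux f) (hK : ∀ x y, |K x - K y| ≤ M * |x - y|)
    (hX : IsShockCurve f K T X vL vR) {b c : ℝ} (hb : IsSupport K b c)
    (hlast : ∀ z d, IsSupport K z d → z ≤ b)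
    (hXl : ∀ t, T ≤ t → b + t * deriv f c < X t) :
    Tendsto (fun t => X t - t * deriv f (vL t)) atTop (𝓝 b) := by
  obtain ⟨y, hy1, -, hlim, d, hd⟩ := hX.exists_tendsto_footLeft hf hK
    fun t ht => hb.le_foot hf (hX.pos.trans_le ht) (hXl t ht) (hX.min_left t ht)
  rwa [le_antisymm (hlast y d hd) hy1] at hlim

/-- Right of the last point of contact the right feet are unbounded. -/
theorem exists_lt_footRight_of_last (hf : IsFlux f) (hK : ∀ x y, |K x - K y| ≤ M * |x - y|)
    (hX : IsShockCurve f K T X vL vR) {b c : ℝ} (hb : IsSupport K b c)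
    (hlast : ∀ z d, IsSupport K z d → z ≤ b ∧ d ≤ c)
    (hXl : ∀ t, T ≤ t → b + t * deriv f c < X t) :
    ∃ y, b < y ∧ ∀ᶠ t in atTop, y ≤ X t - t * deriv f (vR t) := by
  have hL : ∀ t, T ≤ t → b ≤ X t - t * deriv f (vL t) := fun t ht =>
    hb.le_foot hf (hX.pos.trans_le ht) (hXl t ht) (hX.min_left t ht)
  have hLR := fun t (ht : T ≤ t) => hX.footLeft_le_footRight hf ht
  by_contra! hcon
  have hR : ∀ t, T ≤ t → X t - t * deriv f (vR t) ≤ b := by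
    intro t ht
    by_contra! hlt
    refine hcon _ hlt ?_
    filter_upwards [eventually_ge_atTop t] with s hs
    exact not_lt.2 (hX.footRight_monotone ht hs)
  obtain ⟨v, hv, hvX⟩ := hX.exists_isSupport_of_foot_eq hf hK le_rfl (y := b)
    (fun t ht => le_antisymm ((hLR t ht).trans (hR t ht)) (hL t ht))
    (fun t ht => le_antisymm (hR t ht) ((hL t ht).trans (hLR t ht)))
  have h2 := hXl T le_rfl
  rw [hvX T le_rfl] at h2
  have := mul_le_mul_of_nonneg_left (hf.strictMono.monotone (hlast b v hv).2) hX.pos.le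
  linarith

/-- Right of the last point of contact the left states converge to the extreme slope. -/
theorem tendsto_left_of_last (hf : IsFlux f) (hK : ∀ x y, |K x - K y| ≤ M * |x - y|)
    (hX : IsShockCurve f K T X vL vR) {b c : ℝ} (hb : IsSupport K b c)
    (hlast : ∀ z d, IsSupport K z d → z ≤ b ∧ d ≤ c)
    (hXl : ∀ t, T ≤ t → b + t * deriv f c < X t) : Tendsto vL atTop (𝓝 c) := by
  have hlim := hX.tendsto_footLeft_of_last hf hK hb (fun z d h => (hlast z d h).1) hXl
  refine isCompact_Icc.tendsto_nhds_of_unique_mapClusterPt (s := Icc (-M) M) ?_ ?_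
  · filter_upwards [eventually_ge_atTop T] with t ht
    exact abs_le.1 ((hX.min_left t ht).abs_le hf hK (hX.pos.trans_le ht))
  · intro d _ hd
    obtain ⟨U, hU, hd⟩ := mapClusterPt_iff_ultrafilter.1 hd
    have hs : IsSupport K b d := isSupport_of_tendsto_foot hf hK (l := (U : Filter ℝ)) (t := id)
      (x := X) (v := vL) (tendsto_id.mono_left hU)
      (((eventually_ge_atTop T).mono fun t ht => hX.min_left t ht).filter_mono hU)
      (hlim.mono_left hU) hd
    refine le_antisymm (hlast b d hs).2 (hf.strictMono.le_iff_le.1 ?_)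
    have h1 : Tendsto (fun t => deriv f c - (X t - t * deriv f (vL t) - b) / t) U
        (𝓝 (deriv f c - 0)) :=
      tendsto_const_nhds.sub
        (((hlim.sub_const b).div_atTop tendsto_id).mono_left hU)
    rw [sub_zero] at h1
    refine le_of_tendsto_of_tendsto h1 ((hf.continuous_deriv.tendsto d).comp hd) ?_
    have h2 := (eventually_ge_atTop T).filter_mono hU
    filter_upwards [h2] with t ht
    have h3 := hX.pos.trans_le ht
    have h4 := hXl t ht
    have : deriv f c - (X t - t * deriv f (vL t) - b) / t =
      deriv f (vL t) - (X t - b - t * deriv f c) / t := by field_simp; ring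
    rw [this, Function.comp]
    have : 0 ≤ (X t - b - t * deriv f c) / t := div_nonneg (by linarith) h3.le
    linarith

/-- The distance to the extreme divide is sublinear. -/
theorem tendsto_div_of_last (hf : IsFlux f) (hK : ∀ x y, |K x - K y| ≤ M * |x - y|)
    (hX : IsShockCurve f K T X vL vR) {b c : ℝ} (hb : IsSupport K b c)
    (hlast : ∀ z d, IsSupport K z d → z ≤ b ∧ d ≤ c)
    (hXl : ∀ t, T ≤ t → b + t * deriv f c < X t) :
    Tendsto (fun t => (X t - b - t * deriv f c) / t) atTop (𝓝 0) := by
  have h1 := hX.tendsto_footLeft_of_last hf hK hb (fun z d h => (hlast z d h).1) hXl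
  have h2 := hX.tendsto_left_of_last hf hK hb hlast hXl
  have h3 := ((h1.sub_const b).div_atTop tendsto_id).add
    (((hf.continuous_deriv.tendsto c).comp h2).sub_const (deriv f c))
  rw [sub_self, zero_add] at h3
  refine h3.congr' ?_
  filter_upwards [eventually_gt_atTop 0] with t ht
  simp only [Function.comp, id]
  field_simp
  ring

/-! ### Rates -/

/-- At large times the point `b` is the foot of a segment whose state is slightly above `c`, and
comparison with it bounds the primitive at the left foot. -/
theorem eventually_exists_state (hf : IsFlux f) (hX : IsShockCurve f K T X vL vR) {b c : ℝ}
    (hXl : ∀ t, T ≤ t → b + t * deriv f c < X t)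
    (hρ : Tendsto (fun t => (X t - b - t * deriv f c) / t) atTop (𝓝 0)) {r : ℝ} (hr : 0 < r) :
    ∀ᶠ t in atTop, ∃ w, c ≤ w ∧ w ≤ c + r ∧ deriv f w - deriv f c = (X t - b - t * deriv f c) / t ∧
      K (X t - t * deriv f (vL t)) - K b - c * (X t - t * deriv f (vL t) - b) ≤
        (w - c) * (X t - t * deriv f (vL t) - b) := by
  have h1 : deriv f c < deriv f (c + r) := hf.strictMono (by linarith)
  filter_upwards [hρ.eventually (gt_mem_nhds (sub_pos.2 h1)), eventually_ge_atTop T] with t h2 ht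
  have h0 := hX.pos.trans_le ht
  have h3 := hXl t ht
  have h4 : 0 ≤ (X t - b - t * deriv f c) / t := div_nonneg (by linarith) h0.le
  obtain ⟨w, hw, hwx⟩ := intermediate_value_Icc (show c ≤ c + r by linarith)
    hf.continuous_deriv.continuousOn
    (show deriv f c + (X t - b - t * deriv f c) / t ∈ Icc (deriv f c) (deriv f (c + r)) from
      ⟨by linarith, by linarith⟩)
  refine ⟨w, hw.1, hw.2, by linarith, ?_⟩
  have h5 := hX.min_left t ht w
  unfold cost at h5
  have e : t * deriv f w = X t - b := by rw [hwx]; field_simp; ring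
  rw [e, sub_sub_cancel] at h5
  have h6 := mul_le_mul_of_nonneg_left (legendre_sub_le hf (vL t) w) h0.le
  have h7 : t * (w * (deriv f w - deriv f (vL t))) = w * (X t - b - t * deriv f (vL t)) := by
    rw [← e]; ring
  rw [h7] at h6
  linarith

/-- If the primitive grows faster than its supporting line, the left feet reach `b` in finite
time. -/
theorem eventually_footLeft_eq (hf : IsFlux f) (hX : IsShockCurve f K T X vL vR) {b c κ : ℝ}
    (hb : IsSupport K b c) (hXl : ∀ t, T ≤ t → b + t * deriv f c < X t)
    (hρ : Tendsto (fun t => (X t - b - t * deriv f c) / t) atTop (𝓝 0))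
    (hlim : Tendsto (fun t => X t - t * deriv f (vL t)) atTop (𝓝 b)) (hκ : 0 < κ)
    (hG : ∀ᶠ z in 𝓝[>] b, κ * (z - b) ≤ K z - K b - c * (z - b)) :
    ∀ᶠ t in atTop, X t - t * deriv f (vL t) = b := by
  have hG' := hlim.eventually (eventually_nhdsWithin_iff.1 hG)
  filter_upwards [hX.eventually_exists_state hf hXl hρ (half_pos hκ), hG',
    eventually_ge_atTop T] with t h1 h2 ht
  obtain ⟨w, -, h3, -, h4⟩ := h1
  have h5 := hb.le_foot hf (hX.pos.trans_le ht) (hXl t ht) (hX.min_left t ht)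
  rcases h5.eq_or_lt with h5 | h5
  · exact h5.symm
  · have h6 := h2 h5
    have : 0 < (κ / 2) * (X t - t * deriv f (vL t) - b) := mul_pos (by linarith) (by linarith)
    nlinarith

/-- Growth of the primitive above its supporting line gives a rate for the left feet. -/
theorem footLeft_rate (hf : IsFlux f) (hX : IsShockCurve f K T X vL vR)
    {b c α k l r σ C C' θ : ℝ} (hb : IsSupport K b c)
    (hXl : ∀ t, T ≤ t → b + t * deriv f c < X t)
    (hlim : Tendsto (fun t => X t - t * deriv f (vL t)) atTop (𝓝 b)) (hα : 0 ≤ α)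
    (hk : 0 < k) (hr : 0 < r) (hpow : PowerBounds f c α k l r) (hθ : θ < 1) (hC' : 0 < C')
    (hρ : ∀ᶠ t in atTop, X t - b - t * deriv f c ≤ C' * t ^ θ) (hσ : 0 < σ) (hC : 0 < C)
    (hG : ∀ᶠ z in 𝓝[>] b, C * (z - b) ^ (1 + σ) ≤ K z - K b - c * (z - b)) :
    ∃ D, 0 < D ∧ ∀ᶠ t in atTop,
      X t - t * deriv f (vL t) - b ≤ D * t ^ ((θ - 1) / ((1 + α) * σ)) := by
  have hρ0 : Tendsto (fun t => (X t - b - t * deriv f c) / t) atTop (𝓝 0) := by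
    have h1 : Tendsto (fun t : ℝ => C' * t ^ (-(1 - θ))) atTop (𝓝 (C' * 0)) :=
      (tendsto_rpow_neg_atTop (by linarith)).const_mul C'
    rw [mul_zero] at h1
    refine squeeze_zero' ?_ ?_ h1
    · filter_upwards [eventually_ge_atTop T] with t ht
      exact div_nonneg (by linarith [hXl t ht]) (hX.pos.trans_le ht).le
    · filter_upwards [hρ, eventually_gt_atTop 0] with t h2 ht
      rw [div_le_iff₀ ht, mul_assoc, ← Real.rpow_add_one ht.ne']
      rwa [show -(1 - θ) + 1 = θ by ring]
  have hG' := hlim.eventually (eventually_nhdsWithin_iff.1 hG)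
  have hα1 : 0 < 1 + α := by linarith
  refine ⟨(2 / C * (C' / k) ^ (1 / (1 + α))) ^ (1 / σ), by positivity, ?_⟩
  filter_upwards [hX.eventually_exists_state hf hXl hρ0 hr, hG', eventually_ge_atTop T, hρ]
    with t h1 h2 ht h3
  have ht0 := hX.pos.trans_le ht
  obtain ⟨w, hw1, hw2, hw3, hw4⟩ := h1
  have h5 := hb.le_foot hf ht0 (hXl t ht) (hX.min_left t ht)
  rcases h5.eq_or_lt with h5 | h5
  · rw [← h5, sub_self]; positivity
  set δ := X t - t * deriv f (vL t) - b with hδ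
  have hδ0 : 0 < δ := by linarith
  have h6 := (h2 h5).trans hw4
  rw [Real.rpow_add hδ0, Real.rpow_one, mul_comm δ, ← mul_assoc] at h6
  have h7 : C * δ ^ σ ≤ w - c := le_of_mul_le_mul_right h6 hδ0
  have h8 := hpow.le_deriv_sub hf hα hk.le hw1 hw2
  rw [hw3] at h8
  have h9 : ((w - c) / 2) ^ (1 + α) ≤ C' / k * t ^ (θ - 1) := by
    rw [Real.rpow_sub_one ht0.ne', div_mul_div_comm, le_div_iff₀ (by positivity)]
    rw [le_div_iff₀ ht0] at h8
    linarith
  have h10 : (w - c) / 2 ≤ (C' / k * t ^ (θ - 1)) ^ (1 / (1 + α)) := by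
    have := Real.rpow_le_rpow (by have := sub_nonneg.2 hw1; positivity) h9
      (show 0 ≤ 1 / (1 + α) by positivity)
    rwa [← Real.rpow_mul (by linarith), mul_one_div_cancel hα1.ne', Real.rpow_one] at this
  have h11 : δ ^ σ ≤ 2 / C * (C' / k) ^ (1 / (1 + α)) * t ^ ((θ - 1) / (1 + α)) := by
    rw [Real.mul_rpow (by positivity) (by positivity), ← Real.rpow_mul ht0.le, mul_one_div] at h10
    rw [mul_assoc, div_mul_eq_mul_div, le_div_iff₀ hC]
    linarith
  have h12 := Real.rpow_le_rpow (by positivity) h11 (show 0 ≤ 1 / σ by positivity)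
  rw [← Real.rpow_mul hδ0.le, mul_one_div_cancel hσ.ne', Real.rpow_one,
    Real.mul_rpow (by positivity) (by positivity), ← Real.rpow_mul ht0.le] at h12
  convert h12 using 3
  field_simp

/-- The width of the right unbounded region left of a shock. If `s` is the distance of the left
state from `c`, the excess at `s` is of order `s ^ (2 + α)` and bounded by `ρ ^ (1 - 1 / p) / t`,
while `ρ` is of order `t * s ^ (1 + α)`. -/
theorem width_rate (hf : IsFlux f) (hX : IsShockCurve f K T X vL vR)
    {b c α k l r p Q : ℝ} (hb : IsSupport K b c)
    (hlim : Tendsto (fun t => X t - t * deriv f (vL t)) atTop (𝓝 b))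
    (hvL : Tendsto vL atTop (𝓝 c)) (hα : 0 ≤ α)
    (hk : 0 < k) (hl : 0 < l) (hr : 0 < r) (hpow : PowerBounds f c α k l r) (hp : 1 ≤ p)
    (hQ : 0 < Q) (hG : ∀ z, b < z → K z - K b - c * (z - b) ≤ Q * (z - b) ^ (1 - 1 / p)) :
    ∃ C, 0 < C ∧ ∀ᶠ t in atTop, X t - b - t * deriv f c ≤ C * t ^ (p / (p + 1 + α)) := by
  have hp0 : 0 < p := by linarith
  set m := 1 - 1 / p with hm
  have hm0 : 0 ≤ m := by
    have : 1 / p ≤ 1 := by rw [div_le_one hp0]; exact hp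
    linarith
  set E := 2 + α - (1 + α) * m with hE
  have hE' : E = (p + 1 + α) / p := by rw [hE, hm]; field_simp; ring
  have hE0 : 0 < E := by rw [hE']; positivity
  set C₁ := Q * (2 * l) ^ m * 2 ^ (2 + α) / k with hC₁
  have hC₁0 : 0 < C₁ := by positivity
  set C := max 2 (2 * l * C₁ ^ ((1 + α) / E)) with hC
  refine ⟨C, by positivity, ?_⟩
  filter_upwards [hvL.eventually (gt_mem_nhds (show c < c + r by linarith)),
    hlim.eventually (gt_mem_nhds (show b < b + 1 by linarith)), eventually_ge_atTop T,
    eventually_ge_atTop 1] with t h1 h2 ht ht1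
  have ht0 : 0 < t := by linarith
  set ρ := X t - b - t * deriv f c with hρ
  rcases le_or_gt ρ 2 with h3 | h3
  · have : 1 ≤ t ^ (p / (p + 1 + α)) := Real.one_le_rpow ht1 (by positivity)
    calc ρ ≤ 2 * 1 := by linarith
      _ ≤ C * t ^ (p / (p + 1 + α)) := by gcongr; exact le_max_left _ _
  have h4 : ρ < 2 * (t * (deriv f (vL t) - deriv f c)) := by rw [hρ]; rw [hρ] at h3; linarith
  have h5 : c < vL t := by
    refine hf.strictMono.lt_iff_lt.1 (sub_pos.1 ?_)
    by_contra! hcon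
    have := mul_nonpos_of_nonneg_of_nonpos ht0.le hcon
    linarith
  set s := vL t - c with hs
  have hs0 : 0 < s := by linarith
  have h6 := hpow.deriv_sub_le hf hα hl.le h5.le h1.le
  have h7 := hpow.le_excess hf hα hk.le h5.le h1.le
  rw [← hs] at h6 h7
  have h8 : ρ ≤ 2 * l * t * s ^ (1 + α) := by
    have := mul_le_mul_of_nonneg_left h6 ht0.le
    linarith
  have h9 : t * excess f c (vL t) ≤ Q * ρ ^ m := by
    have h10 := hX.min_left t ht c
    unfold cost at h10
    have h11 := hG (X t - t * deriv f c) (by linarith)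
    have e : X t - t * deriv f c - b = ρ := by rw [hρ]; ring
    rw [e] at h11
    have h12 := hb (X t - t * deriv f (vL t))
    have e2 : X t - t * deriv f (vL t) - b = ρ - t * (deriv f (vL t) - deriv f c) := by
      rw [hρ]; ring
    rw [e2] at h12
    unfold excess
    linarith
  have h10 : s ^ E ≤ C₁ * t ^ (-(1 / p)) := by
    have h11 : ρ ^ m ≤ (2 * l) ^ m * t ^ m * s ^ ((1 + α) * m) := by
      rw [Real.rpow_mul hs0.le, ← Real.mul_rpow (by positivity) ht0.le,
        ← Real.mul_rpow (by positivity) (by positivity)]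
      exact Real.rpow_le_rpow (by linarith) h8 hm0
    have h12 : t * (k * (s / 2) ^ (2 + α)) ≤ Q * ((2 * l) ^ m * t ^ m * s ^ ((1 + α) * m)) :=
      (mul_le_mul_of_nonneg_left h7 ht0.le).trans (h9.trans (by gcongr))
    rw [Real.div_rpow hs0.le (by norm_num)] at h12
    have e1 : t ^ (-(1 / p)) = t ^ m / t := by
      rw [← Real.rpow_sub_one ht0.ne']; congr 1; rw [hm]; ring
    rw [hE, Real.rpow_sub hs0, e1, hC₁, div_mul_div_comm,
      div_le_div_iff₀ (by positivity) (by positivity)]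
    have e2 : t * (k * (s ^ (2 + α) / 2 ^ (2 + α))) = t * k * s ^ (2 + α) / 2 ^ (2 + α) := by ring
    rw [e2, div_le_iff₀ (by positivity)] at h12
    linarith
  have h11 : s ^ (1 + α) ≤ C₁ ^ ((1 + α) / E) * t ^ (-(1 / p) * ((1 + α) / E)) := by
    have h12 := Real.rpow_le_rpow (by positivity) h10 (show 0 ≤ (1 + α) / E by positivity)
    rwa [← Real.rpow_mul hs0.le, mul_div_cancel₀ _ hE0.ne',
      Real.mul_rpow hC₁0.le (by positivity), ← Real.rpow_mul ht0.le] at h12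
  have e3 : t ^ (p / (p + 1 + α)) = t * t ^ (-(1 / p) * ((1 + α) / E)) := by
    rw [mul_comm, ← Real.rpow_add_one ht0.ne']
    congr 1
    rw [hE']; field_simp; ring
  calc ρ ≤ 2 * l * t * s ^ (1 + α) := h8
    _ ≤ 2 * l * t * (C₁ ^ ((1 + α) / E) * t ^ (-(1 / p) * ((1 + α) / E))) := by gcongr
    _ = (2 * l * C₁ ^ ((1 + α) / E)) * t ^ (p / (p + 1 + α)) := by rw [e3]; ring
    _ ≤ C * t ^ (p / (p + 1 + α)) := by gcongr; exact le_max_right _ _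

/-- Over a gap on which `f''` is symmetric to leading order, a shock eventually runs at most halfway
to the right. -/
theorem eventually_width_le (hf : IsFlux f) (hX : IsShockCurve f K T X vL vR) {e h c α N : ℝ}
    (heh : e < h) (he : IsSupport K e c) (hval : K h = K e + c * (h - e))
    (hXl : ∀ t, T ≤ t → e + t * deriv f c < X t) (hXr : ∀ t, T ≤ t → X t < h + t * deriv f c)
    (hlim : Tendsto (fun t => X t - t * deriv f (vL t)) atTop (𝓝 e))
    (hdeg : HasDegeneracy f c α N N) {η : ℝ} (hη : 0 < η) :
    ∀ᶠ t in atTop, X t - (e + t * deriv f c) ≤ (1 + η) * ((h - e) / 2) := by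
  obtain ⟨κ, hκ, hκη⟩ : ∃ κ : ℝ, 0 < κ ∧ (1 + κ) ^ 2 ≤ 1 + η / 2 := by
    have h1 : Tendsto (fun κ : ℝ => (1 + κ) ^ 2) (𝓝[>] 0) (𝓝 ((1 + 0) ^ 2)) :=
      (Continuous.tendsto (by fun_prop) 0).mono_left nhdsWithin_le_nhds
    obtain ⟨κ, h2, h3⟩ := ((h1.eventually (ge_mem_nhds (show (1 + 0 : ℝ) ^ 2 < 1 + η / 2 by
      linarith))).and self_mem_nhdsWithin).exists
    exact ⟨κ, h3, h2⟩
  obtain ⟨r, hr, hsymm⟩ := hdeg.exists_symm hκ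
  have ha1 : deriv f c < deriv f (c + r) := hf.strictMono (by linarith)
  have ha2 : deriv f (c - r) < deriv f c := hf.strictMono (by linarith)
  have hz : Tendsto (fun t : ℝ => (h - e) / t) atTop (𝓝 0) :=
    tendsto_const_nhds.div_atTop tendsto_id
  have hδ0 : e < e + η * (h - e) / 4 := by
    have : 0 < η * (h - e) := mul_pos hη (by linarith)
    linarith
  filter_upwards [eventually_ge_atTop T, hz.eventually (gt_mem_nhds (sub_pos.2 ha1)),
    hz.eventually (gt_mem_nhds (sub_pos.2 ha2)), hlim.eventually (gt_mem_nhds hδ0)]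
    with t ht h1 h2 h3
  have ht0 := hX.pos.trans_le ht
  have h4 := hXl t ht
  have h5 := hXr t ht
  rw [div_lt_iff₀ ht0] at h1 h2
  rcases le_or_gt (vL t) c with h6 | h6
  · have := mul_le_mul_of_nonneg_left (hf.strictMono.monotone h6) ht0.le
    nlinarith
  have hyl := he.le_foot hf ht0 h4 (hX.min_left t ht)
  have h7 : vL t ≤ c + r := by
    refine hf.strictMono.le_iff_le.1 (le_of_mul_le_mul_right (a := t) ?_ ht0)
    linarith
  obtain ⟨w, hw, hwx⟩ := intermediate_value_Icc (show c - r ≤ c by linarith)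
    (f := fun v => t * deriv f v) (by have := hf.continuous_deriv; fun_prop)
    (show X t - h ∈ Icc (t * deriv f (c - r)) (t * deriv f c) from ⟨by linarith, by linarith⟩)
  simp only at hwx
  have h8 : excess f c (vL t) ≤ excess f c w := by
    have h9 := hX.min_left t ht w
    unfold cost at h9
    have e1 : X t - t * deriv f w = h := by linarith
    rw [e1, hval] at h9
    have h10 := he (X t - t * deriv f (vL t))
    refine le_of_mul_le_mul_left (a := t) ?_ ht0
    unfold excess
    have e2 : h - e = X t - t * deriv f w - e := by linarith
    rw [e2] at h9
    linarith
  have h9 := deriv_sub_le_of_excess_le hf hκ.le hsymm (A := vL t - c) (B := c - w)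
    (by linarith) (by linarith) (by linarith [hw.2]) (by linarith [hw.1])
    (by rwa [add_sub_cancel, sub_sub_cancel])
  rw [add_sub_cancel, sub_sub_cancel] at h9
  have h10 : 0 ≤ deriv f c - deriv f w := sub_nonneg.2 (hf.strictMono.monotone hw.2)
  have h11 := h9.trans (mul_le_mul_of_nonneg_right hκη h10)
  have h12 := mul_le_mul_of_nonneg_left h11 ht0.le
  -- In terms of `ρ = X t - e - t * f' c` and `δ`, the displacement of the left foot,
  -- `h12` says `ρ - δ ≤ (1 + η / 2) * (h - e - ρ)`.
  have h13 : X t - (e + t * deriv f c) - η * (h - e) / 4 ≤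
      (1 + η / 2) * (h - e - (X t - (e + t * deriv f c))) := by
    have e3 : t * ((1 + η / 2) * (deriv f c - deriv f w)) =
        (1 + η / 2) * (t * deriv f c - t * deriv f w) := by ring
    rw [e3, hwx] at h12
    have e4 : h - e - (X t - (e + t * deriv f c)) = t * deriv f c - (X t - h) := by ring
    rw [e4]
    linarith
  nlinarith

end IsShockCurve

/-! ### Integrals of powers -/

section Powers

variable {f : ℝ → ℝ} {u w : ℝ → ℝ → ℝ} {q t : ℝ}

/-- The `q`-th power of `lqDist`. -/
def lqPow (f : ℝ → ℝ) (u w : ℝ → ℝ → ℝ) (q a b t : ℝ) : ℝ≥0∞ :=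
  ∫⁻ x in Icc a b, ‖deriv f (u x t) - deriv f (w x t)‖ₑ ^ q

theorem lqDist_eq (hq : 0 < q) (a b : ℝ) :
    lqDist f u w q a b t = lqPow f u w q a b t ^ (1 / q) := by
  unfold lqDist lqPow
  rw [eLpNorm_eq_lintegral_rpow_enorm_toReal (by simpa using hq) ENNReal.ofReal_ne_top,
    ENNReal.toReal_ofReal hq.le]

theorem lqDist_le (hq : 0 < q) {a b W D : ℝ} (hW : 0 ≤ W) (hD : 0 ≤ D)
    (h : lqPow f u w q a b t ≤ ENNReal.ofReal (W * D ^ q)) :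
    lqDist f u w q a b t ≤ ENNReal.ofReal (W ^ (1 / q) * D) := by
  rw [lqDist_eq hq]
  refine (ENNReal.rpow_le_rpow h (by positivity)).trans_eq ?_
  rw [ENNReal.ofReal_rpow_of_nonneg (by positivity) (by positivity),
    Real.mul_rpow hW (by positivity), ← Real.rpow_mul hD, mul_one_div_cancel hq.ne', Real.rpow_one]

theorem enorm_rpow_le {x D : ℝ} (hq : 0 ≤ q) (hD : 0 ≤ D) (h : |x| ≤ D) :
    ‖x‖ₑ ^ q ≤ ENNReal.ofReal (D ^ q) := by
  rw [Real.enorm_eq_ofReal_abs, ← ENNReal.ofReal_rpow_of_nonneg hD hq]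
  exact ENNReal.rpow_le_rpow (ENNReal.ofReal_le_ofReal h) hq

theorem lqPow_le_of_abs_le (hq : 0 ≤ q) {a b D : ℝ} (hab : a ≤ b) (hD : 0 ≤ D)
    (h : ∀ x, a < x → x < b → |deriv f (u x t) - deriv f (w x t)| ≤ D) :
    lqPow f u w q a b t ≤ ENNReal.ofReal ((b - a) * D ^ q) := by
  unfold lqPow
  rw [← setLIntegral_congr Ioo_ae_eq_Icc]
  calc ∫⁻ x in Ioo a b, ‖deriv f (u x t) - deriv f (w x t)‖ₑ ^ q
      ≤ ∫⁻ _ in Ioo a b, ENNReal.ofReal (D ^ q) :=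
        setLIntegral_mono' measurableSet_Ioo fun x hx => enorm_rpow_le hq hD (h x hx.1 hx.2)
    _ = ENNReal.ofReal ((b - a) * D ^ q) := by
        rw [setLIntegral_const, Real.volume_Ioo, mul_comm, ENNReal.ofReal_mul (by linarith)]

theorem lqPow_le_add (a b c : ℝ) :
    lqPow f u w q a c t ≤ lqPow f u w q a b t + lqPow f u w q b c t := by
  refine le_trans (lintegral_mono_set fun x hx => ?_) (lintegral_union_le _ _ _)
  rcases le_total x b with h | h
  · exact Or.inl ⟨hx.1, h⟩
  · exact Or.inr ⟨h, hx.2⟩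

theorem lqPow_mono {a b a' b' : ℝ} (ha : a' ≤ a) (hb : b ≤ b') :
    lqPow f u w q a b t ≤ lqPow f u w q a' b' t :=
  lintegral_mono_set (Icc_subset_Icc ha hb)

theorem LeSmallO.add {F G : ℝ → ℝ≥0∞} {g : ℝ → ℝ} (hF : LeSmallO F g) (hG : LeSmallO G g)
    (hg : ∀ᶠ t in atTop, 0 ≤ g t) : LeSmallO (fun t => F t + G t) g := by
  intro δ hδ
  filter_upwards [hF (δ / 2) (half_pos hδ), hG (δ / 2) (half_pos hδ), hg] with t h1 h2 h3
  refine (add_le_add h1 h2).trans_eq ?_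
  rw [← ENNReal.ofReal_add (by positivity) (by positivity)]
  congr 1; ring

theorem LeSmallO.mono {F G : ℝ → ℝ≥0∞} {g g' : ℝ → ℝ} (hF : LeSmallO F g)
    (h : ∀ᶠ t in atTop, G t ≤ F t) (hg : ∀ᶠ t in atTop, g t ≤ g' t) : LeSmallO G g' := by
  intro δ hδ
  filter_upwards [hF δ hδ, h, hg] with t h1 h2 h3
  exact h2.trans (h1.trans (ENNReal.ofReal_le_ofReal (by gcongr)))

theorem LeSmallO.lqDist (hq : 0 < q) {A B g : ℝ → ℝ} (hg : ∀ᶠ t in atTop, 0 ≤ g t)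
    (h : LeSmallO (fun t => lqPow f u w q (A t) (B t) t) fun t => g t ^ q) :
    LeSmallO (fun t => lqDist f u w q (A t) (B t) t) g := by
  intro δ hδ
  filter_upwards [h (δ ^ q) (by positivity), hg] with t h1 h2
  have := lqDist_le hq (by positivity) h2 h1
  rwa [← Real.rpow_mul hδ.le, mul_one_div_cancel hq.ne', Real.rpow_one] at this

/-- Hölder's inequality for the increments of a primitive. -/
theorem exists_abs_integral_le {ψ : ℝ → ℝ} {p : ℝ} (hp : 1 ≤ p) {S : Set ℝ}
    (hψ : MemLp ψ (ENNReal.ofReal p) (volume.restrict S)) :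
    ∃ Q, 0 < Q ∧ ∀ x y, x ≤ y → Ioc x y ⊆ S →
      |∫ z in x..y, ψ z| ≤ Q * (y - x) ^ (1 - 1 / p) := by
  have hp0 : 0 < p := by linarith
  have hfin := hψ.eLpNorm_ne_top
  refine ⟨(eLpNorm ψ (ENNReal.ofReal p) (volume.restrict S)).toReal + 1, by positivity,
    fun x y hxy hS => ?_⟩
  have hle : volume.restrict (Ioc x y) ≤ volume.restrict S := Measure.restrict_mono hS le_rfl
  have h1 : ‖∫ z in x..y, ψ z‖ₑ ≤ eLpNorm ψ (ENNReal.ofReal p) (volume.restrict S) *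
      ENNReal.ofReal ((y - x) ^ (1 - 1 / p)) := by
    rw [intervalIntegral.integral_of_le hxy]
    refine (enorm_integral_le_lintegral_enorm _).trans ?_
    rw [← eLpNorm_one_eq_lintegral_enorm]
    refine (eLpNorm_le_eLpNorm_mul_rpow_measure_univ (q := ENNReal.ofReal p) (by simpa using hp)
      (hψ.aestronglyMeasurable.mono_measure hle)).trans ?_
    have h0 : 0 ≤ 1 - 1 / p := by
      have : 1 / p ≤ 1 := by rw [div_le_one hp0]; exact hp
      linarith
    rw [Measure.restrict_apply_univ, Real.volume_Ioc, ENNReal.toReal_ofReal hp0.le,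
      ENNReal.toReal_one, div_one, ENNReal.ofReal_rpow_of_nonneg (sub_nonneg.2 hxy) h0]
    gcongr
  have hxy0 : 0 ≤ y - x := sub_nonneg.2 hxy
  rw [Real.enorm_eq_ofReal_abs, ← ENNReal.ofReal_toReal hfin,
    ← ENNReal.ofReal_mul ENNReal.toReal_nonneg, ENNReal.ofReal_le_ofReal_iff (by positivity)] at h1
  refine h1.trans ?_
  gcongr
  linarith

theorem memLp_union_Icc {φ : ℝ → ℝ} (hφ : MemLp φ ∞ volume) {c : ℝ} {p : ℝ≥0∞} {S : Set ℝ}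
    (hS : MeasurableSet S) (h : MemLp (fun x => φ x - c) p (volume.restrict S)) (a b : ℝ) :
    MemLp (fun x => φ x - c) p (volume.restrict (S ∪ Icc a b)) := by
  have h1 : MemLp (fun x => φ x - c) p (volume.restrict (Icc a b \ S)) := by
    have h2 : MemLp (fun x => φ x - c) p (volume.restrict (Icc a b)) :=
      ((hφ.restrict _).sub (memLp_top_const c)).mono_exponent le_top
    exact h2.mono_measure (Measure.restrict_mono sdiff_subset le_rfl)
  have hm : MeasurableSet (Icc a b \ S) := measurableSet_Icc.diff hS
  rw [← memLp_indicator_iff_restrict hS] at h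
  rw [← memLp_indicator_iff_restrict hm] at h1
  rw [← union_sdiff_self, ← memLp_indicator_iff_restrict (hS.union hm),
    indicator_union_of_disjoint disjoint_sdiff_right]
  exact h.add h1

end Powers

/-! ### The wave away from its shocks -/

/-- The data of the asymptotic problem; `M` bounds the solution. -/
structure IsWaveProblem (f φ : ℝ → ℝ) (u w : ℝ → ℝ → ℝ) (M : ℝ) : Prop where
  flux : IsFlux f
  locallyIntegrable : LocallyIntegrable φ
  entropy : IsEntropySolution f φ u
  timeContinuous : IsTimeContinuous u
  bound : ∀ x t, 0 < t → |u x t| ≤ M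
  wave : IsNWave f φ u w

namespace IsWaveProblem

variable {f φ : ℝ → ℝ} {u w : ℝ → ℝ → ℝ} {M : ℝ}

theorem lip (P : IsWaveProblem f φ u w M) (x y : ℝ) :
    |primitive φ x - primitive φ y| ≤ M * |x - y| :=
  P.entropy.abs_primitive_sub_le P.flux P.bound x y

theorem mem_contactSet (P : IsWaveProblem f φ u w M) {x c : ℝ} (h : IsSupport (primitive φ) x c) :
    x ∈ contactSet φ :=
  (mem_contactSet_iff P.lip).2 ⟨c, h⟩

theorem mem_divideValues_iff (P : IsWaveProblem f φ u w M) {x c : ℝ} :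
    c ∈ divideValues f φ x ↔ IsSupport (primitive φ) x c :=
  ConvexLaw.mem_divideValues_iff P.flux P.locallyIntegrable P.lip

/-- On a divide the solution equals the slope of its supporting line. -/
theorem eq_of_isSupport (P : IsWaveProblem f φ u w M) {x c t : ℝ}
    (h : IsSupport (primitive φ) x c) (ht : 0 < t) : u (x + t * deriv f c) t = c := by
  obtain ⟨h1, h2⟩ := P.entropy.isLaxMin_traces P.flux P.timeContinuous ht (x + t * deriv f c)
  rw [h.isLaxMin_iff P.flux ht] at h1 h2
  exact le_antisymm ((P.entropy.le_traceLeft P.flux ht _).trans_eq h1)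
    (h2.ge.trans (P.entropy.traceRight_le P.flux ht _))

theorem foot_of_isSupport (P : IsWaveProblem f φ u w M) {x c t : ℝ}
    (h : IsSupport (primitive φ) x c) (ht : 0 < t) : foot f u (x + t * deriv f c) t = x := by
  rw [foot, P.eq_of_isSupport h ht, add_sub_cancel_right]

theorem le_foot (P : IsWaveProblem f φ u w M) {x₀ c t x : ℝ}
    (h : IsSupport (primitive φ) x₀ c) (ht : 0 < t) (hx : x₀ + t * deriv f c ≤ x) :
    x₀ ≤ foot f u x t :=
  (P.foot_of_isSupport h ht).ge.trans (P.entropy.foot_mono ht hx)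

theorem foot_le (P : IsWaveProblem f φ u w M) {x₀ c t x : ℝ}
    (h : IsSupport (primitive φ) x₀ c) (ht : 0 < t) (hx : x ≤ x₀ + t * deriv f c) :
    foot f u x t ≤ x₀ :=
  (P.entropy.foot_mono ht hx).trans (P.foot_of_isSupport h ht).le

theorem wave_eq_of_isSupport (P : IsWaveProblem f φ u w M) {x c t : ℝ}
    (h : IsSupport (primitive φ) x c) (ht : 0 < t) : w (x + t * deriv f c) t = c := by
  have h1 := P.wave.on_divides x (P.mem_contactSet h) c (P.mem_divideValues_iff.2 h) t ht
  have e : (x + t * deriv f c - x) / t = deriv f c := by field_simp; ring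
  rw [WaveAt, e] at h1
  exact P.flux.strictMono.injective (h1 (mem_range_self c))

/-- At large times the wave is defined wherever the foot of the characteristic is not too far from
the centre of the wave, and the distance of the speeds is that of the foot from the centre. -/
theorem exists_sub_eq (P : IsWaveProblem f φ u w M) : ∃ κ, 0 < κ ∧ ∀ x t ξ, 0 < t →
    |foot f u x t - ξ| ≤ κ * t → WaveAt f w ξ x t →
      deriv f (u x t) - deriv f (w x t) = (ξ - foot f u x t) / t := by
  obtain ⟨κ, hκ, h⟩ := P.flux.exists_near M one_pos
  refine ⟨κ, hκ, fun x t ξ ht h1 h2 => ?_⟩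
  have e : (x - ξ) / t = deriv f (u x t) + (foot f u x t - ξ) / t := by
    unfold foot; field_simp; ring
  obtain ⟨v, -, hv⟩ := h (u x t) (P.bound x t ht) ((foot f u x t - ξ) / t) (by
    rwa [abs_div, abs_of_pos ht, div_le_iff₀ ht])
  rw [h2 ⟨v, by rw [hv, e]⟩, e]
  ring

/-- On an interval where the feet of the characteristics are within `y` of the centre of the wave,
the speeds differ by at most `y / t`. -/
theorem exists_lqPow_le (P : IsWaveProblem f φ u w M) : ∃ κ, 0 < κ ∧ ∀ ξ y t A B, 0 < t →
    A ≤ B → (∀ x, A < x → x < B → WaveAt f w ξ x t ∧ |foot f u x t - ξ| ≤ y) → 0 ≤ y →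
      y ≤ κ * t → (∀ x, A < x → x < B → |deriv f (u x t) - deriv f (w x t)| ≤ y / t) ∧
        ∀ q, 0 < q → lqPow f u w q A B t ≤ ENNReal.ofReal ((B - A) * (y / t) ^ q) := by
  obtain ⟨κ, hκ, h⟩ := P.exists_sub_eq
  refine ⟨κ, hκ, fun ξ y t A B ht hAB hw hy hyκ => ?_⟩
  have key : ∀ x, A < x → x < B → |deriv f (u x t) - deriv f (w x t)| ≤ y / t := by
    intro x h1 h2
    obtain ⟨h3, h4⟩ := hw x h1 h2
    rw [h x t ξ ht (h4.trans hyκ) h3, abs_div, abs_of_pos ht, abs_sub_comm]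
    gcongr
  exact ⟨key, fun q hq => lqPow_le_of_abs_le hq.le hAB (by positivity) key⟩

end IsWaveProblem

/-! ### Gap regions -/

namespace IsWaveProblem

variable {f φ : ℝ → ℝ} {u w : ℝ → ℝ → ℝ} {M e h s : ℝ} {X Y : ℝ → ℝ}

theorem footLeft_mem_gap (P : IsWaveProblem f φ u w M) (hg : IsGap φ e h)
    (hX : IsForwardCharIn f u (gapRegion f φ e h) s X) {t : ℝ} (hs : s ≤ t) (ht : 0 < t) :
    footLeft f u (X t) t ∈ Icc e h := by
  obtain ⟨-, h1, h2⟩ := hX.2 t hs ht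
  simp only at h1 h2
  refine ⟨(hg.isSupport_left P.lip).le_foot P.flux ht h1
    (P.entropy.isLaxMin_traces P.flux P.timeContinuous ht _).1, ?_⟩
  exact (P.entropy.footLeft_le_foot P.flux ht _).trans
    (P.foot_le (hg.isSupport_right P.lip) ht h2.le)

theorem footRight_mem_gap (P : IsWaveProblem f φ u w M) (hg : IsGap φ e h)
    (hX : IsForwardCharIn f u (gapRegion f φ e h) s X) {t : ℝ} (hs : s ≤ t) (ht : 0 < t) :
    footRight f u (X t) t ∈ Icc e h := by
  obtain ⟨-, h1, h2⟩ := hX.2 t hs ht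
  simp only at h1 h2
  refine ⟨(P.le_foot (hg.isSupport_left P.lip) ht h1.le).trans
    (P.entropy.foot_le_footRight P.flux ht _), ?_⟩
  have := (hg.isSupport_right P.lip).reflect.le_foot P.flux.reflect ht (x := -X t)
    (v := -traceRight u (X t) t) (by simp only [deriv_reflect, neg_neg]; linarith)
    (P.entropy.isLaxMin_traces P.flux P.timeContinuous ht _).2.reflect
  simp only [deriv_reflect, neg_neg] at this
  unfold footRight
  linarith

theorem isShockCurve (P : IsWaveProblem f φ u w M) (hX : IsForwardChar f u s X) :
    IsShockCurve f (primitive φ) (max s 1) X (fun t => traceLeft u (X t) t)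
      fun t => traceRight u (X t) t :=
  hX.isShockCurve P.flux P.entropy P.timeContinuous (by positivity) (le_max_left _ _)

theorem lt_of_gap (hX : IsForwardCharIn f u (gapRegion f φ e h) s X) :
    ∀ t, max s 1 ≤ t → e + t * deriv f (gapValue φ e h) < X t := fun t ht =>
  (hX.2 t ((le_max_left _ _).trans ht) (one_pos.trans_le ((le_max_right _ _).trans ht))).2.1

theorem of_gap_lt (hX : IsForwardCharIn f u (gapRegion f φ e h) s X) :
    ∀ t, max s 1 ≤ t → X t < h + t * deriv f (gapValue φ e h) := fun t ht =>
  (hX.2 t ((le_max_left _ _).trans ht) (one_pos.trans_le ((le_max_right _ _).trans ht))).2.2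

theorem tendsto_footLeft_gap (P : IsWaveProblem f φ u w M) (hg : IsGap φ e h)
    (hX : IsForwardCharIn f u (gapRegion f φ e h) s X) :
    Tendsto (fun t => footLeft f u (X t) t) atTop (𝓝 e) :=
  (P.isShockCurve hX.1).tendsto_footLeft_of_gap P.flux P.lip hg.lt (hg.isSupport_left P.lip)
    (hg.isSupport_right P.lip) (fun z _ h1 h2 hz => hg.disjoint z h1 h2 (P.mem_contactSet hz))
    (lt_of_gap hX) (of_gap_lt hX)

theorem tendsto_footRight_gap (P : IsWaveProblem f φ u w M) (hg : IsGap φ e h)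
    (hX : IsForwardCharIn f u (gapRegion f φ e h) s X) :
    Tendsto (fun t => footRight f u (X t) t) atTop (𝓝 h) := by
  have key := (P.isShockCurve hX.1).reflect.tendsto_footLeft_of_gap P.flux.reflect
    (abs_reflect_sub_le P.lip) (neg_lt_neg hg.lt) (hg.isSupport_right P.lip).reflect
    (hg.isSupport_left P.lip).reflect
    (fun z d h1 h2 hz => hg.disjoint (-z) (by linarith) (by linarith)
      (P.mem_contactSet (c := -d) (by simpa using hz.reflect)))
    (fun t ht => by
      have := of_gap_lt hX t ht
      simp only [deriv_reflect, neg_neg] at this ⊢; linarith)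
    (fun t ht => by
      have := lt_of_gap hX t ht
      simp only [deriv_reflect, neg_neg] at this ⊢; linarith)
  have h2 := key.neg
  rw [neg_neg] at h2
  refine h2.congr fun t => ?_
  simp only [deriv_reflect, neg_neg, footRight]
  ring

/-- Two forward characteristics in the same gap region merge. -/
theorem eventually_eq_gap (P : IsWaveProblem f φ u w M) (hg : IsGap φ e h)
    (hX : IsForwardCharIn f u (gapRegion f φ e h) s X) {s' : ℝ}
    (hY : IsForwardCharIn f u (gapRegion f φ e h) s' Y) : ∀ᶠ t in atTop, X t = Y t := by
  have hm1 : e < (e + h) / 2 := by linarith [hg.lt]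
  have hm2 : (e + h) / 2 < h := by linarith [hg.lt]
  filter_upwards [(P.tendsto_footLeft_gap hg hX).eventually (gt_mem_nhds hm1),
    (P.tendsto_footLeft_gap hg hY).eventually (gt_mem_nhds hm1),
    (P.tendsto_footRight_gap hg hX).eventually (lt_mem_nhds hm2),
    (P.tendsto_footRight_gap hg hY).eventually (lt_mem_nhds hm2), eventually_gt_atTop 0]
    with t h1 h2 h3 h4 ht
  rcases lt_trichotomy (X t) (Y t) with hlt | heq | hlt
  · have := P.entropy.footRight_le_footLeft P.flux ht hlt
    linarith
  · exact heq
  · have := P.entropy.footRight_le_footLeft P.flux ht hlt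
    linarith

/-- The estimate of the distance of the speeds over a gap by the displacements of the feet. -/
theorem exists_gap_bounds (P : IsWaveProblem f φ u w M) : ∃ κ, 0 < κ ∧ ∀ e h, IsGap φ e h →
    ∃ X, IsForwardCharIn f u (gapRegion f φ e h) 0 X ∧ ∀ t, 0 < t → h - e ≤ κ * t →
      (∀ x, e + t * deriv f (gapValue φ e h) < x → x < X t →
        |deriv f (u x t) - deriv f (w x t)| ≤ (footLeft f u (X t) t - e) / t) ∧
      (∀ x, X t < x → x < h + t * deriv f (gapValue φ e h) →
        |deriv f (u x t) - deriv f (w x t)| ≤ (h - footRight f u (X t) t) / t) ∧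
      ∀ q, 0 < q → lqPow f u w q (e + t * deriv f (gapValue φ e h))
        (h + t * deriv f (gapValue φ e h)) t ≤
        ENNReal.ofReal ((X t - (e + t * deriv f (gapValue φ e h))) *
          ((footLeft f u (X t) t - e) / t) ^ q +
          (h + t * deriv f (gapValue φ e h) - X t) * ((h - footRight f u (X t) t) / t) ^ q) := by
  obtain ⟨κ, hκ, H⟩ := P.exists_lqPow_le
  refine ⟨κ, hκ, fun e h hg => ?_⟩
  obtain ⟨X, hX, hw⟩ := P.wave.on_gaps e h hg
  refine ⟨X, hX, fun t ht htκ => ?_⟩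
  obtain ⟨-, h1, h2⟩ := hX.2 t ht.le ht
  simp only at h1 h2
  have hl := P.footLeft_mem_gap hg hX ht.le ht
  have hr := P.footRight_mem_gap hg hX ht.le ht
  have hA := H e (footLeft f u (X t) t - e) t _ (X t) ht h1.le (fun x hx1 hx2 => by
    refine ⟨(hw x t ht).1 hx1 hx2, ?_⟩
    have h3 := P.le_foot (hg.isSupport_left P.lip) ht hx1.le
    have h4 := P.entropy.foot_le_footLeft P.flux ht hx2
    rw [abs_of_nonneg (by linarith)]; linarith) (by linarith [hl.1]) (by linarith [hl.2])
  have hB := H h (h - footRight f u (X t) t) t (X t) _ ht h2.le (fun x hx1 hx2 => by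
    refine ⟨(hw x t ht).2 hx1 hx2, ?_⟩
    have h3 := P.foot_le (hg.isSupport_right P.lip) ht hx2.le
    have h4 := P.entropy.footRight_le_foot P.flux ht hx1
    rw [abs_of_nonpos (by linarith)]; linarith) (by linarith [hr.2]) (by linarith [hr.1])
  refine ⟨hA.1, hB.1, fun q hq => (lqPow_le_add _ (X t) _).trans
    ((add_le_add (hA.2 q hq) (hB.2 q hq)).trans_eq (ENNReal.ofReal_add ?_ ?_).symm)⟩
  · have := sub_nonneg.2 hl.1
    have := sub_nonneg.2 h1.le
    positivity
  · have := sub_nonneg.2 hr.2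
    have := sub_nonneg.2 h2.le
    positivity

/-- The bound holds for every characteristic in the region, since it merges with the one chosen in
the wave. -/
theorem eventually_lqPow_gap_le (P : IsWaveProblem f φ u w M) (hg : IsGap φ e h)
    (hX : IsForwardCharIn f u (gapRegion f φ e h) s X) : ∀ᶠ t in atTop, ∀ q, 0 < q →
      lqPow f u w q (e + t * deriv f (gapValue φ e h)) (h + t * deriv f (gapValue φ e h)) t ≤
        ENNReal.ofReal ((X t - (e + t * deriv f (gapValue φ e h))) *
          ((footLeft f u (X t) t - e) / t) ^ q +
          (h + t * deriv f (gapValue φ e h) - X t) * ((h - footRight f u (X t) t) / t) ^ q) := by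
  obtain ⟨κ, hκ, H⟩ := P.exists_gap_bounds
  obtain ⟨Y, hY, HY⟩ := H e h hg
  filter_upwards [P.eventually_eq_gap hg hX hY, eventually_gt_atTop 0,
    (tendsto_id.const_mul_atTop hκ).eventually_ge_atTop (h - e)] with t h1 h2 h3
  rw [h1]
  exact (HY t h2 h3).2.2

/-- Over a gap on which `f''` is symmetric to leading order, the shock eventually runs halfway. -/
theorem eventually_gap_widths_le (P : IsWaveProblem f φ u w M) (hg : IsGap φ e h)
    (hX : IsForwardCharIn f u (gapRegion f φ e h) s X) {α N η : ℝ}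
    (hdeg : HasDegeneracy f (gapValue φ e h) α N N) (hη : 0 < η) : ∀ᶠ t in atTop,
      X t - (e + t * deriv f (gapValue φ e h)) ≤ (1 + η) * ((h - e) / 2) ∧
        h + t * deriv f (gapValue φ e h) - X t ≤ (1 + η) * ((h - e) / 2) := by
  have h1 := lt_of_gap hX
  have h2 := of_gap_lt hX
  have k1 := (P.isShockCurve hX.1).eventually_width_le P.flux hg.lt (hg.isSupport_left P.lip)
    hg.primitive_right h1 h2 (P.tendsto_footLeft_gap hg hX) hdeg hη
  have k2 := (P.isShockCurve hX.1).reflect.eventually_width_le P.flux.reflect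
    (neg_lt_neg hg.lt) (hg.isSupport_right P.lip).reflect
    (by simp only [neg_neg]; linarith [hg.primitive_right])
    (fun t ht => by have := h2 t ht; simp only [deriv_reflect, neg_neg] at this ⊢; linarith)
    (fun t ht => by have := h1 t ht; simp only [deriv_reflect, neg_neg] at this ⊢; linarith)
    ((P.tendsto_footRight_gap hg hX).neg.congr fun t => by
      simp only [deriv_reflect, neg_neg, footRight]; ring) hdeg.reflect hη
  filter_upwards [k1, k2] with t h3 h4
  simp only [deriv_reflect, neg_neg] at h4
  constructor <;> linarith

/-- Growth of the primitive at the left endpoint of a gap gives a rate for the left feet. -/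
theorem exists_footLeft_gap_le (P : IsWaveProblem f φ u w M) (hg : IsGap φ e h)
    (hX : IsForwardCharIn f u (gapRegion f φ e h) s X) {α N₁ N₂ σ : ℝ}
    (hdeg : HasDegeneracy f (gapValue φ e h) α N₁ N₂) (hσ : 0 < σ)
    (hgr : HasGrowth φ (gapValue φ e h) e σ (𝓝[>] e)) : ∃ D, 0 < D ∧ ∀ᶠ t in atTop,
      footLeft f u (X t) t - e ≤ D * t ^ (-(1 / (σ * (1 + α)))) := by
  have h1 := lt_of_gap hX
  have h2 := of_gap_lt hX
  obtain ⟨k, l, r, hk, -, hr, hpow⟩ := hdeg.exists_powerBounds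
  obtain ⟨C, hC, hG⟩ := hgr
  have hG' : ∀ᶠ z in 𝓝[>] e, C * (z - e) ^ (1 + σ) ≤
      primitive φ z - primitive φ e - gapValue φ e h * (z - e) := by
    filter_upwards [hG, self_mem_nhdsWithin] with z hz hz'
    rwa [integral_sub_const_eq P.locallyIntegrable, abs_of_pos (sub_pos.2 (mem_Ioi.1 hz'))] at hz
  obtain ⟨D, hD, H⟩ := (P.isShockCurve hX.1).footLeft_rate P.flux (C' := h - e) (θ := 0)
    (hg.isSupport_left P.lip) h1 (P.tendsto_footLeft_gap hg hX) hdeg.order_nonneg hk hr hpow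
    one_pos (sub_pos.2 hg.lt) (by
      filter_upwards [eventually_ge_atTop (max s 1)] with t ht
      rw [Real.rpow_zero]; linarith [h2 t ht]) hσ hC hG'
  refine ⟨D, hD, H.mono fun t ht => ?_⟩
  have e1 : (0 - 1) / ((1 + α) * σ) = -(1 / (σ * (1 + α))) := by rw [mul_comm (1 + α)]; ring
  rwa [e1] at ht

theorem exists_footRight_gap_le (P : IsWaveProblem f φ u w M) (hg : IsGap φ e h)
    (hX : IsForwardCharIn f u (gapRegion f φ e h) s X) {α N₁ N₂ σ : ℝ}
    (hdeg : HasDegeneracy f (gapValue φ e h) α N₁ N₂) (hσ : 0 < σ)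
    (hgr : HasGrowth φ (gapValue φ e h) h σ (𝓝[<] h)) : ∃ D, 0 < D ∧ ∀ᶠ t in atTop,
      h - footRight f u (X t) t ≤ D * t ^ (-(1 / (σ * (1 + α)))) := by
  have h1 := lt_of_gap hX
  have h2 := of_gap_lt hX
  obtain ⟨k, l, r, hk, -, hr, hpow⟩ := hdeg.reflect.exists_powerBounds
  obtain ⟨C, hC, hG⟩ := hgr
  have hG' : ∀ᶠ z in 𝓝[>] (-h), C * (z - -h) ^ (1 + σ) ≤
      primitive φ (-z) - primitive φ (- -h) - -gapValue φ e h * (z - -h) := by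
    have hm : Tendsto Neg.neg (𝓝[>] (-h)) (𝓝[<] h) := by simpa using tendsto_neg_nhdsGT (a := -h)
    filter_upwards [hm.eventually hG, self_mem_nhdsWithin] with z hz hz'
    have hz' : -h < z := hz'
    rw [integral_sub_const_eq P.locallyIntegrable, abs_of_neg (by linarith)] at hz
    rw [neg_neg, show z - -h = -(-z - h) by ring]
    linarith
  obtain ⟨D, hD, H⟩ := (P.isShockCurve hX.1).reflect.footLeft_rate P.flux.reflect (C' := h - e)
    (θ := 0) (hg.isSupport_right P.lip).reflect
    (fun t ht => by have := h2 t ht; simp only [deriv_reflect, neg_neg] at this ⊢; linarith)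
    ((P.tendsto_footRight_gap hg hX).neg.congr fun t => by
      simp only [deriv_reflect, neg_neg, footRight]; ring) hdeg.order_nonneg hk hr hpow
    one_pos (sub_pos.2 hg.lt) (by
      filter_upwards [eventually_ge_atTop (max s 1)] with t ht
      simp only [deriv_reflect, neg_neg]
      rw [Real.rpow_zero]; linarith [h1 t ht]) hσ hC hG'
  refine ⟨D, hD, H.mono fun t ht => ?_⟩
  simp only [deriv_reflect, neg_neg] at ht
  unfold footRight
  have e1 : (0 - 1) / ((1 + α) * σ) = -(1 / (σ * (1 + α))) := by rw [mul_comm (1 + α)]; ring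
  rw [e1] at ht
  linarith

/-! ### Unbounded regions -/

/-- The information on an unbounded region: between `A t` and `B t`, at distance `ρ t`, the solution
is within `δ t / t` of a centred wave, and `δ` tends to zero. -/
structure _root_.ConvexLaw.IsEndRegion (f : ℝ → ℝ) (u w : ℝ → ℝ → ℝ) (A B ρ δ : ℝ → ℝ) : Prop where
  lqPow_le : ∀ᶠ t in atTop, ∀ q, 0 < q →
    lqPow f u w q (A t) (B t) t ≤ ENNReal.ofReal (ρ t * (δ t / t) ^ q)
  width_nonneg : ∀ᶠ t in atTop, 0 ≤ ρ t
  nonneg : ∀ᶠ t in atTop, 0 ≤ δ t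
  tendsto : Tendsto δ atTop (𝓝 0)

variable {b a : ℝ}

theorem last (P : IsWaveProblem f φ u w M) (hb : IsLUB (contactSet φ) b) :
    ∀ z d, IsSupport (primitive φ) z d → z ≤ b ∧ d ≤ meanLowerRight φ := fun _ _ hz =>
  ⟨hb.1 (P.mem_contactSet hz), hz.le_slope (isSlopeAtTop_right P.lip)⟩

theorem first (P : IsWaveProblem f φ u w M) (ha : IsGLB (contactSet φ) a) :
    ∀ z d, IsSupport (fun x => primitive φ (-x)) z d → z ≤ -a ∧ d ≤ -meanUpperLeft φ :=
  fun z d hz => ⟨by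
    have h1 : IsSupport (primitive φ) (-z) (-d) := by simpa using hz.reflect
    linarith [ha.1 (P.mem_contactSet h1)], hz.le_slope (isSlopeAtTop_left P.lip)⟩

theorem lt_of_right (hX : IsForwardCharIn f u (rightRegion f φ b) s X) :
    ∀ t, max s 1 ≤ t → b + t * deriv f (meanLowerRight φ) < X t := fun t ht =>
  (hX.2 t ((le_max_left _ _).trans ht) (one_pos.trans_le ((le_max_right _ _).trans ht))).2

theorem lt_of_left (hX : IsForwardCharIn f u (leftRegion f φ a) s X) :
    ∀ t, max s 1 ≤ t → X t < a + t * deriv f (meanUpperLeft φ) := fun t ht =>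
  (hX.2 t ((le_max_left _ _).trans ht) (one_pos.trans_le ((le_max_right _ _).trans ht))).2

theorem reflect_lt_of_left (hX : IsForwardCharIn f u (leftRegion f φ a) s X) :
    ∀ t, max s 1 ≤ t → -a + t * deriv (fun v => f (-v)) (-meanUpperLeft φ) < -X t :=
  fun t ht => by
    have := lt_of_left hX t ht
    simp only [deriv_reflect, neg_neg]; linarith

theorem tendsto_footLeft_right (P : IsWaveProblem f φ u w M) (hb : IsLUB (contactSet φ) b)
    (hX : IsForwardCharIn f u (rightRegion f φ b) s X) :
    Tendsto (fun t => footLeft f u (X t) t) atTop (𝓝 b) :=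
  (P.isShockCurve hX.1).tendsto_footLeft_of_last P.flux P.lip (isSupport_meanLowerRight P.lip hb)
    (fun z d hz => (P.last hb z d hz).1) (lt_of_right hX)

theorem tendsto_footRight_left (P : IsWaveProblem f φ u w M) (ha : IsGLB (contactSet φ) a)
    (hX : IsForwardCharIn f u (leftRegion f φ a) s X) :
    Tendsto (fun t => footRight f u (X t) t) atTop (𝓝 a) := by
  have := ((P.isShockCurve hX.1).reflect.tendsto_footLeft_of_last P.flux.reflect
    (abs_reflect_sub_le P.lip) (isSupport_meanUpperLeft P.lip ha).reflect
    (fun z d hz => (P.first ha z d hz).1) (reflect_lt_of_left hX)).neg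
  rw [neg_neg] at this
  refine this.congr fun t => ?_
  simp only [deriv_reflect, neg_neg, footRight]
  ring

/-- Two forward characteristics in the right unbounded region merge. -/
theorem eventually_eq_right (P : IsWaveProblem f φ u w M) (hb : IsLUB (contactSet φ) b)
    (hX : IsForwardCharIn f u (rightRegion f φ b) s X) {s' : ℝ}
    (hY : IsForwardCharIn f u (rightRegion f φ b) s' Y) : ∀ᶠ t in atTop, X t = Y t := by
  obtain ⟨y, hy, h1⟩ := (P.isShockCurve hX.1).exists_lt_footRight_of_last P.flux P.lip
    (isSupport_meanLowerRight P.lip hb) (P.last hb) (lt_of_right hX)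
  obtain ⟨z, hz, h2⟩ := (P.isShockCurve hY.1).exists_lt_footRight_of_last P.flux P.lip
    (isSupport_meanLowerRight P.lip hb) (P.last hb) (lt_of_right hY)
  filter_upwards [h1, h2, (P.tendsto_footLeft_right hb hX).eventually (gt_mem_nhds hz),
    (P.tendsto_footLeft_right hb hY).eventually (gt_mem_nhds hy), eventually_gt_atTop 0]
    with t h3 h4 h5 h6 ht
  rcases lt_trichotomy (X t) (Y t) with hlt | heq | hlt
  · have := P.entropy.footRight_le_footLeft P.flux ht hlt
    unfold footRight at this
    linarith
  · exact heq
  · have := P.entropy.footRight_le_footLeft P.flux ht hlt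
    unfold footRight at this
    linarith

theorem eventually_eq_left (P : IsWaveProblem f φ u w M) (ha : IsGLB (contactSet φ) a)
    (hX : IsForwardCharIn f u (leftRegion f φ a) s X) {s' : ℝ}
    (hY : IsForwardCharIn f u (leftRegion f φ a) s' Y) : ∀ᶠ t in atTop, X t = Y t := by
  obtain ⟨y, hy, h1⟩ := (P.isShockCurve hX.1).reflect.exists_lt_footRight_of_last P.flux.reflect
    (abs_reflect_sub_le P.lip) (isSupport_meanUpperLeft P.lip ha).reflect (P.first ha)
    (reflect_lt_of_left hX)
  obtain ⟨z, hz, h2⟩ := (P.isShockCurve hY.1).reflect.exists_lt_footRight_of_last P.flux.reflect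
    (abs_reflect_sub_le P.lip) (isSupport_meanUpperLeft P.lip ha).reflect (P.first ha)
    (reflect_lt_of_left hY)
  filter_upwards [h1, h2,
    (P.tendsto_footRight_left ha hX).eventually (lt_mem_nhds (show -z < a by linarith)),
    (P.tendsto_footRight_left ha hY).eventually (lt_mem_nhds (show -y < a by linarith)),
    eventually_gt_atTop 0] with t h3 h4 h5 h6 ht
  simp only [deriv_reflect, neg_neg] at h3 h4
  rcases lt_trichotomy (X t) (Y t) with hlt | heq | hlt
  · have := P.entropy.footRight_le_footLeft P.flux ht hlt
    unfold footLeft at this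
    linarith
  · exact heq
  · have := P.entropy.footRight_le_footLeft P.flux ht hlt
    unfold footLeft at this
    linarith

/-- The wave is centred at `b`, and the feet left of `X t` lie between `b` and the left foot at `X t`. -/
theorem isEndRegion_right (P : IsWaveProblem f φ u w M) (hb : IsLUB (contactSet φ) b)
    (hX : IsForwardCharIn f u (rightRegion f φ b) s X) :
    IsEndRegion f u w (fun t => b + t * deriv f (meanLowerRight φ)) X
      (fun t => X t - (b + t * deriv f (meanLowerRight φ)))
      fun t => footLeft f u (X t) t - b := by
  have hs := isSupport_meanLowerRight P.lip hb
  have h0 : ∀ᶠ t in atTop, 0 ≤ footLeft f u (X t) t - b := by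
    filter_upwards [eventually_ge_atTop (max s 1)] with t ht
    have ht0 : 0 < t := one_pos.trans_le ((le_max_right _ _).trans ht)
    exact sub_nonneg.2 (hs.le_foot P.flux ht0 (lt_of_right hX t ht)
      (P.entropy.isLaxMin_traces P.flux P.timeContinuous ht0 _).1)
  have hlim := (P.tendsto_footLeft_right hb hX).sub_const b
  rw [sub_self] at hlim
  refine ⟨?_, ?_, h0, hlim⟩
  · obtain ⟨κ, hκ, H⟩ := P.exists_lqPow_le
    obtain ⟨Y, hY, hw⟩ := P.wave.on_right b hb
    filter_upwards [h0, eventually_ge_atTop (max s 1), P.eventually_eq_right hb hX hY,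
      hlim.eventually (gt_mem_nhds hκ)] with t h1 ht h2 h3
    have ht1 : 1 ≤ t := (le_max_right _ _).trans ht
    have ht0 : 0 < t := one_pos.trans_le ht1
    refine (H b _ t _ (X t) ht0 (lt_of_right hX t ht).le (fun x hx1 hx2 => ?_) h1
      (h3.le.trans (le_mul_of_one_le_right hκ.le ht1))).2
    refine ⟨hw x t ht0 hx1 (h2 ▸ hx2), ?_⟩
    have h4 := P.le_foot hs ht0 hx1.le
    have h5 := P.entropy.foot_le_footLeft P.flux ht0 hx2
    rw [abs_of_nonneg (by linarith)]; linarith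
  · filter_upwards [eventually_ge_atTop (max s 1)] with t ht
    exact sub_nonneg.2 (lt_of_right hX t ht).le

/-- The mirror image of `isEndRegion_right`. -/
theorem isEndRegion_left (P : IsWaveProblem f φ u w M) (ha : IsGLB (contactSet φ) a)
    (hX : IsForwardCharIn f u (leftRegion f φ a) s X) :
    IsEndRegion f u w X (fun t => a + t * deriv f (meanUpperLeft φ))
      (fun t => a + t * deriv f (meanUpperLeft φ) - X t)
      fun t => a - footRight f u (X t) t := by
  have hs := isSupport_meanUpperLeft P.lip ha
  have h0 : ∀ᶠ t in atTop, 0 ≤ a - footRight f u (X t) t := by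
    filter_upwards [eventually_ge_atTop (max s 1)] with t ht
    have ht0 : 0 < t := one_pos.trans_le ((le_max_right _ _).trans ht)
    have := hs.reflect.le_foot P.flux.reflect ht0 (reflect_lt_of_left hX t ht)
      (P.entropy.isLaxMin_traces P.flux P.timeContinuous ht0 _).2.reflect
    simp only [deriv_reflect, neg_neg] at this
    unfold footRight
    linarith
  have hlim := (P.tendsto_footRight_left ha hX).const_sub a
  rw [sub_self] at hlim
  refine ⟨?_, ?_, h0, hlim⟩
  · obtain ⟨κ, hκ, H⟩ := P.exists_lqPow_le
    obtain ⟨Y, hY, hw⟩ := P.wave.on_left a ha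
    filter_upwards [h0, eventually_ge_atTop (max s 1), P.eventually_eq_left ha hX hY,
      hlim.eventually (gt_mem_nhds hκ)] with t h1 ht h2 h3
    have ht1 : 1 ≤ t := (le_max_right _ _).trans ht
    have ht0 : 0 < t := one_pos.trans_le ht1
    refine (H a _ t (X t) _ ht0 (lt_of_left hX t ht).le (fun x hx1 hx2 => ?_) h1
      (h3.le.trans (le_mul_of_one_le_right hκ.le ht1))).2
    refine ⟨hw x t ht0 (h2 ▸ hx1) hx2, ?_⟩
    have h4 := P.foot_le hs ht0 hx2.le
    have h5 := P.entropy.footRight_le_foot P.flux ht0 hx1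
    rw [abs_of_nonpos (by linarith)]; linarith
  · filter_upwards [eventually_ge_atTop (max s 1)] with t ht
    exact sub_nonneg.2 (lt_of_left hX t ht).le

/-- Hölder's inequality bounds the growth of the primitive above its supporting line, and this bounds
the width of the region. -/
theorem exists_width_right_le (P : IsWaveProblem f φ u w M) (hb : IsLUB (contactSet φ) b)
    (hX : IsForwardCharIn f u (rightRegion f φ b) s X) {α N₁ N₂ p : ℝ}
    (hdeg : HasDegeneracy f (meanLowerRight φ) α N₁ N₂) (hp : 1 ≤ p) (hφ : MemLp φ ∞ volume)
    (hφr : MemLp (fun x => φ x - meanLowerRight φ) (ENNReal.ofReal p) (volume.restrict (Ici 0))) :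
    ∃ C, 0 < C ∧ ∀ᶠ t in atTop,
      X t - (b + t * deriv f (meanLowerRight φ)) ≤ C * t ^ (p / (p + 1 + α)) := by
  obtain ⟨k, l, r, hk, hl, hr, hpow⟩ := hdeg.exists_powerBounds
  obtain ⟨Q, hQ, HQ⟩ := exists_abs_integral_le hp (memLp_union_Icc hφ measurableSet_Ici hφr b 0)
  obtain ⟨C, hC, H⟩ := (P.isShockCurve hX.1).width_rate P.flux
    (isSupport_meanLowerRight P.lip hb) (P.tendsto_footLeft_right hb hX)
    ((P.isShockCurve hX.1).tendsto_left_of_last P.flux P.lip (isSupport_meanLowerRight P.lip hb)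
      (P.last hb) (lt_of_right hX)) hdeg.order_nonneg hk hl hr hpow hp hQ (fun z hz => by
        have := HQ b z hz.le fun y hy => by
          rcases le_total 0 y with h1 | h1
          · exact Or.inl h1
          · exact Or.inr ⟨hy.1.le, h1⟩
        rw [integral_sub_const_eq P.locallyIntegrable] at this
        exact (le_abs_self _).trans this)
  exact ⟨C, hC, H.mono fun t ht => by linarith⟩

theorem exists_width_left_le (P : IsWaveProblem f φ u w M) (ha : IsGLB (contactSet φ) a)
    (hX : IsForwardCharIn f u (leftRegion f φ a) s X) {α N₁ N₂ p : ℝ}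
    (hdeg : HasDegeneracy f (meanUpperLeft φ) α N₁ N₂) (hp : 1 ≤ p) (hφ : MemLp φ ∞ volume)
    (hφl : MemLp (fun x => φ x - meanUpperLeft φ) (ENNReal.ofReal p) (volume.restrict (Iic 0))) :
    ∃ C, 0 < C ∧ ∀ᶠ t in atTop,
      a + t * deriv f (meanUpperLeft φ) - X t ≤ C * t ^ (p / (p + 1 + α)) := by
  obtain ⟨k, l, r, hk, hl, hr, hpow⟩ := hdeg.reflect.exists_powerBounds
  obtain ⟨Q, hQ, HQ⟩ := exists_abs_integral_le hp (memLp_union_Icc hφ measurableSet_Iic hφl 0 a)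
  have hs := (isSupport_meanUpperLeft P.lip ha).reflect
  obtain ⟨C, hC, H⟩ := (P.isShockCurve hX.1).reflect.width_rate P.flux.reflect hs
    ((P.tendsto_footRight_left ha hX).neg.congr fun t => by
      simp only [deriv_reflect, neg_neg, footRight]; ring)
    ((P.isShockCurve hX.1).reflect.tendsto_left_of_last P.flux.reflect (abs_reflect_sub_le P.lip)
      hs (P.first ha) (reflect_lt_of_left hX)) hdeg.order_nonneg hk hl hr hpow hp hQ
      (fun z hz => by
        have := HQ (-z) a (by linarith) fun y hy => by
          rcases le_total y 0 with h1 | h1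
          · exact Or.inl h1
          · exact Or.inr ⟨h1, hy.2⟩
        rw [integral_sub_const_eq P.locallyIntegrable] at this
        have h2 := (neg_le_abs _).trans this
        rw [neg_neg, show z - -a = a - -z by ring]
        linarith)
  refine ⟨C, hC, H.mono fun t ht => ?_⟩
  simp only [deriv_reflect, neg_neg] at ht
  linarith

/-- Growth of the primitive at the last point of contact gives a rate for the left feet. -/
theorem exists_footLeft_right_le (P : IsWaveProblem f φ u w M) (hb : IsLUB (contactSet φ) b)
    (hX : IsForwardCharIn f u (rightRegion f φ b) s X) {α N₁ N₂ p σ C' : ℝ}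
    (hdeg : HasDegeneracy f (meanLowerRight φ) α N₁ N₂) (hp : 1 ≤ p) (hC' : 0 < C')
    (hρ : ∀ᶠ t in atTop,
      X t - (b + t * deriv f (meanLowerRight φ)) ≤ C' * t ^ (p / (p + 1 + α)))
    (hσ : 0 < σ) (hgr : HasGrowth φ (meanLowerRight φ) b σ (𝓝[>] b)) : ∃ D, 0 < D ∧
      ∀ᶠ t in atTop, footLeft f u (X t) t - b ≤ D * t ^ (-((1 / σ) / (p + 1 + α))) := by
  have hα := hdeg.order_nonneg
  obtain ⟨k, l, r, hk, -, hr, hpow⟩ := hdeg.exists_powerBounds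
  obtain ⟨C, hC, hG⟩ := hgr
  have hG' : ∀ᶠ z in 𝓝[>] b, C * (z - b) ^ (1 + σ) ≤
      primitive φ z - primitive φ b - meanLowerRight φ * (z - b) := by
    filter_upwards [hG, self_mem_nhdsWithin] with z hz hz'
    rwa [integral_sub_const_eq P.locallyIntegrable, abs_of_pos (sub_pos.2 (mem_Ioi.1 hz'))] at hz
  obtain ⟨D, hD, H⟩ := (P.isShockCurve hX.1).footLeft_rate P.flux
    (isSupport_meanLowerRight P.lip hb) (lt_of_right hX) (P.tendsto_footLeft_right hb hX) hα
    hk hr hpow (θ := p / (p + 1 + α)) (by rw [div_lt_one (by linarith)]; linarith) hC'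
    (hρ.mono fun t ht => by linarith) hσ hC hG'
  refine ⟨D, hD, H.mono fun t ht => ?_⟩
  have e1 : (p / (p + 1 + α) - 1) / ((1 + α) * σ) = -((1 / σ) / (p + 1 + α)) := by
    have h1 : p + 1 + α ≠ 0 := by linarith
    have h2 : 1 + α ≠ 0 := by linarith
    field_simp; ring
  rwa [e1] at ht

theorem exists_footRight_left_le (P : IsWaveProblem f φ u w M) (ha : IsGLB (contactSet φ) a)
    (hX : IsForwardCharIn f u (leftRegion f φ a) s X) {α N₁ N₂ p σ C' : ℝ}
    (hdeg : HasDegeneracy f (meanUpperLeft φ) α N₁ N₂) (hp : 1 ≤ p) (hC' : 0 < C')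
    (hρ : ∀ᶠ t in atTop,
      a + t * deriv f (meanUpperLeft φ) - X t ≤ C' * t ^ (p / (p + 1 + α)))
    (hσ : 0 < σ) (hgr : HasGrowth φ (meanUpperLeft φ) a σ (𝓝[<] a)) : ∃ D, 0 < D ∧
      ∀ᶠ t in atTop, a - footRight f u (X t) t ≤ D * t ^ (-((1 / σ) / (p + 1 + α))) := by
  have hα := hdeg.order_nonneg
  obtain ⟨k, l, r, hk, -, hr, hpow⟩ := hdeg.reflect.exists_powerBounds
  obtain ⟨C, hC, hG⟩ := hgr
  have hG' : ∀ᶠ z in 𝓝[>] (-a), C * (z - -a) ^ (1 + σ) ≤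
      primitive φ (-z) - primitive φ (- -a) - -meanUpperLeft φ * (z - -a) := by
    have hm : Tendsto Neg.neg (𝓝[>] (-a)) (𝓝[<] a) := by simpa using tendsto_neg_nhdsGT (a := -a)
    filter_upwards [hm.eventually hG, self_mem_nhdsWithin] with z hz hz'
    have hz' : -a < z := hz'
    rw [integral_sub_const_eq P.locallyIntegrable, abs_of_neg (by linarith)] at hz
    rw [neg_neg, show z - -a = -(-z - a) by ring]
    linarith
  obtain ⟨D, hD, H⟩ := (P.isShockCurve hX.1).reflect.footLeft_rate P.flux.reflect
    (isSupport_meanUpperLeft P.lip ha).reflect (reflect_lt_of_left hX)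
    ((P.tendsto_footRight_left ha hX).neg.congr fun t => by
      simp only [deriv_reflect, neg_neg, footRight]; ring) hα
    hk hr hpow (θ := p / (p + 1 + α)) (by rw [div_lt_one (by linarith)]; linarith) hC'
    (hρ.mono fun t ht => by simp only [deriv_reflect, neg_neg]; linarith) hσ hC hG'
  refine ⟨D, hD, H.mono fun t ht => ?_⟩
  have e1 : (p / (p + 1 + α) - 1) / ((1 + α) * σ) = -((1 / σ) / (p + 1 + α)) := by
    have h1 : p + 1 + α ≠ 0 := by linarith
    have h2 : 1 + α ≠ 0 := by linarith
    field_simp; ring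
  simp only [deriv_reflect, neg_neg, e1] at ht
  unfold footRight
  linarith

/-- Under the Dini condition the left feet reach the last point of contact in finite time. -/
theorem eventually_footLeft_right_eq (P : IsWaveProblem f φ u w M) (hb : IsLUB (contactSet φ) b)
    (hX : IsForwardCharIn f u (rightRegion f φ b) s X)
    (h : hullDerivRight φ b < diniLowerRight φ b) :
    ∀ᶠ t in atTop, footLeft f u (X t) t - b = 0 := by
  obtain ⟨κ, hκ, hG⟩ := exists_lt_of_hullDerivRight_lt P.locallyIntegrable P.lip hb h
  have hs := isSupport_meanLowerRight P.lip hb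
  refine ((P.isShockCurve hX.1).eventually_footLeft_eq P.flux hs (lt_of_right hX)
    ((P.isShockCurve hX.1).tendsto_div_of_last P.flux P.lip hs (P.last hb) (lt_of_right hX))
    (P.tendsto_footLeft_right hb hX) hκ hG).mono fun t ht => sub_eq_zero.2 ht

theorem eventually_footRight_left_eq (P : IsWaveProblem f φ u w M) (ha : IsGLB (contactSet φ) a)
    (hX : IsForwardCharIn f u (leftRegion f φ a) s X)
    (h : diniUpperLeft φ a < hullDerivLeft φ a) :
    ∀ᶠ t in atTop, a - footRight f u (X t) t = 0 := by
  obtain ⟨κ, hκ, hG⟩ := exists_lt_of_lt_hullDerivLeft P.locallyIntegrable P.lip ha h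
  have hs := (isSupport_meanUpperLeft P.lip ha).reflect
  have hG' : ∀ᶠ z in 𝓝[>] (-a), κ * (z - -a) ≤
      primitive φ (-z) - primitive φ (- -a) - -meanUpperLeft φ * (z - -a) := by
    have hm : Tendsto Neg.neg (𝓝[>] (-a)) (𝓝[<] a) := by simpa using tendsto_neg_nhdsGT (a := -a)
    filter_upwards [hm.eventually hG] with z hz
    rw [neg_neg]
    linarith
  refine ((P.isShockCurve hX.1).reflect.eventually_footLeft_eq P.flux.reflect hs
    (reflect_lt_of_left hX)
    ((P.isShockCurve hX.1).reflect.tendsto_div_of_last P.flux.reflect (abs_reflect_sub_le P.lip)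
      hs (P.first ha) (reflect_lt_of_left hX))
    ((P.tendsto_footRight_left ha hX).neg.congr fun t => by
      simp only [deriv_reflect, neg_neg, footRight]; ring) hκ hG').mono fun t ht => ?_
  simp only [deriv_reflect, neg_neg] at ht
  unfold footRight
  linarith

end IsWaveProblem

/-! ### Between two divides -/

section Inner

variable {f φ : ℝ → ℝ} {u w : ℝ → ℝ → ℝ} {M : ℝ}

theorem IsGap.eq_of_mem {e h e' h' z : ℝ} (hg : IsGap φ e h) (hg' : IsGap φ e' h')
    (hz : z ∈ Ioo e h) (hz' : z ∈ Ioo e' h') : e = e' ∧ h = h' := by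
  have h1 : e' ≤ e := by
    by_contra! hcon
    exact hg.disjoint e' hcon (hz'.1.trans hz.2) hg'.left_mem
  have h2 : e ≤ e' := by
    by_contra! hcon
    exact hg'.disjoint e hcon (hz.1.trans hz'.2) hg.left_mem
  have h3 : h ≤ h' := by
    by_contra! hcon
    exact hg.disjoint h' (hz.1.trans hz'.2) hcon hg'.right_mem
  have h4 : h' ≤ h := by
    by_contra! hcon
    exact hg'.disjoint h (hz'.1.trans hz.2) hcon hg.right_mem
  exact ⟨le_antisymm h2 h1, le_antisymm h3 h4⟩

theorem pairwise_disjoint_gaps (G : Set (ℝ × ℝ)) (hG : ∀ g ∈ G, IsGap φ g.1 g.2) :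
    Pairwise (Function.onFun Disjoint fun g : G => Ioo g.1.1 g.1.2) := by
  intro g g' hne
  rw [Function.onFun, Set.disjoint_left]
  intro z hz hz'
  obtain ⟨h1, h2⟩ := (hG g g.2).eq_of_mem (hG g' g'.2) hz hz'
  exact hne (Subtype.ext (Prod.ext h1 h2))

theorem countable_gaps (G : Set (ℝ × ℝ)) (hG : ∀ g ∈ G, IsGap φ g.1 g.2) : Countable G :=
  (pairwise_disjoint_gaps G hG).countable_of_isOpen_disjoint (fun _ => isOpen_Ioo)
    fun g => nonempty_Ioo.2 (hG g g.2).lt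

theorem summable_gaps {x₁ x₂ : ℝ} (G : Set (ℝ × ℝ))
    (hG : ∀ g ∈ G, IsGap φ g.1 g.2 ∧ x₁ ≤ g.1 ∧ g.2 ≤ x₂) :
    Summable fun g : G => g.1.2 - g.1.1 := by
  have := countable_gaps G fun g hg => (hG g hg).1
  have h1 := measure_iUnion (μ := volume) (pairwise_disjoint_gaps G fun g hg => (hG g hg).1)
    fun g => measurableSet_Ioo
  have h2 : volume (⋃ g : G, Ioo g.1.1 g.1.2) ≤ volume (Icc x₁ x₂) :=
    measure_mono (iUnion_subset fun g z hz =>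
      ⟨(hG g g.2).2.1.trans hz.1.le, hz.2.le.trans (hG g g.2).2.2⟩)
  have h3 : ∑' g : G, volume (Ioo g.1.1 g.1.2) ≠ ⊤ := by
    rw [← h1]
    exact (h2.trans_lt (by simp)).ne
  refine (ENNReal.summable_toReal h3).congr fun g => ?_
  rw [Real.volume_Ioo, ENNReal.toReal_ofReal (sub_nonneg.2 (hG g g.2).1.lt.le)]

/-- Between two divides the distance is `o(1) / t`: over each gap it is, and the gaps have finite
total length. -/
theorem IsWaveProblem.leSmallO_inner (P : IsWaveProblem f φ u w M) {x₁ x₂ c₁ c₂ q : ℝ}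
    (h₁ : IsSupport (primitive φ) x₁ c₁) (h₂ : IsSupport (primitive φ) x₂ c₂) (hq : 0 < q) :
    LeSmallO (fun t => lqPow f u w q (x₁ + t * deriv f c₁) (x₂ + t * deriv f c₂) t)
      fun t => (t ^ (-1 : ℝ)) ^ q := by
  obtain ⟨κ, hκ, H⟩ := P.exists_gap_bounds
  set G : Set (ℝ × ℝ) := {g | IsGap φ g.1 g.2 ∧ x₁ ≤ g.1 ∧ g.2 ≤ x₂} with hGdef
  have hG : ∀ g : G, IsGap φ g.1.1 g.1.2 ∧ x₁ ≤ g.1.1 ∧ g.1.2 ≤ x₂ := fun g => g.2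
  have hcount : Countable G := countable_gaps G fun g hg => hg.1
  have hsum := summable_gaps G fun g hg => hg
  choose X hX hXb using fun g : G => H g.1.1 g.1.2 (hG g).1
  set D : ℝ → G → ℝ := fun t g =>
    max (footLeft f u (X g t) t - g.1.1) (g.1.2 - footRight f u (X g t) t) with hD
  have hD0 : ∀ t, 0 < t → ∀ g, 0 ≤ D t g ∧ D t g ≤ g.1.2 - g.1.1 := by
    intro t ht g
    have h1 := P.footLeft_mem_gap (hG g).1 (hX g) ht.le ht
    have h2 := P.footRight_mem_gap (hG g).1 (hX g) ht.le ht
    exact ⟨le_max_of_le_left (sub_nonneg.2 h1.1),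
      max_le (by linarith [h1.2]) (by linarith [h2.1])⟩
  have hpos : ∀ g : G, 0 < g.1.2 - g.1.1 := fun g => sub_pos.2 (hG g).1.lt
  have hlen : ∀ g : G, g.1.2 - g.1.1 ≤ x₂ - x₁ := fun g => by linarith [(hG g).2.1, (hG g).2.2]
  have hlim : Tendsto (fun t => ∑' g : G, (g.1.2 - g.1.1) * D t g ^ q) atTop (𝓝 0) := by
    have h0 : ∑' _ : G, (0 : ℝ) = 0 := tsum_zero
    rw [← h0]
    refine tendsto_tsum_of_dominated_convergence (hsum.mul_right ((x₂ - x₁) ^ q)) (fun g => ?_) ?_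
    · have h1 := (P.tendsto_footLeft_gap (hG g).1 (hX g)).sub_const g.1.1
      have h2 := (P.tendsto_footRight_gap (hG g).1 (hX g)).const_sub g.1.2
      have h3 := (h1.max h2).rpow_const (p := q) (Or.inr hq.le)
      rw [sub_self, sub_self, max_self, Real.zero_rpow hq.ne'] at h3
      simpa using h3.const_mul (g.1.2 - g.1.1)
    · filter_upwards [eventually_gt_atTop 0] with t ht g
      obtain ⟨h1, h2⟩ := hD0 t ht g
      rw [Real.norm_of_nonneg (mul_nonneg (hpos g).le (by positivity))]
      exact mul_le_mul_of_nonneg_left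
        (Real.rpow_le_rpow h1 (h2.trans (hlen g)) hq.le) (hpos g).le
  intro ε hε
  filter_upwards [hlim.eventually (gt_mem_nhds hε), eventually_gt_atTop 0,
    (tendsto_id.const_mul_atTop hκ).eventually_ge_atTop (x₂ - x₁)] with t h1 ht hκt
  have hterm : ∀ g : G, 0 ≤ (g.1.2 - g.1.1) * (D t g / t) ^ q := fun g =>
    mul_nonneg (hpos g).le (Real.rpow_nonneg (div_nonneg (hD0 t ht g).1 ht.le) q)
  have hdiv : ∀ g : G, (g.1.2 - g.1.1) * (D t g / t) ^ q =
      (g.1.2 - g.1.1) * D t g ^ q * (t ^ (-1 : ℝ)) ^ q := fun g => by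
    rw [div_eq_mul_inv, Real.mul_rpow (hD0 t ht g).1 (by positivity), Real.rpow_neg_one, mul_assoc]
  have hsum2 : Summable fun g : G => (g.1.2 - g.1.1) * D t g ^ q :=
    Summable.of_nonneg_of_le
      (fun g => mul_nonneg (hpos g).le (Real.rpow_nonneg (hD0 t ht g).1 q))
      (fun g => mul_le_mul_of_nonneg_left
        (Real.rpow_le_rpow (hD0 t ht g).1 ((hD0 t ht g).2.trans (hlen g)) hq.le) (hpos g).le)
      (hsum.mul_right ((x₂ - x₁) ^ q))
  set S : G → Set ℝ := fun g => Ioo (g.1.1 + t * deriv f (gapValue φ g.1.1 g.1.2))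
    (g.1.2 + t * deriv f (gapValue φ g.1.1 g.1.2)) with hS
  -- Off the divides and the shocks, each point lies over a gap, where the difference is controlled.
  have hae : ∀ᵐ x, x ∈ Icc (x₁ + t * deriv f c₁) (x₂ + t * deriv f c₂) →
      ‖deriv f (u x t) - deriv f (w x t)‖ₑ ^ q ≤
        ∑' g : G, (S g).indicator (fun _ => ENNReal.ofReal ((D t g / t) ^ q)) x := by
    filter_upwards [(countable_range fun g : G => X g t).ae_notMem volume] with x hx hxI
    rcases exists_divide_or_gap P.flux P.lip h₁ h₂ ht hxI.1 hxI.2 with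
      ⟨z, d, hz, rfl⟩ | ⟨e, h, hg, hge, hgh, hxe, hxh⟩
    · rw [P.eq_of_isSupport hz ht, P.wave_eq_of_isSupport hz ht, sub_self, enorm_zero,
        ENNReal.zero_rpow_of_pos hq]
      exact zero_le
    · set g : G := ⟨(e, h), hg, hge, hgh⟩
      refine le_trans ?_ (ENNReal.le_tsum g)
      rw [indicator_of_mem (show x ∈ S g from ⟨hxe, hxh⟩)]
      refine enorm_rpow_le hq.le (div_nonneg (hD0 t ht g).1 ht.le) ?_
      obtain ⟨h2, h3, -⟩ := hXb g t ht ((hlen g).trans hκt)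
      have hxX : x ≠ X g t := fun hcon => hx ⟨g, hcon.symm⟩
      rcases lt_or_gt_of_ne hxX with h4 | h4
      · exact (h2 x hxe h4).trans (div_le_div_of_nonneg_right (le_max_left _ _) ht.le)
      · exact (h3 x h4 hxh).trans (div_le_div_of_nonneg_right (le_max_right _ _) ht.le)
  calc lqPow f u w q (x₁ + t * deriv f c₁) (x₂ + t * deriv f c₂) t
      ≤ ∫⁻ x in Icc (x₁ + t * deriv f c₁) (x₂ + t * deriv f c₂),
          ∑' g : G, (S g).indicator (fun _ => ENNReal.ofReal ((D t g / t) ^ q)) x :=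
        lintegral_mono_ae ((ae_restrict_iff' measurableSet_Icc).2 hae)
    _ ≤ ∫⁻ x, ∑' g : G, (S g).indicator (fun _ => ENNReal.ofReal ((D t g / t) ^ q)) x :=
        setLIntegral_le_lintegral _ _
    _ = ∑' g : G, ENNReal.ofReal ((g.1.2 - g.1.1) * (D t g / t) ^ q) := by
        rw [lintegral_tsum fun g =>
          (measurable_const.indicator measurableSet_Ioo).aemeasurable]
        refine tsum_congr fun g => ?_
        rw [lintegral_indicator_const measurableSet_Ioo, Real.volume_Ioo, add_sub_add_right_eq_sub,
          mul_comm, ENNReal.ofReal_mul (hpos g).le]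
    _ = ENNReal.ofReal (∑' g : G, (g.1.2 - g.1.1) * (D t g / t) ^ q) := by
        refine (ENNReal.ofReal_tsum_of_nonneg hterm ?_).symm
        simp_rw [hdiv]
        exact hsum2.mul_right _
    _ ≤ ENNReal.ofReal (ε * (t ^ (-1 : ℝ)) ^ q) := by
        refine ENNReal.ofReal_le_ofReal ?_
        simp_rw [hdiv]
        rw [tsum_mul_right]
        gcongr

end Inner

/-! ### Estimates on the regions -/

section Regions

variable {f φ : ℝ → ℝ} {u w : ℝ → ℝ → ℝ} {M q θ : ℝ} {A B ρ δ : ℝ → ℝ}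

theorem rpow_neg_one_mul_rpow {t : ℝ} (ht : 0 < t) (x : ℝ) :
    t ^ (-1 + x) = t ^ x / t := by
  rw [Real.rpow_add ht, Real.rpow_neg_one]; field_simp

theorem IsEndRegion.leBigO (h : IsEndRegion f u w A B ρ δ) (hq : 0 < q) {C : ℝ} (hC : 0 < C)
    (hρ : ∀ᶠ t in atTop, ρ t ≤ C * t ^ θ) :
    LeBigO (fun t => lqDist f u w q (A t) (B t) t) fun t => δ t * t ^ (-1 + θ / q) := by
  refine ⟨C ^ (1 / q), by positivity, ?_⟩
  filter_upwards [h.lqPow_le, h.width_nonneg, h.nonneg, hρ, eventually_gt_atTop 0]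
    with t h1 h2 h3 h4 ht
  refine (lqDist_le hq h2 (by positivity) (h1 q hq)).trans (ENNReal.ofReal_le_ofReal ?_)
  have h5 := Real.rpow_le_rpow h2 h4 (show 0 ≤ 1 / q by positivity)
  rw [Real.mul_rpow hC.le (by positivity), ← Real.rpow_mul ht.le, mul_one_div] at h5
  calc ρ t ^ (1 / q) * (δ t / t) ≤ C ^ (1 / q) * t ^ (θ / q) * (δ t / t) := by gcongr
    _ = C ^ (1 / q) * (δ t * t ^ (-1 + θ / q)) := by
      rw [rpow_neg_one_mul_rpow ht]; ring

theorem LeBigO.mono_right {F : ℝ → ℝ≥0∞} {g g' : ℝ → ℝ} {D : ℝ} (hD : 0 < D) (h : LeBigO F g)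
    (hg : ∀ᶠ t in atTop, g t ≤ D * g' t) : LeBigO F g' := by
  obtain ⟨C, hC, h⟩ := h
  refine ⟨C * D, by positivity, ?_⟩
  filter_upwards [h, hg] with t h1 h2
  refine h1.trans (ENNReal.ofReal_le_ofReal ?_)
  rw [mul_assoc]
  gcongr

/-- A rate for the displacement of the feet improves the exponent. -/
theorem IsEndRegion.leBigO_of_rate (h : IsEndRegion f u w A B ρ δ) (hq : 0 < q) {C : ℝ}
    (hC : 0 < C) (hρ : ∀ᶠ t in atTop, ρ t ≤ C * t ^ θ) {D η : ℝ} (hD : 0 < D)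
    (hδ : ∀ᶠ t in atTop, δ t ≤ D * t ^ (-η)) :
    LeBigO (fun t => lqDist f u w q (A t) (B t) t) fun t => t ^ (-1 + θ / q - η) := by
  refine (h.leBigO hq hC hρ).mono_right hD ?_
  filter_upwards [hδ, eventually_gt_atTop 0] with t h1 ht
  rw [sub_eq_add_neg, Real.rpow_add ht (-1 + θ / q)]
  calc δ t * t ^ (-1 + θ / q) ≤ D * t ^ (-η) * t ^ (-1 + θ / q) := by gcongr
    _ = _ := by ring

/-- The displacement of the feet tends to zero, which turns the bound into a little-o. -/
theorem IsEndRegion.leSmallO (h : IsEndRegion f u w A B ρ δ) (hq : 0 < q) {C : ℝ}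
    (hρ : ∀ᶠ t in atTop, ρ t ≤ C * t ^ θ) :
    LeSmallO (fun t => lqPow f u w q (A t) (B t) t) fun t => (t ^ (-1 + θ / q)) ^ q := by
  intro ε hε
  have h0 := (h.tendsto.rpow_const (p := q) (Or.inr hq.le)).const_mul C
  rw [Real.zero_rpow hq.ne', mul_zero] at h0
  filter_upwards [h.lqPow_le, h.width_nonneg, h.nonneg, hρ, eventually_gt_atTop 0,
    h0.eventually (gt_mem_nhds hε)] with t h1 h2 h3 h4 ht h5
  refine (h1 q hq).trans (ENNReal.ofReal_le_ofReal ?_)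
  have e : (t ^ (-1 + θ / q)) ^ q = t ^ θ / t ^ q := by
    rw [rpow_neg_one_mul_rpow ht, Real.div_rpow (by positivity) ht.le, ← Real.rpow_mul ht.le,
      div_mul_cancel₀ _ hq.ne']
  rw [e, Real.div_rpow h3 ht.le]
  calc ρ t * (δ t ^ q / t ^ q) ≤ C * t ^ θ * (δ t ^ q / t ^ q) := by gcongr
    _ = C * δ t ^ q * (t ^ θ / t ^ q) := by ring
    _ ≤ ε * (t ^ θ / t ^ q) := by gcongr

theorem IsEndRegion.leSmallO_of_eq_zero (h : IsEndRegion f u w A B ρ δ) (hq : 0 < q)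
    (hδ : ∀ᶠ t in atTop, δ t = 0) (g : ℝ → ℝ) :
    LeSmallO (fun t => lqPow f u w q (A t) (B t) t) g := by
  intro ε _
  filter_upwards [h.lqPow_le, hδ] with t h1 h2
  have := h1 q hq
  rw [h2, zero_div, Real.zero_rpow hq.ne', mul_zero, ENNReal.ofReal_zero] at this
  exact this.trans zero_le

theorem eventually_rpow_mono {x y : ℝ} (hq : 0 < q) (h : x ≤ y) :
    ∀ᶠ t : ℝ in atTop, (t ^ x) ^ q ≤ (t ^ y) ^ q := by
  filter_upwards [eventually_ge_atTop 1] with t ht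
  have : 0 < t := by linarith
  exact Real.rpow_le_rpow (by positivity) (Real.rpow_le_rpow_of_exponent_le ht h) hq.le

theorem eventually_rpow_nonneg (x : ℝ) : ∀ᶠ t : ℝ in atTop, 0 ≤ t ^ x := by
  filter_upwards [eventually_ge_atTop 0] with t ht using by positivity

/-- An inner characteristic eventually lies between two divides. -/
theorem IsWaveProblem.exists_divides (P : IsWaveProblem f φ u w M) {X : ℝ → ℝ}
    (hX : IsInnerChar f φ u X) :
    ∃ x₁ c₁ x₂ c₂, IsSupport (primitive φ) x₁ c₁ ∧ IsSupport (primitive φ) x₂ c₂ ∧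
      ∀ᶠ t in atTop, x₁ + t * deriv f c₁ ≤ X t ∧ X t ≤ x₂ + t * deriv f c₂ := by
  rcases hX with ⟨e, h, s, hg, hX⟩ | ⟨x₀, c, hc, hX⟩
  · refine ⟨e, _, h, _, hg.isSupport_left P.lip, hg.isSupport_right P.lip, ?_⟩
    filter_upwards [eventually_ge_atTop (max s 1)] with t ht
    exact ⟨(IsWaveProblem.lt_of_gap hX t ht).le, (IsWaveProblem.of_gap_lt hX t ht).le⟩
  · have hs := P.mem_divideValues_iff.1 hc
    refine ⟨x₀, c, x₀, c, hs, hs, ?_⟩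
    filter_upwards [eventually_gt_atTop 0] with t ht
    exact ⟨(hX t ht).ge, (hX t ht).le⟩

/-- Both widths are asymptotically at most half the length of the gap, which gives the constant. -/
theorem IsWaveProblem.leAsymp_gap (P : IsWaveProblem f φ u w M) {e h s α N : ℝ} {X : ℝ → ℝ}
    (hg : IsGap φ e h) (hdeg : HasDegeneracy f (gapValue φ e h) α N N)
    (hX : IsForwardCharIn f u (gapRegion f φ e h) s X) (hq : 0 < q) :
    LeAsymp
      (fun t => lqDist f u w q (e + t * deriv f (gapValue φ e h))
        (h + t * deriv f (gapValue φ e h)) t)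
      (fun t => ((h - e) / 2) ^ (1 / q) *
        ((footLeft f u (X t) t - e) ^ q + (h - footRight f u (X t) t) ^ q) ^ (1 / q) *
          t ^ (-1 : ℝ)) := by
  intro ε hε
  have hη : 0 < (1 + ε) ^ q - 1 := sub_pos.2 (Real.one_lt_rpow (by linarith) hq)
  filter_upwards [P.eventually_lqPow_gap_le hg hX, P.eventually_gap_widths_le hg hX hdeg hη,
    eventually_ge_atTop s, eventually_gt_atTop 0] with t h1 h2 hs ht
  rw [add_sub_cancel] at h2
  have hl := sub_nonneg.2 (P.footLeft_mem_gap hg hX hs ht).1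
  have hr := sub_nonneg.2 (P.footRight_mem_gap hg hX hs ht).2
  have hhe := sub_pos.2 hg.lt
  set L := footLeft f u (X t) t - e
  set R := h - footRight f u (X t) t
  have h3 : lqPow f u w q (e + t * deriv f (gapValue φ e h))
      (h + t * deriv f (gapValue φ e h)) t ≤ ENNReal.ofReal
        ((h - e) / 2 * (L ^ q + R ^ q) * ((1 + ε) * t ^ (-1 : ℝ)) ^ q) := by
    refine (h1 q hq).trans (ENNReal.ofReal_le_ofReal ?_)
    calc _ ≤ (1 + ε) ^ q * ((h - e) / 2) * (L / t) ^ q +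
          (1 + ε) ^ q * ((h - e) / 2) * (R / t) ^ q := by
          gcongr
          · exact h2.1
          · exact h2.2
      _ = _ := by
        rw [Real.div_rpow hl ht.le, Real.div_rpow hr ht.le, Real.mul_rpow (by linarith)
          (by positivity), Real.rpow_neg_one, Real.inv_rpow ht.le]
        ring
  refine (lqDist_le hq (by positivity) (by positivity) h3).trans_eq ?_
  rw [Real.mul_rpow (by positivity) (by positivity)]
  congr 1; ring

/-- Rates for the feet at both ends give a rate over the whole gap. -/
theorem IsWaveProblem.leBigO_gap (P : IsWaveProblem f φ u w M) {e h α N₁ N₂ σ : ℝ}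
    (hg : IsGap φ e h) (hdeg : HasDegeneracy f (gapValue φ e h) α N₁ N₂) (hσ : 0 < σ)
    (hge : HasGrowth φ (gapValue φ e h) e σ (𝓝[>] e))
    (hgh : HasGrowth φ (gapValue φ e h) h σ (𝓝[<] h)) (hq : 0 < q) :
    LeBigO
      (fun t => lqDist f u w q (e + t * deriv f (gapValue φ e h))
        (h + t * deriv f (gapValue φ e h)) t)
      (fun t => t ^ (-1 - 1 / (σ * (1 + α)))) := by
  obtain ⟨X, hX, -⟩ := P.wave.on_gaps e h hg
  obtain ⟨D₁, hD₁, H₁⟩ := P.exists_footLeft_gap_le hg hX hdeg hσ hge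
  obtain ⟨D₂, hD₂, H₂⟩ := P.exists_footRight_gap_le hg hX hdeg hσ hgh
  have hhe := sub_pos.2 hg.lt
  refine ⟨(h - e) ^ (1 / q) * (D₁ + D₂), by positivity, ?_⟩
  filter_upwards [P.eventually_lqPow_gap_le hg hX, H₁, H₂, eventually_ge_atTop (max 0 1)]
    with t h1 h2 h3 ht1
  have ht : 0 < t := one_pos.trans_le ((le_max_right _ _).trans ht1)
  have hl := sub_nonneg.2 (P.footLeft_mem_gap hg hX ht.le ht).1
  have hr := sub_nonneg.2 (P.footRight_mem_gap hg hX ht.le ht).2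
  have hXl := sub_pos.2 (IsWaveProblem.lt_of_gap hX t ht1)
  have hXr := sub_pos.2 (IsWaveProblem.of_gap_lt hX t ht1)
  set E := t ^ (-(1 / (σ * (1 + α))))
  have hE : 0 < E := by positivity
  have h4 : footLeft f u (X t) t - e ≤ (D₁ + D₂) * E :=
    h2.trans (mul_le_mul_of_nonneg_right (by linarith) hE.le)
  have h5 : h - footRight f u (X t) t ≤ (D₁ + D₂) * E :=
    h3.trans (mul_le_mul_of_nonneg_right (by linarith) hE.le)
  have h6 : lqPow f u w q (e + t * deriv f (gapValue φ e h))
      (h + t * deriv f (gapValue φ e h)) t ≤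
      ENNReal.ofReal ((h - e) * ((D₁ + D₂) * E / t) ^ q) := by
    refine (h1 q hq).trans (ENNReal.ofReal_le_ofReal ?_)
    calc _ ≤ (X t - (e + t * deriv f (gapValue φ e h))) * ((D₁ + D₂) * E / t) ^ q +
          (h + t * deriv f (gapValue φ e h) - X t) * ((D₁ + D₂) * E / t) ^ q := by gcongr
      _ = _ := by ring
  refine (lqDist_le hq hhe.le (by positivity) h6).trans_eq ?_
  congr 1
  rw [sub_eq_add_neg (-1 : ℝ), rpow_neg_one_mul_rpow ht]
  ring

/-- In the right unbounded region and to the left of it up to a divide. -/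
theorem IsWaveProblem.leSmallO_right (P : IsWaveProblem f φ u w M) {b y : ℝ} {X₁ X₂ : ℝ → ℝ}
    (hb : IsLUB (contactSet φ) b) (hX₁ : IsInnerChar f φ u X₁)
    (hq : 0 < q) (hy : -1 ≤ y)
    (h : LeSmallO (fun t => lqPow f u w q (b + t * deriv f (meanLowerRight φ)) (X₂ t) t)
      fun t => (t ^ y) ^ q) :
    LeSmallO (fun t => lqDist f u w q (X₁ t) (X₂ t) t) fun t => t ^ y := by
  obtain ⟨x₁, c₁, _, _, h₁, -, hev⟩ := P.exists_divides hX₁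
  have hin := (P.leSmallO_inner h₁ (isSupport_meanLowerRight P.lip hb) hq).mono
    (Eventually.of_forall fun _ => le_rfl) (eventually_rpow_mono hq hy)
  refine LeSmallO.lqDist hq (eventually_rpow_nonneg y)
    ((hin.add h ((eventually_rpow_nonneg y).mono fun t ht => by positivity)).mono ?_
      (Eventually.of_forall fun _ => le_rfl))
  filter_upwards [hev] with t ht
  exact (lqPow_mono ht.1 le_rfl).trans (lqPow_le_add _ _ _)

theorem IsWaveProblem.leSmallO_left (P : IsWaveProblem f φ u w M) {a y : ℝ} {X₁ X₂ : ℝ → ℝ}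
    (ha : IsGLB (contactSet φ) a) (hX₂ : IsInnerChar f φ u X₂) (hq : 0 < q) (hy : -1 ≤ y)
    (h : LeSmallO (fun t => lqPow f u w q (X₁ t) (a + t * deriv f (meanUpperLeft φ)) t)
      fun t => (t ^ y) ^ q) :
    LeSmallO (fun t => lqDist f u w q (X₁ t) (X₂ t) t) fun t => t ^ y := by
  obtain ⟨_, _, x₂, c₂, -, h₂, hev⟩ := P.exists_divides hX₂
  have hin := (P.leSmallO_inner (isSupport_meanUpperLeft P.lip ha) h₂ hq).mono
    (Eventually.of_forall fun _ => le_rfl) (eventually_rpow_mono hq hy)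
  refine LeSmallO.lqDist hq (eventually_rpow_nonneg y)
    ((h.add hin ((eventually_rpow_nonneg y).mono fun t ht => by positivity)).mono ?_
      (Eventually.of_forall fun _ => le_rfl))
  filter_upwards [hev] with t ht
  exact (lqPow_mono le_rfl ht.2).trans (lqPow_le_add _ _ _)

/-- From one unbounded region to the other, across all divides. -/
theorem IsWaveProblem.leSmallO_left_right (P : IsWaveProblem f φ u w M) {a b y : ℝ}
    {X₁ X₂ : ℝ → ℝ} (ha : IsGLB (contactSet φ) a) (hb : IsLUB (contactSet φ) b)
    (hq : 0 < q) (hy : -1 ≤ y)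
    (hl : LeSmallO (fun t => lqPow f u w q (X₁ t) (a + t * deriv f (meanUpperLeft φ)) t)
      fun t => (t ^ y) ^ q)
    (hr : LeSmallO (fun t => lqPow f u w q (b + t * deriv f (meanLowerRight φ)) (X₂ t) t)
      fun t => (t ^ y) ^ q) :
    LeSmallO (fun t => lqDist f u w q (X₁ t) (X₂ t) t) fun t => t ^ y := by
  have hin := (P.leSmallO_inner (isSupport_meanUpperLeft P.lip ha)
    (isSupport_meanLowerRight P.lip hb) hq).mono
    (Eventually.of_forall fun _ => le_rfl) (eventually_rpow_mono hq hy)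
  have hnn : ∀ᶠ t : ℝ in atTop, 0 ≤ (t ^ y) ^ q :=
    (eventually_rpow_nonneg y).mono fun t ht => by positivity
  refine LeSmallO.lqDist hq (eventually_rpow_nonneg y)
    ((hl.add (hin.add hr hnn) hnn).mono (Eventually.of_forall fun t => ?_)
      (Eventually.of_forall fun _ => le_rfl))
  exact (lqPow_le_add _ _ _).trans (by gcongr; exact lqPow_le_add _ _ _)

end Regions

end ConvexLaw

end

theorem theorem7p4
    (f φ : ℝ → ℝ) (hf : ConvexLaw.IsFlux f) (hφ : MemLp φ ∞ volume)
    (hdiv : ConvexLaw.meanUpperLeft φ < ConvexLaw.meanLowerRight φ ∨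
      (ConvexLaw.meanUpperLeft φ = ConvexLaw.meanLowerRight φ ∧
        (ConvexLaw.contactSet φ).Nonempty))
    (p : ℝ) (hp : 1 ≤ p)
    (hφr : MemLp (fun x => φ x - ConvexLaw.meanLowerRight φ) (ENNReal.ofReal p)
      (volume.restrict (Ici 0)))
    (hφl : MemLp (fun x => φ x - ConvexLaw.meanUpperLeft φ) (ENNReal.ofReal p)
      (volume.restrict (Iic 0)))
    (u : ℝ → ℝ → ℝ) (hu : ConvexLaw.IsEntropySolution f φ u)
    (hut : ConvexLaw.IsTimeContinuous u)
    (w : ℝ → ℝ → ℝ) (hw : ConvexLaw.IsNWave f φ u w) :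
    -- `u = w` on the union of all divides
    (∀ P ∈ ConvexLaw.divideSet f φ, u P.1 P.2 = w P.1 P.2) ∧
    -- bounded gaps
    (∀ e h, ConvexLaw.IsGap φ e h →
      (∀ α N, ConvexLaw.HasDegeneracy f (ConvexLaw.gapValue φ e h) α N N →
        ∀ s X, ConvexLaw.IsForwardCharIn f u (ConvexLaw.gapRegion f φ e h) s X →
        ∀ q, 0 < q →
        ConvexLaw.LeAsymp
          (fun t => ConvexLaw.lqDist f u w q
            (e + t * deriv f (ConvexLaw.gapValue φ e h))
            (h + t * deriv f (ConvexLaw.gapValue φ e h)) t)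
          (fun t => ((h - e) / 2) ^ (1 / q) *
            ((ConvexLaw.footLeft f u (X t) t - e) ^ q +
              (h - ConvexLaw.footRight f u (X t) t) ^ q) ^ (1 / q) * t ^ (-1 : ℝ))) ∧
      (∀ α N₁ N₂, ConvexLaw.HasDegeneracy f (ConvexLaw.gapValue φ e h) α N₁ N₂ →
        ∀ σ, 0 < σ →
        ConvexLaw.HasGrowth φ (ConvexLaw.gapValue φ e h) e σ (𝓝[>] e) →
        ConvexLaw.HasGrowth φ (ConvexLaw.gapValue φ e h) h σ (𝓝[<] h) →
        ∀ q, 0 < q →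
        ConvexLaw.LeBigO
          (fun t => ConvexLaw.lqDist f u w q
            (e + t * deriv f (ConvexLaw.gapValue φ e h))
            (h + t * deriv f (ConvexLaw.gapValue φ e h)) t)
          (fun t => t ^ (-1 - 1 / (σ * (1 + α)))))) ∧
    -- the right unbounded region
    (∀ b, IsLUB (ConvexLaw.contactSet φ) b →
      ∀ s X, ConvexLaw.IsForwardCharIn f u (ConvexLaw.rightRegion f φ b) s X →
      ∀ α N₁ N₂, ConvexLaw.HasDegeneracy f (ConvexLaw.meanLowerRight φ) α N₁ N₂ →
      ∀ q, p / (p + 1 + α) < q →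
        ConvexLaw.LeBigO
          (fun t => ConvexLaw.lqDist f u w q
            (b + t * deriv f (ConvexLaw.meanLowerRight φ)) (X t) t)
          (fun t => (ConvexLaw.footLeft f u (X t) t - b) *
            t ^ (-1 + (p / q) / (p + 1 + α))) ∧
        (∀ σ, 0 < σ → ConvexLaw.HasGrowth φ (ConvexLaw.meanLowerRight φ) b σ (𝓝[>] b) →
          ConvexLaw.LeBigO
            (fun t => ConvexLaw.lqDist f u w q
              (b + t * deriv f (ConvexLaw.meanLowerRight φ)) (X t) t)
            (fun t => t ^ (-1 + (p / q) / (p + 1 + α) - (1 / σ) / (p + 1 + α))))) ∧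
    -- the left unbounded region
    (∀ a, IsGLB (ConvexLaw.contactSet φ) a →
      ∀ s X, ConvexLaw.IsForwardCharIn f u (ConvexLaw.leftRegion f φ a) s X →
      ∀ α N₁ N₂, ConvexLaw.HasDegeneracy f (ConvexLaw.meanUpperLeft φ) α N₁ N₂ →
      ∀ q, p / (p + 1 + α) < q →
        ConvexLaw.LeBigO
          (fun t => ConvexLaw.lqDist f u w q
            (X t) (a + t * deriv f (ConvexLaw.meanUpperLeft φ)) t)
          (fun t => (a - ConvexLaw.footRight f u (X t) t) *
            t ^ (-1 + (p / q) / (p + 1 + α))) ∧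
        (∀ σ, 0 < σ → ConvexLaw.HasGrowth φ (ConvexLaw.meanUpperLeft φ) a σ (𝓝[<] a) →
          ConvexLaw.LeBigO
            (fun t => ConvexLaw.lqDist f u w q
              (X t) (a + t * deriv f (ConvexLaw.meanUpperLeft φ)) t)
            (fun t => t ^ (-1 + (p / q) / (p + 1 + α) - (1 / σ) / (p + 1 + α))))) ∧
    -- between two divides
    (∀ x₁ x₂, ∀ c₁ ∈ ConvexLaw.divideValues f φ x₁, ∀ c₂ ∈ ConvexLaw.divideValues f φ x₂,
      (∀ t, 0 < t → x₁ + t * deriv f c₁ < x₂ + t * deriv f c₂) →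
      ∀ q, 0 < q →
      ConvexLaw.LeSmallO
        (fun t => ConvexLaw.lqDist f u w q (x₁ + t * deriv f c₁) (x₂ + t * deriv f c₂) t)
        (fun t => t ^ (-1 : ℝ))) ∧
    -- left curve in the left unbounded region, right curve away from the unbounded regions
    (∀ a, IsGLB (ConvexLaw.contactSet φ) a →
      ∀ s₁ X₁, ConvexLaw.IsForwardCharIn f u (ConvexLaw.leftRegion f φ a) s₁ X₁ →
      ∀ X₂, ConvexLaw.IsInnerChar f φ u X₂ →
      (∀ α N₁ N₂, ConvexLaw.HasDegeneracy f (ConvexLaw.meanUpperLeft φ) α N₁ N₂ →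
        ∀ q, p / (p + 1 + α) < q →
        ConvexLaw.LeSmallO (fun t => ConvexLaw.lqDist f u w q (X₁ t) (X₂ t) t)
          (fun t => t ^ (-1 + (p / q) / (p + 1 + α)))) ∧
      (ConvexLaw.diniUpperLeft φ a < ConvexLaw.hullDerivLeft φ a → ∀ q, 0 < q →
        ConvexLaw.LeSmallO (fun t => ConvexLaw.lqDist f u w q (X₁ t) (X₂ t) t)
          (fun t => t ^ (-1 : ℝ)))) ∧
    -- left curve away from the unbounded regions, right curve in the right unbounded region
    (∀ b, IsLUB (ConvexLaw.contactSet φ) b →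
      ∀ X₁, ConvexLaw.IsInnerChar f φ u X₁ →
      ∀ s₂ X₂, ConvexLaw.IsForwardCharIn f u (ConvexLaw.rightRegion f φ b) s₂ X₂ →
      (∀ α N₁ N₂, ConvexLaw.HasDegeneracy f (ConvexLaw.meanLowerRight φ) α N₁ N₂ →
        ∀ q, p / (p + 1 + α) < q →
        ConvexLaw.LeSmallO (fun t => ConvexLaw.lqDist f u w q (X₁ t) (X₂ t) t)
          (fun t => t ^ (-1 + (p / q) / (p + 1 + α)))) ∧
      (ConvexLaw.hullDerivRight φ b < ConvexLaw.diniLowerRight φ b → ∀ q, 0 < q →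
        ConvexLaw.LeSmallO (fun t => ConvexLaw.lqDist f u w q (X₁ t) (X₂ t) t)
          (fun t => t ^ (-1 : ℝ)))) ∧
    -- both curves in the unbounded regions
    (∀ a b, IsGLB (ConvexLaw.contactSet φ) a → IsLUB (ConvexLaw.contactSet φ) b →
      ∀ s₁ X₁, ConvexLaw.IsForwardCharIn f u (ConvexLaw.leftRegion f φ a) s₁ X₁ →
      ∀ s₂ X₂, ConvexLaw.IsForwardCharIn f u (ConvexLaw.rightRegion f φ b) s₂ X₂ →
      (∀ αl αr N₁ N₂ N₃ N₄, ConvexLaw.HasDegeneracy f (ConvexLaw.meanUpperLeft φ) αl N₁ N₂ →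
        ConvexLaw.HasDegeneracy f (ConvexLaw.meanLowerRight φ) αr N₃ N₄ →
        ∀ q, p / (p + 1 + min αl αr) < q →
        ConvexLaw.LeSmallO (fun t => ConvexLaw.lqDist f u w q (X₁ t) (X₂ t) t)
          (fun t => t ^ (-1 + (p / q) / (p + 1 + min αl αr)))) ∧
      (ConvexLaw.diniUpperLeft φ a < ConvexLaw.hullDerivLeft φ a →
        ConvexLaw.hullDerivRight φ b < ConvexLaw.diniLowerRight φ b → ∀ q, 0 < q →
        ConvexLaw.LeSmallO (fun t => ConvexLaw.lqDist f u w q (X₁ t) (X₂ t) t)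
          (fun t => t ^ (-1 : ℝ)))) := by
  obtain ⟨M, hM⟩ := hu.bounded
  have P : ConvexLaw.IsWaveProblem f φ u w M :=
    ⟨hf, ConvexLaw.locallyIntegrable_of_memLp_top hφ, hu, hut, hM, hw⟩
  have hp0 : 0 < p := by linarith
  have hqpos : ∀ α q : ℝ, 0 ≤ α → p / (p + 1 + α) < q → 0 < q := fun α q hα hq =>
    (by positivity : 0 < p / (p + 1 + α)).trans hq
  have he : ∀ α q : ℝ, -1 + (p / q) / (p + 1 + α) = -1 + (p / (p + 1 + α)) / q :=
    fun α q => by rw [div_right_comm]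
  have hy : ∀ α q : ℝ, 0 ≤ α → 0 < q → -1 ≤ -1 + (p / q) / (p + 1 + α) := fun α q hα hq => by
    have : 0 ≤ (p / q) / (p + 1 + α) := by positivity
    linarith
  refine ⟨?_, ?_, ?_, ?_, ?_, ?_, ?_, ?_⟩
  · rintro ⟨x, t⟩ ⟨ht, x₀, -, c, hc, hx⟩
    simp only at ht hx ⊢
    have hs := P.mem_divideValues_iff.1 hc
    rw [hx, P.eq_of_isSupport hs ht, P.wave_eq_of_isSupport hs ht]
  · intro e h hg
    exact ⟨fun α N hdeg s X hX q hq => P.leAsymp_gap hg hdeg hX hq,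
      fun α N₁ N₂ hdeg σ hσ hge hgh q hq => P.leBigO_gap hg hdeg hσ hge hgh hq⟩
  · intro b hb s X hX α N₁ N₂ hdeg q hq
    obtain ⟨C, hC, hρ⟩ := P.exists_width_right_le hb hX hdeg hp hφ hφr
    have hq0 := hqpos α q hdeg.order_nonneg hq
    have hE := P.isEndRegion_right hb hX
    simp only [he]
    refine ⟨hE.leBigO hq0 hC hρ, fun σ hσ hgr => ?_⟩
    obtain ⟨D, hD, hδ⟩ := P.exists_footLeft_right_le hb hX hdeg hp hC hρ hσ hgr
    exact hE.leBigO_of_rate hq0 hC hρ hD hδ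
  · intro a ha s X hX α N₁ N₂ hdeg q hq
    obtain ⟨C, hC, hρ⟩ := P.exists_width_left_le ha hX hdeg hp hφ hφl
    have hq0 := hqpos α q hdeg.order_nonneg hq
    have hE := P.isEndRegion_left ha hX
    simp only [he]
    refine ⟨hE.leBigO hq0 hC hρ, fun σ hσ hgr => ?_⟩
    obtain ⟨D, hD, hδ⟩ := P.exists_footRight_left_le ha hX hdeg hp hC hρ hσ hgr
    exact hE.leBigO_of_rate hq0 hC hρ hD hδ
  · intro x₁ x₂ c₁ hc₁ c₂ hc₂ _ q hq
    exact ConvexLaw.LeSmallO.lqDist hq (ConvexLaw.eventually_rpow_nonneg _)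
      (P.leSmallO_inner (P.mem_divideValues_iff.1 hc₁) (P.mem_divideValues_iff.1 hc₂) hq)
  · intro a ha s₁ X₁ hX₁ X₂ hX₂
    have hE := P.isEndRegion_left ha hX₁
    refine ⟨fun α N₁ N₂ hdeg q hq => ?_, fun hd q hq => ?_⟩
    · obtain ⟨C, hC, hρ⟩ := P.exists_width_left_le ha hX₁ hdeg hp hφ hφl
      have hα := hdeg.order_nonneg
      have hq0 := hqpos α q hα hq
      refine P.leSmallO_left ha hX₂ hq0 (hy α q hα hq0) ?_
      rw [he]
      exact hE.leSmallO hq0 hρ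
    · exact P.leSmallO_left ha hX₂ hq le_rfl
        (hE.leSmallO_of_eq_zero hq (P.eventually_footRight_left_eq ha hX₁ hd) _)
  · intro b hb X₁ hX₁ s₂ X₂ hX₂
    have hE := P.isEndRegion_right hb hX₂
    refine ⟨fun α N₁ N₂ hdeg q hq => ?_, fun hd q hq => ?_⟩
    · obtain ⟨C, hC, hρ⟩ := P.exists_width_right_le hb hX₂ hdeg hp hφ hφr
      have hα := hdeg.order_nonneg
      have hq0 := hqpos α q hα hq
      refine P.leSmallO_right hb hX₁ hq0 (hy α q hα hq0) ?_
      rw [he]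
      exact hE.leSmallO hq0 hρ
    · exact P.leSmallO_right hb hX₁ hq le_rfl
        (hE.leSmallO_of_eq_zero hq (P.eventually_footLeft_right_eq hb hX₂ hd) _)
  · intro a b ha hb s₁ X₁ hX₁ s₂ X₂ hX₂
    have hEl := P.isEndRegion_left ha hX₁
    have hEr := P.isEndRegion_right hb hX₂
    refine ⟨fun αl αr N₁ N₂ N₃ N₄ hdl hdr q hq => ?_, fun hd₁ hd₂ q hq => ?_⟩
    · obtain ⟨Cl, -, hρl⟩ := P.exists_width_left_le ha hX₁ hdl hp hφ hφl
      obtain ⟨Cr, -, hρr⟩ := P.exists_width_right_le hb hX₂ hdr hp hφ hφr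
      have hα : 0 ≤ min αl αr := le_min hdl.order_nonneg hdr.order_nonneg
      have hq0 := hqpos _ q hα hq
      have hmono : ∀ α, min αl αr ≤ α →
          -1 + (p / (p + 1 + α)) / q ≤ -1 + (p / (p + 1 + min αl αr)) / q := fun α h => by gcongr
      refine P.leSmallO_left_right ha hb hq0 (hy _ q hα hq0) ?_ ?_
      · rw [he]
        exact (hEl.leSmallO hq0 hρl).mono (Eventually.of_forall fun _ => le_rfl)
          (ConvexLaw.eventually_rpow_mono hq0 (hmono αl (min_le_left _ _)))
      · rw [he]
        exact (hEr.leSmallO hq0 hρr).mono (Eventually.of_forall fun _ => le_rfl)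
          (ConvexLaw.eventually_rpow_mono hq0 (hmono αr (min_le_right _ _)))
    · exact P.leSmallO_left_right ha hb hq le_rfl
        (hEl.leSmallO_of_eq_zero hq (P.eventually_footRight_left_eq ha hX₁ hd₁) _)
        (hEr.leSmallO_of_eq_zero hq (P.eventually_footLeft_right_eq hb hX₂ hd₂) _)
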